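/- Let $(P,\omega)$ be a (finite-dimensional, Hausdorff, second countable) symplectic manifold. For $h\in C^\infty(P)$ let $X_h$ be the Hamiltonian vector field, $X_h\lrcorner\,\omega=dh$, and let $\{f,k\}=\omega(X_f,X_k)=X_k\cdot f$. Let $G$ be a connected Lie group with Lie algebra $\mathfrak g$, acting smoothly and properly on $P$ by symplectic diffeomorphisms $\phi_g$, with a smooth momentum map $j:P\to\mathfrak g^*$, i.e. $X_\xi\lrcorner\,\omega=d\langle j,\xi\rangle$ for every $\xi\in\mathfrak g$, where $X_\xi$ is the infinitesimal generator of the action (no equivariance of $j$ is required). Fix a basis $e_1,\dots,e_n$ of $\mathfrak g$ and put $j_a=\langle j,e_a\rangle$. Let $h\in C^\infty(P)$, not necessarily $G$-invariant, satisfy $$\{j_a,h\}=f_a(j_1,\dots,j_n),\qquad a=1,\dots,n,$$ for some functions $f_a$ on $\mathfrak g^*\cong\mathbb R^n$ that are smooth near the points of $j(P)$. Let $\rho:P\to\bar P=P/G$ be the orbit map. Give $\bar P$ the quotient topology, let $C^\infty(P)^G$ be the algebra of smooth $G$-invariant functions on $P$, and let $C^\infty(\bar P)$ be the algebra of functions $\bar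 f$ with $\bar f\circ\rho\in C^\infty(P)$, so that $\rho^*:C^\infty(\bar P)\cong C^\infty(P)^G$. An integral curve of a derivation $D$ of $C^\infty(\bar P)$ is a map $c$ from an interval $I\ni 0$ to $\bar P$ with $\frac{d}{dt}\bar f(c(t))=(D\bar f)(c(t))$ for all $\bar f\in C^\infty(\bar P)$ and $t\in I$. The derivation $D$ is called a vector field on $\bar P$ if there is a unique maximal integral curve $t\mapsto(\exp tD)(x)$ through every $x\in\bar P$, and every point of $\bar P$ has an open neighbourhood $U$ such that, for all sufficiently small $|t|$, $\exp tD$ is defined on $U$ and is a diffeomorphism from $U$ onto an open subset of $\bar P$ (with respect to the functions that agree locally with elements of $C^\infty(\bar P)$). Then: 1. For every $g\in G$ the vector field $\phi_{g*}X_h-X_h$ is tangent to the $G$-orbits: its value at $p$ lies in $\{X_\xi(p):\xi\in\mathfrak g\}$ for every $p\in P$. 2. $X_h$ descends to $\bar P$: there is a derivation $\bar X=\rho_*X_h$ of $C^\infty(\bar P)$ with $(\bar X\bar f)\circ\rho=X_h\cdot(\bar f\circ\rho)$ for all $\bar f\in C^\infty(\bar P)$, and $\bar X$ is a vector field on $\bar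 P$. 3. $C^\infty(P)^G$ is closed under the Poisson bracket, and $\delta:f\mapsto\{f,h\}$ maps $C^\infty(P)^G$ to itself and is an (infinitesimal) Poisson morphism of it: it is linear, $\delta(fk)=\delta(f)k+f\delta(k)$ and $\delta\{f,k\}=\{\delta f,k\}+\{f,\delta k\}$ for all $f,k\in C^\infty(P)^G$. If $h$ is not $G$-invariant, this morphism is outer, in the sense that it is the bracket with a function $h\in C^\infty(P)$ that does not belong to $C^\infty(P)^G$. 4. The reduced dynamics on $\bar P$ is $\dot f=\{f,h\}$, $f\in C^\infty(P)^G\cong C^\infty(\bar P)$: a map $c$ from an interval $I\ni0$ to $\bar P$ is an integral curve of $\bar X$ if and only if $\frac{d}{dt}\bar f(c(t))=\overline{\{f,h\}}(c(t))$ for all $f\in C^\infty(P)^G$ and $t\in I$, where $\bar k\in C^\infty(\bar P)$ denotes the function with $\bar k\circ\rho=k$. -/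

import Mathlib

open scoped Manifold ContDiff Topology

noncomputable section

namespace NotQuiteHamiltonian

/-! ### Calculus on a manifold -/

section Calculus

variable {E : Type*} [NormedAddCommGroup E] [NormedSpace ℝ E]
  {P : Type*} [TopologicalSpace P] [ChartedSpace E P]

/-- Smooth real functions on the manifold `P`. -/
def SmoothFun (f : P → ℝ) : Prop := ContMDiff 𝓘(ℝ, E) 𝓘(ℝ, ℝ) ∞ f

/-- The differential of a real function on `P`. -/
def diff (f : P → ℝ) (p : P) : TangentSpace 𝓘(ℝ, E) p →L[ℝ] ℝ :=
  mfderiv 𝓘(ℝ, E) 𝓘(ℝ, ℝ) f p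

/-- Smooth (globally defined) vector fields on `P`. -/
def SmoothVectorField [IsManifold 𝓘(ℝ, E) 1 P] (X : ∀ p : P, TangentSpace 𝓘(ℝ, E) p) : Prop :=
  ContMDiff 𝓘(ℝ, E) 𝓘(ℝ, E).tangent ∞ (fun p => (⟨p, X p⟩ : TangentBundle 𝓘(ℝ, E) P))

end Calculus

/-! ### Symplectic manifolds, Hamiltonian vector fields, Poisson bracket -/

section Symplectic

variable (E : Type*) [NormedAddCommGroup E] [NormedSpace ℝ E]
  (P : Type*) [TopologicalSpace P] [ChartedSpace E P] [IsManifold 𝓘(ℝ, E) ∞ P]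

/-- A symplectic form: a smooth, alternating, nondegenerate and closed 2-form. Closedness is
`dΩ = 0` in the invariant form of the exterior derivative, evaluated on smooth vector fields. -/
structure SymplecticForm where
  toFun (p : P) : TangentSpace 𝓘(ℝ, E) p →L[ℝ] TangentSpace 𝓘(ℝ, E) p →L[ℝ] ℝ
  smooth : ContMDiff 𝓘(ℝ, E) (𝓘(ℝ, E).prod 𝓘(ℝ, E →L[ℝ] E →L[ℝ] ℝ)) ∞
    (fun p => Bundle.TotalSpace.mk' (E →L[ℝ] E →L[ℝ] ℝ)
      (E := fun p : P => TangentSpace 𝓘(ℝ, E) p →L[ℝ] TangentSpace 𝓘(ℝ, E) p →L[ℝ] ℝ) p (toFun p))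
  alternating (p : P) (u : TangentSpace 𝓘(ℝ, E) p) : toFun p u u = 0
  nondegenerate (p : P) (u : TangentSpace 𝓘(ℝ, E) p) : (∀ v, toFun p u v = 0) → u = 0
  closed (X Y Z : ∀ p : P, TangentSpace 𝓘(ℝ, E) p) :
    SmoothVectorField X → SmoothVectorField Y → SmoothVectorField Z → ∀ p : P,
      diff (E := E) (fun q => toFun q (Y q) (Z q)) p (X p)
        - diff (E := E) (fun q => toFun q (X q) (Z q)) p (Y p)
        + diff (E := E) (fun q => toFun q (X q) (Y q)) p (Z p)
        - toFun p (VectorField.mlieBracket 𝓘(ℝ, E) X Y p) (Z p)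
        + toFun p (VectorField.mlieBracket 𝓘(ℝ, E) X Z p) (Y p)
        - toFun p (VectorField.mlieBracket 𝓘(ℝ, E) Y Z p) (X p) = 0

variable {E P} [FiniteDimensional ℝ E] (Ω : SymplecticForm E P)

theorem SymplecticForm.exists_sharp (p : P) (α : TangentSpace 𝓘(ℝ, E) p →L[ℝ] ℝ) :
    ∃ u : TangentSpace 𝓘(ℝ, E) p, Ω.toFun p u = α := by
  have : FiniteDimensional ℝ (TangentSpace 𝓘(ℝ, E) p) := inferInstanceAs (FiniteDimensional ℝ E)
  have hinj : Function.Injective (Ω.toFun p).toLinearMap := by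
    rw [injective_iff_map_eq_zero]
    intro u hu
    exact Ω.nondegenerate p u fun v => by
      have := congrArg (fun β : TangentSpace 𝓘(ℝ, E) p →L[ℝ] ℝ => β v) hu
      simpa using this
  have hdim : Module.finrank ℝ (TangentSpace 𝓘(ℝ, E) p) =
      Module.finrank ℝ (TangentSpace 𝓘(ℝ, E) p →L[ℝ] ℝ) := by
    have hE : Module.finrank ℝ E = Module.finrank ℝ (E →L[ℝ] ℝ) := by
      rw [← (LinearMap.toContinuousLinearMap (𝕜 := ℝ) (E := E) (F' := ℝ)).finrank_eq]
      exact (Subspace.dual_finrank_eq (K := ℝ) (V := E)).symm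
    exact hE
  exact (LinearMap.injective_iff_surjective_of_finrank_eq_finrank hdim).1 hinj α

/-- The Hamiltonian vector field `X_h`, the unique solution of `X_h ⌟ Ω = dh`. -/
def hamiltonianVF (h : P → ℝ) (p : P) : TangentSpace 𝓘(ℝ, E) p :=
  (Ω.exists_sharp p (diff (E := E) h p)).choose

theorem hamiltonianVF_spec (h : P → ℝ) (p : P) :
    Ω.toFun p (hamiltonianVF Ω h p) = diff (E := E) h p :=
  (Ω.exists_sharp p (diff (E := E) h p)).choose_spec

/-- The Poisson bracket `{f, k} = Ω(X_f, X_k) = X_k f`. -/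
def bracket (f k : P → ℝ) (p : P) : ℝ :=
  Ω.toFun p (hamiltonianVF Ω f p) (hamiltonianVF Ω k p)

theorem bracket_eq (f k : P → ℝ) (p : P) :
    bracket Ω f k p = diff (E := E) f p (hamiltonianVF Ω k p) := by
  rw [bracket, hamiltonianVF_spec]

end Symplectic

/-! ### Hamiltonian actions -/

section Action

variable {E : Type*} [NormedAddCommGroup E] [NormedSpace ℝ E]
  {P : Type*} [TopologicalSpace P] [ChartedSpace E P]
  {F : Type*} [NormedAddCommGroup F] [NormedSpace ℝ F]
  {G : Type*} [TopologicalSpace G] [ChartedSpace F G] [Group G] [MulAction G P]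

/-- The derivative at the identity of `g ↦ g • p`: it sends `ξ` in the Lie algebra to the value at
`p` of the infinitesimal generator `X_ξ`. -/
def generator (p : P) : GroupLieAlgebra 𝓘(ℝ, F) G →L[ℝ] TangentSpace 𝓘(ℝ, E) p :=
  (mfderiv 𝓘(ℝ, F) 𝓘(ℝ, E) (fun g : G => g • p) 1 : F →L[ℝ] E)

variable (G) in
/-- The tangent space at `p` of the orbit through `p`. -/
def orbitTangentSpace (p : P) : Submodule ℝ (TangentSpace 𝓘(ℝ, E) p) :=
  LinearMap.range (generator (E := E) (F := F) (G := G) p).toLinearMap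

/-- The push-forward `(φ_g)_* X`, with value `T φ_g (X (g⁻¹ • p))` at `p`. -/
def pushforward (g : G) (X : ∀ p : P, TangentSpace 𝓘(ℝ, E) p) (p : P) : TangentSpace 𝓘(ℝ, E) p :=
  (mfderiv 𝓘(ℝ, E) 𝓘(ℝ, E) (fun q : P => g • q) (g⁻¹ • p) : E →L[ℝ] E) (X (g⁻¹ • p))

/-- The action of `G` on `(P, Ω)` is by symplectic diffeomorphisms and has the momentum map `j`:
each infinitesimal generator satisfies `X_ξ ⌟ Ω = d⟨j, ξ⟩`. -/
structure IsHamiltonianAction [IsManifold 𝓘(ℝ, E) ∞ P] (Ω : SymplecticForm E P)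
    (j : P → (GroupLieAlgebra 𝓘(ℝ, F) G →L[ℝ] ℝ)) : Prop where
  symplectic (g : G) (p : P) (u v : TangentSpace 𝓘(ℝ, E) p) :
    Ω.toFun (g • p) (mfderiv 𝓘(ℝ, E) 𝓘(ℝ, E) (fun q : P => g • q) p u)
      (mfderiv 𝓘(ℝ, E) 𝓘(ℝ, E) (fun q : P => g • q) p v) = Ω.toFun p u v
  smooth_momentum (ξ : GroupLieAlgebra 𝓘(ℝ, F) G) : SmoothFun (E := E) (fun p => j p ξ)
  momentum (ξ : GroupLieAlgebra 𝓘(ℝ, F) G) (p : P) :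
    Ω.toFun p (generator p ξ) = diff (E := E) (fun q => j q ξ) p

variable (E P G)

/-- The algebra `C^∞(P)^G` of smooth invariant functions. -/
def invariantFunctions : Subalgebra ℝ (P → ℝ) where
  carrier := {f | SmoothFun (E := E) f ∧ ∀ (g : G) (p : P), f (g • p) = f p}
  mul_mem' := fun ha hb => ⟨ContMDiff.mul ha.1 hb.1, fun g p => by simp [ha.2 g p, hb.2 g p]⟩
  add_mem' := fun ha hb => ⟨ContMDiff.add ha.1 hb.1, fun g p => by simp [ha.2 g p, hb.2 g p]⟩
  algebraMap_mem' := fun _ => ⟨contMDiff_const, fun _ _ => rfl⟩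

/-- The orbit map `ρ : P → P/G`. -/
def orbitMap (p : P) : MulAction.orbitRel.Quotient G P := Quotient.mk _ p

/-- The smooth functions on the orbit space `P/G`: those whose pull-back by the orbit map is
smooth on `P`. -/
def orbitSpaceFunctions : Subalgebra ℝ (MulAction.orbitRel.Quotient G P → ℝ) where
  carrier := {f | SmoothFun (E := E) (f ∘ orbitMap P G)}
  mul_mem' := fun ha hb => ContMDiff.mul ha hb
  add_mem' := fun ha hb => ContMDiff.add ha hb
  algebraMap_mem' := fun _ => contMDiff_const

/-- The identification of `C^∞(P/G)` with `C^∞(P)^G` by pull-back along the orbit map. -/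
def pullbackEquiv : orbitSpaceFunctions E P G ≃ₐ[ℝ] invariantFunctions E P G where
  toFun f := ⟨f.1 ∘ orbitMap P G, f.2, fun g p =>
    congrArg f.1 (Quotient.sound (MulAction.mem_orbit p g))⟩
  invFun f := ⟨Quotient.lift f.1 (by rintro a b ⟨g, rfl⟩; exact f.2.2 g b), f.2.1⟩
  left_inv f := Subtype.ext (funext fun x => Quotient.inductionOn x fun _ => rfl)
  right_inv _ := rfl
  map_mul' _ _ := rfl
  map_add' _ _ := rfl
  commutes' _ := rfl

end Action

/-! ### Vector fields on a space with a given algebra of smooth functions -/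

section DifferentialSpace

variable {M : Type*} [TopologicalSpace M] {A : Subalgebra ℝ (M → ℝ)}

/-- `c : I → M` is an integral curve, parametrized by an interval `I` containing `0`, of the
derivation `D` of the algebra `A` of smooth functions. -/
structure IsIntegralCurve (D : Derivation ℝ A A) (c : ℝ → M) (I : Set ℝ) : Prop where
  interval : I.OrdConnected
  zero_mem : (0 : ℝ) ∈ I
  hasDeriv (f : A) (t : ℝ) : t ∈ I → HasDerivWithinAt (fun s => f.1 (c s)) ((D f).1 (c t)) I t

/-- `c : I → M` is the unique maximal integral curve of `D` through `x`. -/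
structure IsMaximalIntegralCurve (D : Derivation ℝ A A) (x : M) (c : ℝ → M) (I : Set ℝ) :
    Prop where
  integral : IsIntegralCurve D c I
  start : c 0 = x
  maximal (d : ℝ → M) (J : Set ℝ) : IsIntegralCurve D d J → d 0 = x → J ⊆ I ∧ Set.EqOn d c J

/-- `(exp t D) x` is defined and equal to `y`. -/
def ExpEq (D : Derivation ℝ A A) (t : ℝ) (x y : M) : Prop :=
  ∃ (c : ℝ → M) (I : Set ℝ), IsMaximalIntegralCurve D x c I ∧ t ∈ I ∧ c t = y

/-- `f` is smooth on the open set `U`: it agrees locally with elements of `A`. -/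
def SmoothOnOpen (A : Subalgebra ℝ (M → ℝ)) (f : M → ℝ) (U : Set M) : Prop :=
  ∀ x ∈ U, ∃ k ∈ A, f =ᶠ[𝓝 x] k

/-- The derivation `D` is a vector field: through each point there is a unique maximal integral
curve, and `exp t D` is a local one-parameter group of local diffeomorphisms, i.e. every point has
an open neighbourhood `U` such that, for all small `t`, `exp t D` is defined on `U` and is a
diffeomorphism of `U` onto an open set. -/
structure IsVectorField (D : Derivation ℝ A A) : Prop where
  exists_maximal (x : M) : ∃ (c : ℝ → M) (I : Set ℝ), IsMaximalIntegralCurve D x c I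
  flow (x : M) : ∃ U : Set M, IsOpen U ∧ x ∈ U ∧ ∃ ε > (0 : ℝ), ∀ t : ℝ, |t| < ε →
    ∃ e : OpenPartialHomeomorph M M, e.source = U ∧ (∀ y ∈ U, ExpEq D t y (e y)) ∧
      (∀ f ∈ A, SmoothOnOpen A (f ∘ e) e.source) ∧
      (∀ f ∈ A, SmoothOnOpen A (f ∘ e.symm) e.target)

end DifferentialSpace

/-! ### Poisson morphisms -/

section PoissonMorphism

variable {E : Type*} [NormedAddCommGroup E] [NormedSpace ℝ E] [FiniteDimensional ℝ E]
  {P : Type*} [TopologicalSpace P] [ChartedSpace E P] [IsManifold 𝓘(ℝ, E) ∞ P]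

/-- `A` is a Poisson algebra under the bracket of `(P, Ω)`, and the derivation `δ` of `A` is an
(infinitesimal) Poisson morphism: it is also a derivation of the bracket. -/
def IsPoissonMorphism (Ω : SymplecticForm E P) {A : Subalgebra ℝ (P → ℝ)}
    (δ : Derivation ℝ A A) : Prop :=
  ∀ f k : A, ∃ hfk : bracket Ω f.1 k.1 ∈ A,
    (δ ⟨bracket Ω f.1 k.1, hfk⟩).1 = bracket Ω (δ f).1 k.1 + bracket Ω f.1 (δ k).1

/-- The Poisson morphism `δ` is the bracket with `h`, and it is outer: `h` is a smooth function
on `P` outside of `A`. -/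
structure IsOuterPoissonMorphism (Ω : SymplecticForm E P) {A : Subalgebra ℝ (P → ℝ)}
    (h : P → ℝ) (δ : Derivation ℝ A A) : Prop where
  smooth : SmoothFun (E := E) h
  poisson : IsPoissonMorphism Ω δ
  eq_bracket (f : A) : (δ f).1 = bracket Ω f.1 h
  outer : h ∉ A

end PoissonMorphism

end NotQuiteHamiltonian

end

/-! Everything rests on one identity. Let `v` at `p` be Ω-orthogonal to the orbit through `p`. Then
d(h ∘ φ_g)(v) does not depend on g. Its derivative in g, along a direction with right translate ξ,
is after exchange of the two derivatives the derivative along `v` of (X_ξ h) ∘ φ_g = -∑ ξ_a f_a(j ∘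
φ_g). Moreover d(j ∘ φ_g)(v) = 0, since φ_g is symplectic and carries orbit directions to orbit
directions; this is why no equivariance of j is needed. So the derivative in g vanishes, and G is
connected (`diff_smul_eq`).

Since φ_{g*}X_h is the Hamiltonian field of h ∘ φ_{g⁻¹}, the difference φ_{g*}X_h - X_h is
Ω-orthogonal to the complement of the orbit directions, hence is an orbit direction. Invariant
functions do not see orbit directions, so f ↦ {f, h} preserves them and descends to P/G. The Poisson
property is the Jacobi identity, which is dΩ = 0 evaluated on three Hamiltonian fields
(`bracket_jacobi`).

The analytic part is that the reduced derivation has a flow, although P/G may be singular. Near a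
given point X_h is replaced by an invariant field Y. With a compactly supported weight θ, put K(p,
q) = κ(p)/N(p) ∫ θ(g⁻¹p) h(g⁻¹q) dg, where N(p) = ∫ θ(g⁻¹p) dg and κ is an invariant cut-off, and
let Y(p) be the value at p of the Hamiltonian field of K(p, ·). Haar invariance makes Y invariant,
and the identity above shows that Y - κX_h is an orbit direction (`exists_invariant_vectorField`).
The flow of Y is equivariant by uniqueness, so it descends to a local flow of the reduced derivation
(`exists_localFlow_orbitSpace`). Properness makes the averages finite and smooth, makes P/G
Hausdorff, and yields enough invariant functions to separate points and to define the topology. From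
local flows alone follow uniqueness, maximal integral curves and the local diffeomorphisms exp tD
(`isVectorField_of_localFlow`).

Smooth dependence, both of flows on initial points and of integrals on parameters, comes from one
source: γ ↦ Φ(·, γ(·)) is a smooth map between Banach spaces of continuous functions on a compact
space (`contDiff_superposition`). -/

open scoped Manifold ContDiff Topology

noncomputable section

namespace NotQuiteHamiltonian

set_option linter.unusedSectionVars false

/-! ### Superposition operators -/

section Superposition

universe u

/-- The partial derivative of a smooth map in a vector space direction is smooth. -/
theorem contMDiff_fderiv_snd {E : Type*} [NormedAddCommGroup E] [NormedSpace ℝ E]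
    {W : Type*} [NormedAddCommGroup W] [NormedSpace ℝ W]
    {F : Type*} [NormedAddCommGroup F] [NormedSpace ℝ F]
    {G : Type*} [TopologicalSpace G] [ChartedSpace F G] [IsManifold 𝓘(ℝ, F) ∞ G] {Φ : G × E → W}
    (hΦ : ContMDiff (𝓘(ℝ, F).prod 𝓘(ℝ, E)) 𝓘(ℝ, W) ∞ Φ) :
    ContMDiff (𝓘(ℝ, F).prod 𝓘(ℝ, E)) 𝓘(ℝ, E →L[ℝ] W) ∞
      (fun z : G × E => fderiv ℝ (fun y => Φ (z.1, y)) z.2) := by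
  have : IsManifold 𝓘(ℝ, F) 1 G := IsManifold.of_le (n := ∞) (by simp)
  intro z
  have h1 : ContMDiff ((𝓘(ℝ, F).prod 𝓘(ℝ, E)).prod 𝓘(ℝ, E)) 𝓘(ℝ, W) ∞
      (Function.uncurry (fun (z : G × E) (y : E) => Φ (z.1, y))) := by
    refine hΦ.comp (ContMDiff.prodMk ?_ ?_)
    · exact contMDiff_fst.comp contMDiff_fst
    · exact contMDiff_snd
  have h := ContMDiffAt.mfderiv (I := 𝓘(ℝ, E)) (I' := 𝓘(ℝ, W))
    (J := 𝓘(ℝ, F).prod 𝓘(ℝ, E)) (m := ∞) (n := ∞) (x₀ := z)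
    (fun (z : G × E) (y : E) => Φ (z.1, y)) (fun z => z.2) h1.contMDiffAt
    contMDiff_snd.contMDiffAt (by simp)
  have e := inTangentCoordinates_model_space (I := 𝓘(ℝ, E)) (I' := 𝓘(ℝ, W))
    (fun z : G × E => z.2) (fun z : G × E => Φ (z.1, z.2))
    (fun z : G × E => fderiv ℝ (fun y => Φ (z.1, y)) z.2) z
  simp only [mfderiv_eq_fderiv] at h
  exact e ▸ h

variable {E W : Type u} [NormedAddCommGroup E] [NormedSpace ℝ E]
  [NormedAddCommGroup W] [NormedSpace ℝ W]
  {F : Type*} [NormedAddCommGroup F] [NormedSpace ℝ F]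
  {G : Type*} [TopologicalSpace G] [ChartedSpace F G] [IsManifold 𝓘(ℝ, F) ∞ G]
  {L : Type*} [TopologicalSpace L] [CompactSpace L]

/-- Pointwise application of a continuous family of operators, as an operator on continuous
maps. -/
def pointwiseApply (L : Type*) [TopologicalSpace L] [CompactSpace L]
    (E W : Type u) [NormedAddCommGroup E] [NormedSpace ℝ E]
    [NormedAddCommGroup W] [NormedSpace ℝ W] :
    C(L, E →L[ℝ] W) →L[ℝ] C(L, E) →L[ℝ] C(L, W) :=
  LinearMap.mkContinuous₂
    (LinearMap.mk₂ ℝ (fun (A : C(L, E →L[ℝ] W)) (δ : C(L, E)) => (⟨fun l => A l (δ l), by fun_prop⟩ : C(L, W)))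
      (fun _ _ _ => by ext; simp) (fun _ _ _ => by ext; simp)
      (fun _ _ _ => by ext; simp) (fun _ _ _ => by ext; simp)) 1 (by
    intro A δ
    refine (ContinuousMap.norm_le _ (by positivity)).2 fun l => ?_
    rw [one_mul]
    exact ((A l).le_opNorm (δ l)).trans
      (mul_le_mul (A.norm_coe_le_norm l) (δ.norm_coe_le_norm l) (norm_nonneg _)
        (by positivity)))

@[simp] theorem pointwiseApply_apply (A : C(L, E →L[ℝ] W)) (δ : C(L, E)) (l : L) :
    pointwiseApply L E W A δ l = A l (δ l) := rfl

/-- Pointwise this is the mean value inequality. Compactness of `L` makes the continuity of `Φ'`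
uniform along the graph of `γ`, which turns the pointwise estimate into one in the sup norm. -/
theorem hasFDerivAt_superposition {Φ : G × E → W} {Φ' : G × E → E →L[ℝ] W}
    (hΦ' : Continuous Φ') (hd : ∀ g x, HasFDerivAt (fun y => Φ (g, y)) (Φ' (g, x)) x)
    (ι : C(L, G)) {N : C(L, E) → C(L, W)} (hN : ∀ γ l, N γ l = Φ (ι l, γ l))
    (γ : C(L, E)) (A : C(L, E →L[ℝ] W)) (hA : ∀ l, A l = Φ' (ι l, γ l)) :
    HasFDerivAt N (pointwiseApply L E W A) γ := by
  rw [hasFDerivAt_iff_isLittleO_nhds_zero, Asymptotics.isLittleO_iff]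
  intro ε hε
  have h1 : ∀ᶠ v : E in 𝓝 0, ∀ l ∈ (Set.univ : Set L),
      ‖Φ' (ι l, γ l + v) - Φ' (ι l, γ l)‖ < ε := by
    refine IsCompact.eventually_forall_of_forall_eventually isCompact_univ fun l _ => ?_
    have hc : Continuous fun z : E × L =>
        ‖Φ' (ι z.2, γ z.2 + z.1) - Φ' (ι z.2, γ z.2)‖ := by fun_prop
    exact hc.continuousAt.eventually_lt continuousAt_const (by simpa using hε)
  obtain ⟨r, hr, hball⟩ := Metric.eventually_nhds_iff_ball.1 h1
  filter_upwards [Metric.ball_mem_nhds (0 : C(L, E)) hr] with δ hδ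
  refine (ContinuousMap.norm_le _ (by positivity)).2 fun l => ?_
  have hδl : ‖δ l‖ < r := (δ.norm_coe_le_norm l).trans_lt (by simpa using hδ)
  have key := Convex.norm_image_sub_le_of_norm_hasFDerivWithin_le' (𝕜 := ℝ)
    (f := fun y => Φ (ι l, y)) (f' := fun y => Φ' (ι l, y)) (φ := Φ' (ι l, γ l)) (C := ε)
    (s := Metric.ball (γ l) r) (x := γ l) (y := γ l + δ l)
    (fun y _ => (hd _ y).hasFDerivWithinAt) (fun y hy => by
      have := hball (y - γ l) (by simpa [dist_eq_norm] using hy) l trivial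
      simpa using this.le) (convex_ball _ _) (Metric.mem_ball_self hr)
    (by simpa [dist_eq_norm] using hδl)
  simp only [add_sub_cancel_left] at key
  simp only [ContinuousMap.sub_apply, pointwiseApply_apply, hN, hA, ContinuousMap.add_apply]
  exact key.trans (mul_le_mul_of_nonneg_left (δ.norm_coe_le_norm l) hε.le)

/-- The derivative of a superposition operator is again one, built from the partial derivative of
`Φ`, followed by the continuous linear map `pointwiseApply`; hence induction on `n`. The induction
replaces `W` by `E →L[ℝ] W`, which is why `E` and `W` share a universe. -/
theorem contDiff_superposition (ι : C(L, G)) (n : ℕ) {Φ : G × E → W}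
    (hΦ : ContMDiff (𝓘(ℝ, F).prod 𝓘(ℝ, E)) 𝓘(ℝ, W) ∞ Φ) {N : C(L, E) → C(L, W)}
    (hN : ∀ γ l, N γ l = Φ (ι l, γ l)) : ContDiff ℝ n N := by
  induction n generalizing W with
  | zero =>
    have hd := contMDiff_fderiv_snd hΦ
    refine contDiff_zero.2 (continuous_iff_continuousAt.2 fun γ => ?_)
    refine (hasFDerivAt_superposition (Φ' := fun z => fderiv ℝ (fun y => Φ (z.1, y)) z.2)
      hd.continuous (fun g x => ?_) ι hN γ
      ⟨fun l => fderiv ℝ (fun y => Φ (ι l, y)) (γ l), ?_⟩ fun _ => rfl).continuousAt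
    · refine DifferentiableAt.hasFDerivAt ?_
      have : ContMDiff 𝓘(ℝ, E) 𝓘(ℝ, W) ∞ (fun y => Φ (g, y)) :=
        hΦ.comp (contMDiff_const.prodMk contMDiff_id)
      exact (this.contDiff.differentiable (by simp)) x
    · exact hd.continuous.comp (ι.continuous.prodMk γ.continuous)
  | succ n ih =>
    have hd := contMDiff_fderiv_snd hΦ
    push_cast
    let N' : C(L, E) → C(L, E →L[ℝ] W) := fun γ =>
      ⟨fun l => fderiv ℝ (fun y => Φ (ι l, y)) (γ l),
        hd.continuous.comp (ι.continuous.prodMk γ.continuous)⟩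
    refine contDiff_succ_iff_hasFDerivAt.2 ⟨fun γ => pointwiseApply L E W (N' γ), ?_, fun γ => ?_⟩
    · exact (pointwiseApply L E W).contDiff.comp (ih hd (N := N') fun _ _ => rfl)
    · refine hasFDerivAt_superposition (Φ' := fun z => fderiv ℝ (fun y => Φ (z.1, y)) z.2)
        hd.continuous (fun g x => DifferentiableAt.hasFDerivAt ?_) ι hN γ (N' γ) fun _ => rfl
      have : ContMDiff 𝓘(ℝ, E) 𝓘(ℝ, W) ∞ (fun y => Φ (g, y)) :=
        hΦ.comp (contMDiff_const.prodMk contMDiff_id)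
      exact (this.contDiff.differentiable (by simp)) x

end Superposition

/-! ### Smooth dependence of integrals on parameters -/

section ParametricIntegral

open MeasureTheory

universe u

variable {E : Type u} [NormedAddCommGroup E] [NormedSpace ℝ E]
  {F : Type*} [NormedAddCommGroup F] [NormedSpace ℝ F]
  {G : Type*} [TopologicalSpace G] [ChartedSpace F G] [IsManifold 𝓘(ℝ, F) ∞ G]

/-- The integral factors as constants `E → C(K, E)`, then a superposition operator, then the
integral as a continuous linear functional; each factor is smooth. -/
theorem contDiff_setIntegral [T2Space G] [MeasurableSpace G] [BorelSpace G] {μ : Measure G}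
    [IsFiniteMeasureOnCompacts μ] {K : Set G} (hK : IsCompact K) {Φ : G × E → ℝ}
    (hΦ : ContMDiff (𝓘(ℝ, F).prod 𝓘(ℝ, E)) 𝓘(ℝ, ℝ) ∞ Φ) :
    ContDiff ℝ ∞ (fun x => ∫ g in K, Φ (g, x) ∂μ) := by
  have : CompactSpace K := isCompact_iff_compactSpace.1 hK
  let ν : Measure K := μ.comap Subtype.val
  have hν : IsFiniteMeasure ν := ⟨by
    rw [show ν = μ.comap Subtype.val from rfl,
      (MeasurableEmbedding.subtype_coe hK.measurableSet).comap_apply]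
    simpa using hK.measure_lt_top⟩
  have hint : ∀ f : C(K, ℝ × E), Integrable (fun k => (f k).1) ν := fun f =>
    (continuous_fst.comp f.continuous).integrable_of_hasCompactSupport
      (HasCompactSupport.of_compactSpace _)
  -- The values lie in `ℝ × E` with zero second component only to bring the target into the universe
  -- of `E`.
  let T : C(K, ℝ × E) →L[ℝ] ℝ := LinearMap.mkContinuous
    { toFun := fun f => ∫ k, (f k).1 ∂ν
      map_add' := fun f g => integral_add (hint f) (hint g)
      map_smul' := fun c f => integral_const_mul c _ } (ν.real Set.univ) (fun f => by
        rw [mul_comm]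
        refine norm_integral_le_of_norm_le_const (ae_of_all _ fun k => ?_)
        exact (norm_fst_le _).trans (f.norm_coe_le_norm k))
  have hΨ : ContMDiff (𝓘(ℝ, F).prod 𝓘(ℝ, E)) 𝓘(ℝ, ℝ × E) ∞
      (fun z : G × E => (Φ z, (0 : E))) := hΦ.prodMk_space contMDiff_const
  let N : C(K, E) → C(K, ℝ × E) := fun γ => ⟨fun k => (Φ (k, γ k), 0), by
    have := hΦ.continuous
    fun_prop⟩
  have hN : ContDiff ℝ ∞ N := contDiff_infty.2 fun n =>
    contDiff_superposition ⟨Subtype.val, continuous_subtype_val⟩ n hΨ fun _ _ => rfl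
  let c : E →L[ℝ] C(K, E) := ContinuousLinearMap.const ℝ K
  have : (fun x => ∫ g in K, Φ (g, x) ∂μ) = fun x => T (N (c x)) := by
    funext x
    exact (integral_subtype_comap hK.measurableSet (fun g => Φ (g, x))).symm
  rw [this]
  exact T.contDiff.comp (hN.comp c.contDiff)

end ParametricIntegral

/-! ### Cut-off functions in charts -/

section Cutoff

variable {E : Type*} [NormedAddCommGroup E] [NormedSpace ℝ E] [FiniteDimensional ℝ E]
  {E' : Type*} [NormedAddCommGroup E'] [NormedSpace ℝ E']
  {H' : Type*} [TopologicalSpace H'] (I : ModelWithCorners ℝ E' H')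
  {N : Type*} [TopologicalSpace N] [ChartedSpace H' N]
  {W : Type*} [NormedAddCommGroup W] [NormedSpace ℝ W]

theorem exists_contDiffBump {U : Set E} (hU : IsOpen U) {x : E} (hx : x ∈ U) :
    ∃ β : ContDiffBump x, tsupport β ⊆ U := by
  obtain ⟨r, hr, hrU⟩ := Metric.nhds_basis_closedBall.mem_iff.1 (hU.mem_nhds hx)
  exact ⟨⟨r / 2, r, by positivity, by linarith⟩, by rw [ContDiffBump.tsupport_eq]; exact hrU⟩

/-- Extension by zero: outside the support of `β` the values of `f` do not matter. -/
theorem contMDiff_bump_smul {U : Set E} {x : E} (β : ContDiffBump x)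
    (hβ : tsupport β ⊆ U) {f : N × E → W}
    (hf : ∀ z : N × E, z.2 ∈ U → ContMDiffAt (I.prod 𝓘(ℝ, E)) 𝓘(ℝ, W) ∞ f z) :
    ContMDiff (I.prod 𝓘(ℝ, E)) 𝓘(ℝ, W) ∞ (fun z => β z.2 • f z) := by
  refine contMDiff_of_tsupport fun z hz => ?_
  have hz2 : z.2 ∈ tsupport β := by
    have h1 : Function.support (fun z : N × E => β z.2 • f z) ⊆ Prod.snd ⁻¹' tsupport β := by
      intro w hw
      refine subset_tsupport _ fun h => hw ?_
      simp [h]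
    exact closure_minimal h1 ((isClosed_tsupport _).preimage continuous_snd) hz
  refine ContMDiffAt.smul (I := 𝓘(ℝ, ℝ)) (f := fun z : N × E => β z.2) ?_ (hf z (hβ hz2))
  exact β.contDiff.contMDiff.contMDiffAt.comp z contMDiffAt_snd

end Cutoff

/-! ### Smooth dependence of integrals on a parameter in a manifold -/

section ParametricIntegralManifold

open MeasureTheory

variable {E : Type*} [NormedAddCommGroup E] [NormedSpace ℝ E] [FiniteDimensional ℝ E]
  {H : Type*} [TopologicalSpace H] {I : ModelWithCorners ℝ E H} [I.Boundaryless]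
  {M : Type*} [TopologicalSpace M] [ChartedSpace H M] [IsManifold I ∞ M]
  {F : Type*} [NormedAddCommGroup F] [NormedSpace ℝ F]
  {G : Type*} [TopologicalSpace G] [ChartedSpace F G] [IsManifold 𝓘(ℝ, F) ∞ G]

theorem contMDiff_setIntegral [T2Space G] [MeasurableSpace G] [BorelSpace G] {μ : Measure G}
    [IsFiniteMeasureOnCompacts μ] {K : Set G} (hK : IsCompact K) {Φ : G × M → ℝ}
    (hΦ : ContMDiff (𝓘(ℝ, F).prod I) 𝓘(ℝ, ℝ) ∞ Φ) :
    ContMDiff I 𝓘(ℝ, ℝ) ∞ (fun x => ∫ g in K, Φ (g, x) ∂μ) := by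
  intro x
  obtain ⟨β, hβ⟩ := exists_contDiffBump (isOpen_extChartAt_target (I := I) x)
    (mem_extChartAt_target (I := I) x)
  have h1 : ContMDiff (𝓘(ℝ, F).prod 𝓘(ℝ, E)) 𝓘(ℝ, ℝ) ∞
      (fun z : G × E => β z.2 • Φ (z.1, (extChartAt I x).symm z.2)) := by
    refine contMDiff_bump_smul _ β hβ fun z hz => ?_
    refine hΦ.contMDiffAt.comp z (contMDiffAt_fst.prodMk ?_)
    exact (((contMDiffOn_extChartAt_symm x).contMDiffAt
      ((isOpen_extChartAt_target x).mem_nhds hz)).comp z contMDiffAt_snd)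
  have h2 := (contDiff_setIntegral (μ := μ) hK h1).contMDiff.contMDiffAt.comp x
    (contMDiffAt_extChartAt (I := I) (n := ∞) (x := x))
  refine h2.congr_of_eventuallyEq ?_
  filter_upwards [(continuousAt_extChartAt (I := I) x) β.eventuallyEq_one,
    extChartAt_source_mem_nhds (I := I) x] with y hy hy'
  have hy1 : β (extChartAt I x y) = 1 := hy
  simp only [Function.comp_def, hy1, (extChartAt I x).left_inv hy', one_smul]

end ParametricIntegralManifold

/-! ### The local flow of a smooth vector field on a Banach space -/

section Flow

universe u

/-- Invertibility of the derivative is an open condition, so the inverse is smooth on a whole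
neighbourhood and not only at the image point. -/
theorem exists_contDiffOn_localInverse {X : Type*} [NormedAddCommGroup X] [NormedSpace ℝ X]
    [CompleteSpace X] {f : X → X} (hf : ContDiff ℝ ∞ f) {a : X} {f' : X ≃L[ℝ] X}
    (hf' : HasFDerivAt f (f' : X →L[ℝ] X) a) :
    ∃ (V : Set X) (ψ : X → X), IsOpen V ∧ f a ∈ V ∧ ContDiffOn ℝ ∞ ψ V ∧ ψ (f a) = a ∧
      ∀ y ∈ V, f (ψ y) = y := by
  have hs : HasStrictFDerivAt f (f' : X →L[ℝ] X) a := hf.contDiffAt.hasStrictFDerivAt' hf' (by simp)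
  let e := hs.toOpenPartialHomeomorph f
  have he : ∀ x, e x = f x := fun _ => rfl
  have ha : a ∈ e.source := hs.mem_toOpenPartialHomeomorph_source
  have hfc : Continuous (fderiv ℝ f) := hf.continuous_fderiv (by simp)
  let V := e.target ∩ e.symm ⁻¹' (fderiv ℝ f ⁻¹'
    Set.range (ContinuousLinearEquiv.toContinuousLinearMap : (X ≃L[ℝ] X) → X →L[ℝ] X))
  have hsa : e.symm (f a) = a := e.left_inv ha
  refine ⟨V, e.symm, e.symm.isOpen_inter_preimage (ContinuousLinearEquiv.isOpen.preimage hfc),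
    ⟨e.map_source ha, ?_⟩, fun y hy => ?_, hsa, fun y hy => e.right_inv hy.1⟩
  · exact ⟨f', by rw [hsa, hf'.fderiv]⟩
  · obtain ⟨g, hg⟩ := hy.2
    refine (e.contDiffAt_symm (f₀' := g) hy.1 ?_ hf.contDiffAt).contDiffWithinAt
    rw [show (g : X →L[ℝ] X) = fderiv ℝ f (e.symm y) from hg]
    exact (hf.differentiable (by simp) _).hasFDerivAt

variable {E : Type u} [NormedAddCommGroup E] [NormedSpace ℝ E]

/-- The primitive vanishing at `0`, as an operator on continuous curves on `[-1, 1]`. -/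
def primitive (E : Type u) [NormedAddCommGroup E] [NormedSpace ℝ E] :
    C(Set.Icc (-1 : ℝ) 1, E) →L[ℝ] C(Set.Icc (-1 : ℝ) 1, E) :=
  LinearMap.mkContinuous
    { toFun := fun f => ⟨fun t => ∫ s in (0 : ℝ)..t, f.IccExtend (by norm_num) s,
        (intervalIntegral.continuous_primitive
          (fun a b => (map_continuous _).intervalIntegrable a b) 0).comp continuous_subtype_val⟩
      map_add' := fun f g => by
        ext t
        exact intervalIntegral.integral_add
          ((map_continuous (f.IccExtend (by norm_num))).intervalIntegrable _ _)
          ((map_continuous (g.IccExtend (by norm_num))).intervalIntegrable _ _)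
      map_smul' := fun c f => by
        ext t
        exact intervalIntegral.integral_smul c _ } 1 (fun f => by
    refine (ContinuousMap.norm_le _ (by positivity)).2 fun t => ?_
    have h1 := intervalIntegral.norm_integral_le_of_norm_le_const (a := 0) (b := (t : ℝ))
      (C := ‖f‖) (f := f.IccExtend (by norm_num)) (fun s _ => f.norm_coe_le_norm _)
    have h2 : |(t : ℝ) - 0| ≤ 1 := by rw [sub_zero]; exact abs_le.2 t.2
    calc _ ≤ ‖f‖ * |(t : ℝ) - 0| := h1
      _ ≤ 1 * ‖f‖ := by rw [mul_comm]; gcongr)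

theorem hasDerivAt_primitive [CompleteSpace E] (f : C(Set.Icc (-1 : ℝ) 1, E)) {t : ℝ}
    (ht : t ∈ Set.Ioo (-1 : ℝ) 1) :
    HasDerivAt ((primitive E f).IccExtend (by norm_num)) (f ⟨t, Set.Ioo_subset_Icc_self ht⟩) t := by
  have h1 := intervalIntegral.integral_hasDerivAt_right (a := 0) (b := t)
    (f := f.IccExtend (by norm_num)) ((map_continuous _).intervalIntegrable _ _)
    (map_continuous _).stronglyMeasurable.stronglyMeasurableAtFilter (map_continuous _).continuousAt
  have h2 : f.IccExtend (by norm_num : (-1 : ℝ) ≤ 1) t = f ⟨t, Set.Ioo_subset_Icc_self ht⟩ :=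
    Set.IccExtend_of_mem _ _ _
  rw [h2] at h1
  refine h1.congr_of_eventuallyEq ?_
  filter_upwards [isOpen_Ioo.mem_nhds ht] with s hs
  exact Set.IccExtend_of_mem _ (primitive E f) (Set.Ioo_subset_Icc_self hs)

/-- With time rescaled to [-1, 1], a solution of speed `s` from `x` is a solution of γ = x + s ∫
v(γ). At s = 0 the solution is constant, and the inverse function theorem applied to (s, x, γ) ↦ (s,
x, γ - x - s ∫ v(γ)) gives γ as a smooth function of (s, x). One small speed `ε` suffices: the flow
at time `t` is γ evaluated at `t / ε`. -/
theorem exists_local_flow [CompleteSpace E] {v : E → E} (hv : ContDiff ℝ ∞ v) (x₀ : E) :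
    ∃ ε > (0 : ℝ), ∃ U : Set E, IsOpen U ∧ x₀ ∈ U ∧ ∃ φ : ℝ → E → E,
      (∀ x ∈ U, φ 0 x = x) ∧ (∀ t ∈ Set.Ioo (-ε) ε, ContDiffOn ℝ ∞ (φ t) U) ∧
      ContinuousOn (Function.uncurry φ) (Set.Ioo (-ε) ε ×ˢ U) ∧
      ∀ x ∈ U, ∀ t ∈ Set.Ioo (-ε) ε, HasDerivAt (fun s => φ s x) (v (φ t x)) t := by
  let B := C(Set.Icc (-1 : ℝ) 1, E)
  let X := ℝ × E × B
  let N : B → B := fun γ => ⟨fun t => v (γ t), hv.continuous.comp γ.continuous⟩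
  have hN : ContDiff ℝ ∞ N := contDiff_infty.2 fun n =>
    contDiff_superposition (F := E) (G := E) (Φ := fun z : E × E => v z.2)
      (ContinuousMap.const _ 0) n (hv.contMDiff.comp contMDiff_snd) fun _ _ => rfl
  let c : E →L[ℝ] B := ContinuousLinearMap.const ℝ _
  let R : X → B := fun z => c z.2.1 + z.1 • primitive E (N z.2.2)
  have hR : ContDiff ℝ ∞ R := by
    refine (c.contDiff.comp (contDiff_fst.comp contDiff_snd)).add (contDiff_fst.smul ?_)
    exact (primitive E).contDiff.comp (hN.comp (contDiff_snd.comp contDiff_snd))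
  let f : X → X := fun z => (z.1, z.2.1, z.2.2 - R z)
  have hf : ContDiff ℝ ∞ f := by
    refine contDiff_fst.prodMk ((contDiff_fst.comp contDiff_snd).prodMk ?_)
    exact (contDiff_snd.comp contDiff_snd).sub hR
  let a : X := (0, x₀, c x₀)
  -- At `a` the speed is zero, so the derivative of `R` has no component along the curve.
  let K : X →L[ℝ] B := c ∘L (ContinuousLinearMap.fst ℝ E B ∘L ContinuousLinearMap.snd ℝ ℝ (E × B))
    + (ContinuousLinearMap.fst ℝ ℝ (E × B)).smulRight (primitive E (N (c x₀)))
  have hRa : HasFDerivAt R K a := by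
    have h1 : HasFDerivAt (fun z : X => primitive E (N z.2.2))
        (fderiv ℝ (fun z : X => primitive E (N z.2.2)) a) a := by
      refine DifferentiableAt.hasFDerivAt (ContDiff.differentiable (n := ∞) ?_ (by simp) a)
      exact (primitive E).contDiff.comp (hN.comp (contDiff_snd.comp contDiff_snd))
    have h2 := (c ∘L (ContinuousLinearMap.fst ℝ E B ∘L
      ContinuousLinearMap.snd ℝ ℝ (E × B))).hasFDerivAt (x := a)
    have h3 : HasFDerivAt (fun z : X => z.1) (ContinuousLinearMap.fst ℝ ℝ (E × B)) a :=
      hasFDerivAt_fst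
    refine (h2.add (h3.smul h1)).congr_fderiv (ContinuousLinearMap.ext fun z => ?_)
    change c z.2.1 + ((0 : ℝ) • fderiv ℝ (fun z : X => primitive E (N z.2.2)) a z
      + z.1 • primitive E (N (c x₀))) = c z.2.1 + z.1 • primitive E (N (c x₀))
    rw [zero_smul, zero_add]
  let D : X →L[ℝ] X := (ContinuousLinearMap.fst ℝ ℝ (E × B)).prod
    ((ContinuousLinearMap.fst ℝ E B ∘L ContinuousLinearMap.snd ℝ ℝ (E × B)).prod
      (ContinuousLinearMap.snd ℝ E B ∘L ContinuousLinearMap.snd ℝ ℝ (E × B) - K))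
  -- `K` ignores the third component, so `D` is triangular and is inverted by changing the sign of
  -- `K`.
  let D' : X →L[ℝ] X := (ContinuousLinearMap.fst ℝ ℝ (E × B)).prod
    ((ContinuousLinearMap.fst ℝ E B ∘L ContinuousLinearMap.snd ℝ ℝ (E × B)).prod
      (ContinuousLinearMap.snd ℝ E B ∘L ContinuousLinearMap.snd ℝ ℝ (E × B) + K))
  have hD : HasFDerivAt f D a := by
    refine hasFDerivAt_fst.prodMk (HasFDerivAt.prodMk ?_ (HasFDerivAt.sub ?_ hRa))
    · exact (ContinuousLinearMap.fst ℝ E B ∘L ContinuousLinearMap.snd ℝ ℝ (E × B)).hasFDerivAt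
    · exact (ContinuousLinearMap.snd ℝ E B ∘L ContinuousLinearMap.snd ℝ ℝ (E × B)).hasFDerivAt
  let De : X ≃L[ℝ] X := ContinuousLinearEquiv.equivOfInverse D D'
    (fun z => Prod.ext rfl (Prod.ext rfl (sub_add_cancel z.2.2 (K z))))
    (fun z => Prod.ext rfl (Prod.ext rfl (add_sub_cancel_right z.2.2 (K z))))
  obtain ⟨V, ψ, hVo, haV, hψ, -, hinv⟩ := exists_contDiffOn_localInverse (f' := De) hf hD
  have hfa : f a = (0, x₀, 0) := by simp [f, a, R]
  rw [hfa] at haV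
  have hW : ∀ᶠ z : ℝ × E in 𝓝 (0, x₀), (z.1, z.2, (0 : B)) ∈ V := by
    have : Continuous fun z : ℝ × E => ((z.1, z.2, (0 : B)) : X) := by fun_prop
    exact this.continuousAt.eventually (hVo.mem_nhds haV)
  rw [nhds_prod_eq] at hW
  obtain ⟨pr, hpr, pu, hpu, hpp⟩ := Filter.eventually_prod_iff.1 hW
  obtain ⟨r, hr, hrp⟩ := Metric.eventually_nhds_iff.1 hpr
  obtain ⟨U, hUp, hUo, hxU⟩ := eventually_nhds_iff.1 hpu
  let ε := r / 2
  have hε : 0 < ε := by positivity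
  have hmem : ∀ x ∈ U, ((ε, x, (0 : B)) : X) ∈ V := fun x hx =>
    hpp (hrp (by rw [Real.dist_0_eq_abs, abs_of_pos hε]; exact half_lt_self hr)) (hUp x hx)
  -- The third argument 0 selects the solutions of the integral equation.
  let γ : E → B := fun x => (ψ (ε, x, 0)).2.2
  have hγ : ContDiffOn ℝ ∞ γ U := by
    refine (contDiff_snd.comp contDiff_snd).comp_contDiffOn (hψ.comp ?_ hmem)
    exact (contDiff_const.prodMk (contDiff_id.prodMk contDiff_const)).contDiffOn
  have hγeq : ∀ x ∈ U, γ x = c x + ε • primitive E (N (γ x)) := by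
    intro x hx
    have h := hinv _ (hmem x hx)
    have h1 : (ψ (ε, x, 0)).1 = ε := congrArg Prod.fst h
    have h2 : (ψ (ε, x, 0)).2.1 = x := congrArg (fun z : X => z.2.1) h
    have h3 : (ψ (ε, x, 0)).2.2 - R (ψ (ε, x, 0)) = 0 := congrArg (fun z : X => z.2.2) h
    rw [sub_eq_zero] at h3
    simp only [R, h1, h2] at h3
    exact h3
  have hle : (-1 : ℝ) ≤ 1 := by norm_num
  have hts : ∀ t ∈ Set.Ioo (-ε) ε, t / ε ∈ Set.Ioo (-1 : ℝ) 1 := fun t ht =>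
    ⟨by rw [lt_div_iff₀ hε]; linarith [ht.1], by rw [div_lt_iff₀ hε]; linarith [ht.2]⟩
  refine ⟨ε, hε, U, hUo, hxU, fun t x => (γ x).IccExtend hle (t / ε), fun x hx => ?_,
    fun t ht => ?_, ?_, fun x hx t ht => ?_⟩
  · have h0 : (0 : ℝ) ∈ Set.Icc (-1 : ℝ) 1 := by constructor <;> norm_num
    have h1 : (γ x).IccExtend hle (0 / ε) = γ x ⟨0, h0⟩ := by
      rw [zero_div]; exact Set.IccExtend_of_mem _ _ _
    have h2 : primitive E (N (γ x)) ⟨0, h0⟩ = 0 := intervalIntegral.integral_same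
    beta_reduce
    rw [h1, hγeq x hx, ContinuousMap.add_apply, ContinuousMap.smul_apply, h2, smul_zero, add_zero]
    rfl
  · exact (ContinuousMap.evalCLM ℝ (Set.projIcc (-1) 1 hle (t / ε))).contDiff.comp_contDiffOn hγ
  · have h1 : ContinuousOn (fun z : ℝ × E => (γ z.2, Set.projIcc (-1 : ℝ) 1 hle (z.1 / ε)))
        (Set.Ioo (-ε) ε ×ˢ U) := by
      refine (hγ.continuousOn.comp continuousOn_snd fun z hz => hz.2).prodMk ?_
      exact (continuous_projIcc.comp (continuous_fst.div_const ε)).continuousOn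
    exact continuous_eval.comp_continuousOn h1
  · have h1 := (hasDerivAt_primitive (N (γ x)) (hts t ht)).scomp t
      ((hasDerivAt_id t).div_const ε)
    have h2 := (h1.const_smul ε).const_add x
    have h3 : (γ x).IccExtend hle (t / ε) = γ x ⟨t / ε, Set.Ioo_subset_Icc_self (hts t ht)⟩ :=
      Set.IccExtend_of_mem _ _ _
    have h4 : HasDerivAt (fun s => x + ε • (primitive E (N (γ x))).IccExtend hle (s / ε))
        (v ((γ x).IccExtend hle (t / ε))) t := by
      rw [smul_smul, mul_one_div_cancel hε.ne', one_smul] at h2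
      rw [h3]
      exact h2
    refine h4.congr_of_eventuallyEq (Filter.Eventually.of_forall fun s => ?_)
    exact congrArg (fun β : B => β (Set.projIcc (-1) 1 hle (s / ε))) (hγeq x hx)

end Flow

/-! ### Vector fields in charts -/

section Charts

variable {E : Type*} [NormedAddCommGroup E] [NormedSpace ℝ E]
  {P : Type*} [TopologicalSpace P] [ChartedSpace E P] [IsManifold 𝓘(ℝ, E) ∞ P]

/-- The derivative at `p` of the chart around `p₀`. -/
def chartDiff (p₀ p : P) : TangentSpace 𝓘(ℝ, E) p →L[ℝ] E :=
  mfderiv 𝓘(ℝ, E) 𝓘(ℝ, E) (extChartAt 𝓘(ℝ, E) p₀) p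

/-- The derivative of the inverse of the chart around `p₀`. -/
def chartDiffSymm (p₀ : P) (y : E) :
    E →L[ℝ] TangentSpace 𝓘(ℝ, E) ((extChartAt 𝓘(ℝ, E) p₀).symm y) :=
  mfderiv 𝓘(ℝ, E) 𝓘(ℝ, E) (extChartAt 𝓘(ℝ, E) p₀).symm y

theorem contMDiffAt_vectorField_iff {X : ∀ p : P, TangentSpace 𝓘(ℝ, E) p} {p₀ p : P}
    (hp : p ∈ (chartAt E p₀).source) :
    ContMDiffAt 𝓘(ℝ, E) 𝓘(ℝ, E).tangent ∞
        (fun q => (⟨q, X q⟩ : TangentBundle 𝓘(ℝ, E) P)) p ↔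
      ContMDiffAt 𝓘(ℝ, E) 𝓘(ℝ, E) ∞ (fun q => chartDiff p₀ q (X q)) p := by
  have : IsManifold 𝓘(ℝ, E) 1 P := IsManifold.of_le (n := ∞) (by simp)
  have hb : p ∈ (trivializationAt E (TangentSpace 𝓘(ℝ, E)) p₀).baseSet := hp
  refine ((trivializationAt E (TangentSpace 𝓘(ℝ, E)) p₀).contMDiffAt_section_iff hb).trans ?_
  refine Filter.EventuallyEq.contMDiffAt_iff ?_
  filter_upwards [(chartAt E p₀).open_source.mem_nhds hp] with q hq
  have hq' : q ∈ (trivializationAt E (TangentSpace 𝓘(ℝ, E)) p₀).baseSet := hq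
  have h1 : chartDiff p₀ q =
      (trivializationAt E (TangentSpace 𝓘(ℝ, E)) p₀).continuousLinearMapAt ℝ q :=
    (TangentBundle.continuousLinearMapAt_trivializationAt hq).symm
  rw [h1, Bundle.Trivialization.continuousLinearMapAt_apply,
    Bundle.Trivialization.linearMapAt_apply, if_pos hq']

theorem chartDiff_chartDiffSymm {p₀ : P} {y : E} (hy : y ∈ (extChartAt 𝓘(ℝ, E) p₀).target)
    (v : E) : chartDiff p₀ _ (chartDiffSymm p₀ y v) = v := by
  have : IsManifold 𝓘(ℝ, E) 1 P := IsManifold.of_le (n := ∞) (by simp)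
  have h := mfderiv_extChartAt_comp_mfderivWithin_extChartAt_symm (I := 𝓘(ℝ, E)) hy
  rw [modelWithCornersSelf_coe, Set.range_id, mfderivWithin_univ] at h
  exact congrArg (fun A : E →L[ℝ] E => A v) h

theorem chartDiffSymm_chartDiff {p₀ : P} {y : E} (hy : y ∈ (extChartAt 𝓘(ℝ, E) p₀).target)
    (u : TangentSpace 𝓘(ℝ, E) ((extChartAt 𝓘(ℝ, E) p₀).symm y)) :
    chartDiffSymm p₀ y (chartDiff p₀ _ u) = u := by
  have : IsManifold 𝓘(ℝ, E) 1 P := IsManifold.of_le (n := ∞) (by simp)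
  have h := mfderivWithin_extChartAt_symm_comp_mfderiv_extChartAt (I := 𝓘(ℝ, E)) hy
  rw [modelWithCornersSelf_coe, Set.range_id, mfderivWithin_univ] at h
  exact congrArg (fun A : E →L[ℝ] E => A u) h

theorem hasMFDerivAt_extChartAt_symm {p₀ : P} {y : E}
    (hy : y ∈ (extChartAt 𝓘(ℝ, E) p₀).target) :
    HasMFDerivAt 𝓘(ℝ, E) 𝓘(ℝ, E) (extChartAt 𝓘(ℝ, E) p₀).symm y (chartDiffSymm p₀ y) := by
  have h : ContMDiffAt 𝓘(ℝ, E) 𝓘(ℝ, E) ∞ (extChartAt 𝓘(ℝ, E) p₀).symm y :=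
    (contMDiffOn_extChartAt_symm p₀).contMDiffAt ((isOpen_extChartAt_target p₀).mem_nhds hy)
  exact (h.mdifferentiableAt (by simp)).hasMFDerivAt

theorem isMIntegralCurveOn_extChartAt_symm {X : ∀ p : P, TangentSpace 𝓘(ℝ, E) p} {p₀ : P}
    {α : ℝ → E} {s : Set ℝ}
    (hα : ∀ t ∈ s, α t ∈ (extChartAt 𝓘(ℝ, E) p₀).target ∧
      HasDerivAt α (chartDiff p₀ _ (X ((extChartAt 𝓘(ℝ, E) p₀).symm (α t)))) t) :
    IsMIntegralCurveOn (fun t => (extChartAt 𝓘(ℝ, E) p₀).symm (α t)) X s := by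
  intro t ht
  obtain ⟨h1, h2⟩ := hα t ht
  have h3 := (hasMFDerivAt_extChartAt_symm h1).comp t h2.hasFDerivAt.hasMFDerivAt
  refine h3.hasMFDerivWithinAt.congr_mfderiv (ContinuousLinearMap.ext fun a => ?_)
  have h4 := chartDiffSymm_chartDiff h1 (X ((extChartAt 𝓘(ℝ, E) p₀).symm (α t)))
  let r : ℝ := a
  exact ((chartDiffSymm p₀ (α t)).map_smul r _).trans (congrArg (fun u => r • u) h4)

/-- The chart expression of `X` is cut off by a bump function to a smooth field on all of `E`. For
small times the flow stays where the bump equals 1, and there its curves are integral curves of `X`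
itself. -/
theorem exists_flow_box [FiniteDimensional ℝ E] {X : ∀ p : P, TangentSpace 𝓘(ℝ, E) p}
    (hX : ContMDiff 𝓘(ℝ, E) 𝓘(ℝ, E).tangent ∞ (fun p => (⟨p, X p⟩ : TangentBundle 𝓘(ℝ, E) P)))
    {O : Set P} (hO : IsOpen O) {p₀ : P} (hp₀ : p₀ ∈ O) :
    ∃ ε > (0 : ℝ), ∃ U : Set P, IsOpen U ∧ p₀ ∈ U ∧ ∃ φ : ℝ → P → P,
      (∀ p ∈ U, φ 0 p = p) ∧
      (∀ t ∈ Set.Ioo (-ε) ε, ContMDiffOn 𝓘(ℝ, E) 𝓘(ℝ, E) ∞ (φ t) U) ∧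
      ContinuousOn (Function.uncurry φ) (Set.Ioo (-ε) ε ×ˢ U) ∧
      (∀ p ∈ U, IsMIntegralCurveOn (fun t => φ t p) X (Set.Ioo (-ε) ε)) ∧
      ∀ p ∈ U, ∀ t ∈ Set.Ioo (-ε) ε, φ t p ∈ O := by
  have hcomplete : CompleteSpace E := FiniteDimensional.complete ℝ E
  let c := extChartAt 𝓘(ℝ, E) p₀
  have hT : IsOpen c.target := isOpen_extChartAt_target p₀
  have hsrc : c.source = (chartAt E p₀).source := extChartAt_source _ _
  obtain ⟨β, hβ⟩ := exists_contDiffBump hT (mem_extChartAt_target (I := 𝓘(ℝ, E)) p₀)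
  let w : E → E := fun y => chartDiff p₀ _ (X (c.symm y))
  have hsymm : ∀ y ∈ c.target, ContMDiffAt 𝓘(ℝ, E) 𝓘(ℝ, E) ∞ c.symm y := fun y hy =>
    (contMDiffOn_extChartAt_symm p₀).contMDiffAt (hT.mem_nhds hy)
  have hw : ∀ y ∈ c.target, ContMDiffAt 𝓘(ℝ, E) 𝓘(ℝ, E) ∞ w y := fun y hy =>
    ((contMDiffAt_vectorField_iff (hsrc ▸ c.map_target hy)).1 hX.contMDiffAt).comp y (hsymm y hy)
  let v : E → E := fun y => β y • w y
  have hv : ContDiff ℝ ∞ v := by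
    have h1 : ContMDiff (𝓘(ℝ, E).prod 𝓘(ℝ, E)) 𝓘(ℝ, E) ∞ (fun z : E × E => β z.2 • w z.2) :=
      contMDiff_bump_smul 𝓘(ℝ, E) (N := E) β hβ (f := fun z : E × E => w z.2) fun z hz =>
        (hw z.2 hz).comp z contMDiffAt_snd
    exact (h1.comp (contMDiff_const (c := (0 : E)).prodMk contMDiff_id)).contDiff
  obtain ⟨ε, hε, U, hUo, hxU, φ, h0, hφ, hcont, hder⟩ := exists_local_flow hv (c p₀)
  -- On the ball of radius `β.rIn` the cut-off field coincides with the chart expression of `X`.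
  let O' : Set E := (c.target ∩ c.symm ⁻¹' O) ∩ Metric.ball (c p₀) β.rIn
  have hO'o : IsOpen O' :=
    ((contMDiffOn_extChartAt_symm (n := ∞) p₀).continuousOn.isOpen_inter_preimage hT hO).inter
      Metric.isOpen_ball
  have hleft : c.symm (c p₀) = p₀ := c.left_inv (mem_extChartAt_source p₀)
  have hmem0 : c p₀ ∈ O' := ⟨⟨mem_extChartAt_target p₀, by
    rw [Set.mem_preimage, hleft]; exact hp₀⟩, Metric.mem_ball_self β.rIn_pos⟩
  have hev : ∀ᶠ z : ℝ × E in 𝓝 (0, c p₀), Function.uncurry φ z ∈ O' := by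
    have hz : Set.Ioo (-ε) ε ×ˢ U ∈ 𝓝 ((0 : ℝ), c p₀) :=
      (isOpen_Ioo.prod hUo).mem_nhds ⟨⟨by linarith, hε⟩, hxU⟩
    refine (hcont.continuousAt hz).eventually (hO'o.mem_nhds ?_)
    rw [Function.uncurry_apply_pair, h0 _ hxU]
    exact hmem0
  rw [nhds_prod_eq] at hev
  obtain ⟨pr, hpr, pu, hpu, hpp⟩ := Filter.eventually_prod_iff.1 hev
  obtain ⟨r, hr, hrp⟩ := Metric.eventually_nhds_iff.1 hpr
  obtain ⟨U', hUp, hUo', hxU'⟩ := eventually_nhds_iff.1 hpu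
  let δ := min r ε
  have hδ : 0 < δ := lt_min hr hε
  have hδε : Set.Ioo (-δ) δ ⊆ Set.Ioo (-ε) ε :=
    Set.Ioo_subset_Ioo (neg_le_neg (min_le_right _ _)) (min_le_right _ _)
  have hin : ∀ t ∈ Set.Ioo (-δ) δ, ∀ y ∈ U', φ t y ∈ O' := fun t ht y hy =>
    hpp (hrp (by rw [Real.dist_0_eq_abs]; exact (abs_lt.2 ht).trans_le (min_le_left _ _)))
      (hUp y hy)
  let V : Set P := c.source ∩ c ⁻¹' (U ∩ U')
  have hVo : IsOpen V := (continuousOn_extChartAt (I := 𝓘(ℝ, E)) p₀).isOpen_inter_preimage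
    (isOpen_extChartAt_source p₀) (hUo.inter hUo')
  refine ⟨δ, hδ, V, hVo, ⟨mem_extChartAt_source p₀, hxU, hxU'⟩, fun t p => c.symm (φ t (c p)),
    fun p hp => ?_, fun t ht => ?_, ?_, fun p hp => ?_, fun p hp t ht => ?_⟩
  · change c.symm (φ 0 (c p)) = p
    rw [h0 _ hp.2.1, c.left_inv hp.1]
  · intro p hp
    refine ContMDiffAt.contMDiffWithinAt ?_
    refine (hsymm _ (hin t ht _ hp.2.2).1.1).comp p ?_
    refine (((hφ t (hδε ht)).contDiffAt (hUo.mem_nhds hp.2.1)).contMDiffAt).comp p ?_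
    exact contMDiffAt_extChartAt' (hsrc ▸ hp.1)
  · refine (contMDiffOn_extChartAt_symm (n := ∞) p₀).continuousOn.comp
      (t := c.target) (hcont.comp (t := Set.Ioo (-ε) ε ×ˢ U) (f := fun z : ℝ × P => (z.1, c z.2))
        (continuousOn_fst.prodMk ?_) fun z hz => ⟨hδε hz.1, hz.2.2.1⟩)
      fun z hz => (hin z.1 hz.1 _ hz.2.2.2).1.1
    exact (continuousOn_extChartAt p₀).comp continuousOn_snd fun z hz => hz.2.1
  · refine isMIntegralCurveOn_extChartAt_symm fun t ht => ?_
    have h1 := hin t ht _ hp.2.2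
    refine ⟨h1.1.1, ?_⟩
    have h2 := hder (c p) hp.2.1 t (hδε ht)
    have h3 : v (φ t (c p)) = w (φ t (c p)) := by
      change β (φ t (c p)) • w (φ t (c p)) = _
      rw [β.one_of_mem_closedBall (Metric.ball_subset_closedBall h1.2), one_smul]
    rw [h3] at h2
    exact h2
  · exact (hin t ht _ hp.2.2).1.2

end Charts

/-! ### Smoothness of Hamiltonian vector fields -/

section Hamiltonian

variable {E : Type*} [NormedAddCommGroup E] [NormedSpace ℝ E]
  {P : Type*} [TopologicalSpace P] [ChartedSpace E P] [IsManifold 𝓘(ℝ, E) ∞ P]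

theorem SymplecticForm.contMDiffAt_apply (Ω : SymplecticForm E P)
    {X Y : ∀ p : P, TangentSpace 𝓘(ℝ, E) p} {p : P}
    (hX : ContMDiffAt 𝓘(ℝ, E) 𝓘(ℝ, E).tangent ∞
      (fun q => (⟨q, X q⟩ : TangentBundle 𝓘(ℝ, E) P)) p)
    (hY : ContMDiffAt 𝓘(ℝ, E) 𝓘(ℝ, E).tangent ∞
      (fun q => (⟨q, Y q⟩ : TangentBundle 𝓘(ℝ, E) P)) p) :
    ContMDiffAt 𝓘(ℝ, E) 𝓘(ℝ, ℝ) ∞ (fun q => Ω.toFun q (X q) (Y q)) p := by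
  have h := ContMDiffAt.clm_bundle_apply₂ (F₁ := E) (F₂ := E) (F₃ := ℝ) (b := fun q : P => q)
    (E₁ := fun p : P => TangentSpace 𝓘(ℝ, E) p) (E₂ := fun p : P => TangentSpace 𝓘(ℝ, E) p)
    (E₃ := Bundle.Trivial P ℝ) Ω.smooth.contMDiffAt hX hY
  exact (Bundle.contMDiffAt_totalSpace.1 h).2

/-- The coordinate vector fields of the chart around `p₀`. -/
def chartField (p₀ : P) (v : E) (q : P) : TangentSpace 𝓘(ℝ, E) q :=
  (mfderiv 𝓘(ℝ, E) 𝓘(ℝ, E) (extChartAt 𝓘(ℝ, E) p₀).symm (extChartAt 𝓘(ℝ, E) p₀ q) : E →L[ℝ] E) v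

theorem chartField_symm {p₀ : P} {y : E} (hy : y ∈ (extChartAt 𝓘(ℝ, E) p₀).target) (v : E) :
    chartField p₀ v ((extChartAt 𝓘(ℝ, E) p₀).symm y) = chartDiffSymm p₀ y v :=
  congrArg (fun z => (mfderiv 𝓘(ℝ, E) 𝓘(ℝ, E) (extChartAt 𝓘(ℝ, E) p₀).symm z : E →L[ℝ] E) v)
    ((extChartAt 𝓘(ℝ, E) p₀).right_inv hy)

theorem contMDiffAt_chartField {p₀ p : P} (hp : p ∈ (chartAt E p₀).source) (v : E) :
    ContMDiffAt 𝓘(ℝ, E) 𝓘(ℝ, E).tangent ∞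
      (fun q => (⟨q, chartField p₀ v q⟩ : TangentBundle 𝓘(ℝ, E) P)) p := by
  refine (contMDiffAt_vectorField_iff hp).2 ?_
  refine (contMDiffAt_const (c := v)).congr_of_eventuallyEq ?_
  filter_upwards [(chartAt E p₀).open_source.mem_nhds hp] with q hq
  have hq' : q ∈ (extChartAt 𝓘(ℝ, E) p₀).source := by rwa [extChartAt_source]
  have h := chartDiff_chartDiffSymm ((extChartAt 𝓘(ℝ, E) p₀).map_source hq') v
  rw [← chartField_symm ((extChartAt 𝓘(ℝ, E) p₀).map_source hq')] at h
  rw [(extChartAt 𝓘(ℝ, E) p₀).left_inv hq'] at h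
  exact h

variable [FiniteDimensional ℝ E]

/-- The Hamiltonian may depend on the base point as a frozen parameter; the averaged Hamiltonian has
this form. In a chart the form is a smooth family of invertible operators `M`, and the field is
`M⁻¹` applied to the differential of `K` in its second variable on the diagonal. -/
theorem smoothVectorField_hamiltonianVF_diag (Ω : SymplecticForm E P) {K : P → P → ℝ}
    (hK : ContMDiff (𝓘(ℝ, E).prod 𝓘(ℝ, E)) 𝓘(ℝ, ℝ) ∞ (Function.uncurry K)) :
    SmoothVectorField (fun p => hamiltonianVF Ω (K p) p) := by
  have hcomplete : CompleteSpace E := FiniteDimensional.complete ℝ E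
  intro p₀
  refine (contMDiffAt_vectorField_iff (mem_chart_source E p₀)).2 ?_
  let c := extChartAt 𝓘(ℝ, E) p₀
  have hT : IsOpen c.target := isOpen_extChartAt_target p₀
  have hsrc : c.source = (chartAt E p₀).source := extChartAt_source _ _
  have hsymm : ContMDiffOn 𝓘(ℝ, E) 𝓘(ℝ, E) ∞ c.symm c.target := contMDiffOn_extChartAt_symm p₀
  let Ω' : E → E →L[ℝ] E →L[ℝ] ℝ := fun y => Ω.toFun (c.symm y)
  let S : E → E →L[ℝ] E := fun y => chartDiffSymm p₀ y
  let M : E → E →L[ℝ] E →L[ℝ] ℝ := fun y => (Ω' y).bilinearComp (S y) (S y)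
  have hMapply : ∀ y v w, M y v w =
    Ω.toFun (c.symm y) (chartDiffSymm p₀ y v) (chartDiffSymm p₀ y w) := fun _ _ _ => rfl
  have hM : ContDiffOn ℝ ∞ M c.target := by
    refine contDiffOn_clm_apply.2 fun v => contDiffOn_clm_apply.2 fun w => ?_
    refine ContMDiffOn.contDiffOn fun y hy => ContMDiffAt.contMDiffWithinAt ?_
    have h1 := (Ω.contMDiffAt_apply (contMDiffAt_chartField (hsrc ▸ c.map_target hy) v)
      (contMDiffAt_chartField (hsrc ▸ c.map_target hy) w)).comp y
      (hsymm.contMDiffAt (hT.mem_nhds hy))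
    refine h1.congr_of_eventuallyEq ?_
    filter_upwards [hT.mem_nhds hy] with z hz
    simp only [Function.comp_def, c, chartField_symm hz]
    rfl
  let α : E → E →L[ℝ] ℝ := fun y => fderiv ℝ (fun z => K (c.symm y) (c.symm z)) y
  have hα : ContDiffOn ℝ ∞ α c.target := by
    have h1 : ContDiffOn ℝ ∞ (fun z : E × E => K (c.symm z.1) (c.symm z.2))
        (c.target ×ˢ c.target) := by
      rw [← contMDiffOn_iff_contDiffOn]
      refine hK.comp_contMDiffOn (ContMDiffOn.prodMk ?_ ?_)
      · exact hsymm.comp contDiff_fst.contMDiff.contMDiffOn fun z hz => hz.1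
      · exact hsymm.comp contDiff_snd.contMDiff.contMDiffOn fun z hz => hz.2
    intro y hy
    refine ContDiffAt.contDiffWithinAt ?_
    exact ContDiffAt.fderiv (f := fun y z => K (c.symm y) (c.symm z)) (g := id) (n := ∞)
      (h1.contDiffAt ((hT.prod hT).mem_nhds ⟨hy, hy⟩)) contDiffAt_id (by simp)
  have hinv : ∀ y ∈ c.target, ∃ e : E ≃L[ℝ] (E →L[ℝ] ℝ), (e : E →L[ℝ] E →L[ℝ] ℝ) = M y := by
    intro y hy
    have hinj : Function.Injective (M y).toLinearMap := by
      rw [injective_iff_map_eq_zero]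
      intro v hv
      have h1 : chartDiffSymm p₀ y v = 0 := by
        refine Ω.nondegenerate _ _ fun u => ?_
        rw [← chartDiffSymm_chartDiff hy u]
        exact congrArg (fun β : E →L[ℝ] ℝ => β (chartDiff p₀ _ u)) hv
      rw [← chartDiff_chartDiffSymm hy v, h1, map_zero]
    have hdim : Module.finrank ℝ E = Module.finrank ℝ (E →L[ℝ] ℝ) := by
      rw [← (LinearMap.toContinuousLinearMap (𝕜 := ℝ) (E := E) (F' := ℝ)).finrank_eq]
      exact (Subspace.dual_finrank_eq (K := ℝ) (V := E)).symm
    exact ⟨(LinearEquiv.ofInjectiveOfFinrankEq (M y).toLinearMap hinj hdim).toContinuousLinearEquiv,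
      ContinuousLinearMap.ext fun _ => rfl⟩
  have key : ∀ y ∈ c.target,
      chartDiff p₀ _ (hamiltonianVF Ω (K (c.symm y)) (c.symm y)) =
        ContinuousLinearMap.inverse (M y) (α y) := by
    intro y hy
    obtain ⟨e, he⟩ := hinv y hy
    have h1 : M y (chartDiff p₀ _ (hamiltonianVF Ω (K (c.symm y)) (c.symm y))) = α y := by
      refine ContinuousLinearMap.ext fun w => ?_
      rw [hMapply, chartDiffSymm_chartDiff hy, hamiltonianVF_spec]
      have h2 : MDifferentiableAt 𝓘(ℝ, E) 𝓘(ℝ, ℝ) (K (c.symm y)) (c.symm y) := by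
        have : ContMDiff 𝓘(ℝ, E) 𝓘(ℝ, ℝ) ∞ (K (c.symm y)) :=
          hK.comp (contMDiff_const.prodMk contMDiff_id)
        exact this.mdifferentiable (by simp) _
      let A : E →L[ℝ] ℝ := diff (E := E) (K (c.symm y)) (c.symm y)
      have h3 : HasFDerivAt (fun z => K (c.symm y) (c.symm z)) (A ∘L S y) y :=
        hasMFDerivAt_iff_hasFDerivAt.1
          (h2.hasMFDerivAt.comp y (hasMFDerivAt_extChartAt_symm hy))
      exact (congrArg (fun β : E →L[ℝ] ℝ => β w) h3.fderiv).symm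
    let u : E := chartDiff p₀ _ (hamiltonianVF Ω (K (c.symm y)) (c.symm y))
    have h4 : e u = α y := by rw [← h1, ← he]; rfl
    change u = _
    rw [← he, ContinuousLinearMap.inverse_equiv, ← h4]
    exact (e.symm_apply_apply u).symm
  have hsm : ContDiffAt ℝ ∞ (fun y => ContinuousLinearMap.inverse (M y) (α y)) (c p₀) := by
    have h0 : c p₀ ∈ c.target := mem_extChartAt_target p₀
    obtain ⟨e, he⟩ := hinv _ h0
    refine ContDiffAt.clm_apply ?_ (hα.contDiffAt (hT.mem_nhds h0))
    have h1 := contDiffAt_map_inverse (n := ∞) e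
    rw [he] at h1
    exact h1.comp (c p₀) (hM.contDiffAt (hT.mem_nhds h0))
  have h1 := hsm.contMDiffAt.comp p₀ (contMDiffAt_extChartAt (I := 𝓘(ℝ, E)) (n := ∞) (x := p₀))
  refine h1.congr_of_eventuallyEq ?_
  filter_upwards [(isOpen_extChartAt_source (I := 𝓘(ℝ, E)) p₀).mem_nhds
    (mem_extChartAt_source p₀)] with q hq
  have h2 := key (c q) (c.map_source hq)
  rw [c.left_inv hq] at h2
  exact h2

theorem smoothVectorField_hamiltonianVF (Ω : SymplecticForm E P) {h : P → ℝ}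
    (hh : SmoothFun (E := E) h) : SmoothVectorField (hamiltonianVF Ω h) :=
  smoothVectorField_hamiltonianVF_diag Ω (K := fun _ => h) (hh.comp contMDiff_snd)

theorem smoothFun_bracket (Ω : SymplecticForm E P) {f k : P → ℝ} (hf : SmoothFun (E := E) f)
    (hk : SmoothFun (E := E) k) : SmoothFun (E := E) (bracket Ω f k) := fun p =>
  Ω.contMDiffAt_apply (smoothVectorField_hamiltonianVF Ω hf p)
    (smoothVectorField_hamiltonianVF Ω hk p)

end Hamiltonian

/-! ### The Lie bracket as a commutator of derivations and the Jacobi identity -/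

section LieBracket

/-- The second-order terms cancel by symmetry of the second derivative. -/
theorem fderiv_lieBracket {E : Type*} [NormedAddCommGroup E] [NormedSpace ℝ E] {f : E → ℝ}
    {V W : E → E} {y : E} (hf : ContDiffAt ℝ 2 f y) (hV : DifferentiableAt ℝ V y)
    (hW : DifferentiableAt ℝ W y) :
    fderiv ℝ f y (VectorField.lieBracket ℝ V W y) =
      fderiv ℝ (fun z => fderiv ℝ f z (W z)) y (V y) -
        fderiv ℝ (fun z => fderiv ℝ f z (V z)) y (W y) := by
  have h1 : DifferentiableAt ℝ (fderiv ℝ f) y :=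
    (hf.fderiv_right (m := 1) (by norm_num)).differentiableAt (by simp)
  have hsymm : IsSymmSndFDerivAt ℝ f y := hf.isSymmSndFDerivAt (by simp)
  rw [fderiv_clm_apply h1 hW, fderiv_clm_apply h1 hV, VectorField.lieBracket_eq]
  simp only [map_sub, add_apply, ContinuousLinearMap.comp_apply,
    ContinuousLinearMap.flip_apply]
  rw [hsymm.eq (V y) (W y)]
  ring

variable {E : Type*} [NormedAddCommGroup E] [NormedSpace ℝ E]
  {P : Type*} [TopologicalSpace P] [ChartedSpace E P] [IsManifold 𝓘(ℝ, E) ∞ P]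

theorem hasFDerivAt_comp_extChartAt_symm {f : P → ℝ} (hf : SmoothFun (E := E) f) {p₀ : P} {y : E}
    (hy : y ∈ (extChartAt 𝓘(ℝ, E) p₀).target) :
    HasFDerivAt (fun z => f ((extChartAt 𝓘(ℝ, E) p₀).symm z))
      ((diff (E := E) f ((extChartAt 𝓘(ℝ, E) p₀).symm y)).comp (chartDiffSymm p₀ y)) y :=
  hasMFDerivAt_iff_hasFDerivAt.1
    ((hf.mdifferentiable (by simp) _).hasMFDerivAt.comp y (hasMFDerivAt_extChartAt_symm hy))

theorem diff_eq_fderiv {f : P → ℝ} (hf : SmoothFun (E := E) f) {p₀ q : P}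
    (hq : q ∈ (extChartAt 𝓘(ℝ, E) p₀).source) (u : TangentSpace 𝓘(ℝ, E) q) :
    diff (E := E) f q u =
      fderiv ℝ (fun z => f ((extChartAt 𝓘(ℝ, E) p₀).symm z)) (extChartAt 𝓘(ℝ, E) p₀ q)
        (chartDiff p₀ q u) := by
  obtain ⟨y, hy, rfl⟩ : ∃ y ∈ (extChartAt 𝓘(ℝ, E) p₀).target,
      (extChartAt 𝓘(ℝ, E) p₀).symm y = q :=
    ⟨_, (extChartAt 𝓘(ℝ, E) p₀).map_source hq, (extChartAt 𝓘(ℝ, E) p₀).left_inv hq⟩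
  rw [(extChartAt 𝓘(ℝ, E) p₀).right_inv hy, (hasFDerivAt_comp_extChartAt_symm hf hy).fderiv,
    ContinuousLinearMap.comp_apply, chartDiffSymm_chartDiff hy]

/-- In the chart at `p` the fields become `rep X` and `rep Y`, and the claim reduces to
`fderiv_lieBracket`. -/
theorem diff_mlieBracket [CompleteSpace E] {X Y : ∀ p : P, TangentSpace 𝓘(ℝ, E) p}
    (hX : ContMDiff 𝓘(ℝ, E) 𝓘(ℝ, E).tangent ∞ (fun p => (⟨p, X p⟩ : TangentBundle 𝓘(ℝ, E) P)))
    (hY : ContMDiff 𝓘(ℝ, E) 𝓘(ℝ, E).tangent ∞ (fun p => (⟨p, Y p⟩ : TangentBundle 𝓘(ℝ, E) P)))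
    {f : P → ℝ} (hf : SmoothFun (E := E) f)
    (hfX : SmoothFun (E := E) (fun q => diff (E := E) f q (X q)))
    (hfY : SmoothFun (E := E) (fun q => diff (E := E) f q (Y q))) (p : P) :
    diff (E := E) f p (VectorField.mlieBracket 𝓘(ℝ, E) X Y p) =
      diff (E := E) (fun q => diff (E := E) f q (Y q)) p (X p) -
        diff (E := E) (fun q => diff (E := E) f q (X q)) p (Y p) := by
  have : IsManifold 𝓘(ℝ, E) 1 P := IsManifold.of_le (n := ∞) (by simp)
  let c := extChartAt 𝓘(ℝ, E) p
  have hT : IsOpen c.target := isOpen_extChartAt_target p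
  have hsrc : c.source = (chartAt E p).source := extChartAt_source _ _
  have h0 : c p ∈ c.target := mem_extChartAt_target p
  have hleft : c.symm (c p) = p := c.left_inv (mem_extChartAt_source p)
  have hsymm : ∀ y ∈ c.target, ContMDiffAt 𝓘(ℝ, E) 𝓘(ℝ, E) ∞ c.symm y := fun y hy =>
    (contMDiffOn_extChartAt_symm p).contMDiffAt (hT.mem_nhds hy)
  let rep : (∀ p : P, TangentSpace 𝓘(ℝ, E) p) → E → E := fun Z y => chartDiff p _ (Z (c.symm y))
  have hrep : ∀ Z : ∀ p : P, TangentSpace 𝓘(ℝ, E) p,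
      ContMDiff 𝓘(ℝ, E) 𝓘(ℝ, E).tangent ∞ (fun p => (⟨p, Z p⟩ : TangentBundle 𝓘(ℝ, E) P)) →
      DifferentiableAt ℝ (rep Z) (c p) := fun Z hZ => by
    have h1 : ContMDiffAt 𝓘(ℝ, E) 𝓘(ℝ, E) ∞ (rep Z) (c p) :=
      ((contMDiffAt_vectorField_iff (hsrc ▸ c.map_target h0)).1 hZ.contMDiffAt).comp _
        (hsymm _ h0)
    exact h1.contDiffAt.differentiableAt (by simp)
  have hpull : ∀ Z : ∀ p : P, TangentSpace 𝓘(ℝ, E) p,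
      VectorField.mpullback 𝓘(ℝ, E) 𝓘(ℝ, E) c.symm Z =ᶠ[𝓝 (c p)] rep Z := fun Z => by
    filter_upwards [hT.mem_nhds h0] with y hy
    have h1 : ContinuousLinearMap.inverse (chartDiffSymm p y) = chartDiff p (c.symm y) :=
      ContinuousLinearMap.inverse_eq
        (ContinuousLinearMap.ext fun u => chartDiffSymm_chartDiff hy u)
        (ContinuousLinearMap.ext fun u => chartDiff_chartDiffSymm hy u)
    exact congrArg (fun A : TangentSpace 𝓘(ℝ, E) (c.symm y) →L[ℝ] E => A (Z (c.symm y))) h1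
  have hbr : chartDiff p p (VectorField.mlieBracket 𝓘(ℝ, E) X Y p) =
      VectorField.lieBracket ℝ (rep X) (rep Y) (c p) := by
    obtain ⟨A, hA⟩ := isInvertible_mfderiv_extChartAt (I := 𝓘(ℝ, E)) (mem_extChartAt_source p)
    have h1 := VectorField.mlieBracketWithin_apply (I := 𝓘(ℝ, E)) (V := X) (W := Y)
      (s := Set.univ) (x₀ := p)
    rw [Set.preimage_univ, Set.univ_inter, modelWithCornersSelf_coe, Set.range_id,
      VectorField.mpullbackWithin_univ, VectorField.mpullbackWithin_univ, ← hA,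
      ContinuousLinearMap.inverse_equiv, VectorField.mlieBracketWithin_univ] at h1
    let B : TangentSpace 𝓘(ℝ, E) p ≃L[ℝ] E := A
    let X' : E → E := VectorField.mpullback 𝓘(ℝ, E) 𝓘(ℝ, E) c.symm X
    let Y' : E → E := VectorField.mpullback 𝓘(ℝ, E) 𝓘(ℝ, E) c.symm Y
    have h2 : VectorField.lieBracketWithin ℝ X' Y' Set.univ (c p) =
        VectorField.lieBracket ℝ (rep X) (rep Y) (c p) := by
      rw [VectorField.lieBracketWithin_univ]
      exact Filter.EventuallyEq.lieBracket_vectorField_eq (hpull X) (hpull Y)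
    have h3 : VectorField.mlieBracket 𝓘(ℝ, E) X Y p =
        B.symm (VectorField.lieBracket ℝ (rep X) (rep Y) (c p)) :=
      h1.trans (congrArg B.symm h2)
    have h4 : chartDiff p p = (B : TangentSpace 𝓘(ℝ, E) p →L[ℝ] E) := hA.symm
    rw [h3, h4]
    exact B.apply_symm_apply _
  have hrep0 : ∀ Z : ∀ p : P, TangentSpace 𝓘(ℝ, E) p, rep Z (c p) = chartDiff p p (Z p) :=
    fun Z => by
      change chartDiff p _ (Z (c.symm (c p))) = _
      rw [hleft]
  have hcomp : ∀ Z : ∀ p : P, TangentSpace 𝓘(ℝ, E) p,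
      (fun y => fderiv ℝ (fun z => f (c.symm z)) y (rep Z y)) =ᶠ[𝓝 (c p)]
        fun y => diff (E := E) f (c.symm y) (Z (c.symm y)) := fun Z => by
    filter_upwards [hT.mem_nhds h0] with y hy
    rw [diff_eq_fderiv hf (c.map_target hy), c.right_inv hy]
  have hf2 : ContDiffAt ℝ 2 (fun z => f (c.symm z)) (c p) :=
    ((hf.contMDiffAt.comp _ (hsymm _ h0)).contDiffAt).of_le (by norm_cast)
  have hp : p ∈ c.source := mem_extChartAt_source p
  rw [diff_eq_fderiv hf hp, hbr, fderiv_lieBracket hf2 (hrep X hX) (hrep Y hY),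
    (hcomp Y).fderiv_eq, (hcomp X).fderiv_eq, diff_eq_fderiv hfX hp, diff_eq_fderiv hfY hp,
    hrep0, hrep0]

end LieBracket

section Jacobi

variable {E : Type*} [NormedAddCommGroup E] [NormedSpace ℝ E] [FiniteDimensional ℝ E]
  {P : Type*} [TopologicalSpace P] [ChartedSpace E P] [IsManifold 𝓘(ℝ, E) ∞ P]

omit [FiniteDimensional ℝ E] in
theorem SymplecticForm.swap (Ω : SymplecticForm E P) (p : P) (u v : TangentSpace 𝓘(ℝ, E) p) :
    Ω.toFun p u v = -Ω.toFun p v u := by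
  have h := Ω.alternating p (u + v)
  simp only [map_add, add_apply, Ω.alternating] at h
  linarith

theorem bracket_swap (Ω : SymplecticForm E P) (f k : P → ℝ) :
    bracket Ω f k = -bracket Ω k f := funext fun _ => Ω.swap _ _ _

theorem bracket_neg_left (Ω : SymplecticForm E P) (f k : P → ℝ) :
    bracket Ω (-f) k = -bracket Ω f k := by
  funext p
  rw [Pi.neg_apply, bracket_eq, bracket_eq, diff, diff, mfderiv_neg]
  rfl

/-- Closedness on three Hamiltonian fields gives three iterated brackets from the derivative terms
and, each Lie bracket acting as a commutator, six more from the others. By antisymmetry the nine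
terms collapse to a single Jacobi sum. -/
theorem bracket_jacobi (Ω : SymplecticForm E P) {f k h : P → ℝ} (hf : SmoothFun (E := E) f)
    (hk : SmoothFun (E := E) k) (hh : SmoothFun (E := E) h) :
    bracket Ω (bracket Ω f k) h = bracket Ω (bracket Ω f h) k + bracket Ω f (bracket Ω k h) := by
  have hcomplete : CompleteSpace E := FiniteDimensional.complete ℝ E
  have hvf := fun {g : P → ℝ} (hg : SmoothFun (E := E) g) => smoothVectorField_hamiltonianVF Ω hg
  have hlie : ∀ {u v w : P → ℝ}, SmoothFun (E := E) u → SmoothFun (E := E) v →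
      SmoothFun (E := E) w → ∀ p, diff (E := E) w p (VectorField.mlieBracket 𝓘(ℝ, E)
        (hamiltonianVF Ω u) (hamiltonianVF Ω v) p) =
        bracket Ω (bracket Ω w v) u p - bracket Ω (bracket Ω w u) v p := by
    intro u v w hu hv hw p
    have e : ∀ a : P → ℝ, (fun q => diff (E := E) w q (hamiltonianVF Ω a q)) = bracket Ω w a :=
      fun a => funext fun q => (bracket_eq Ω w a q).symm
    have h := diff_mlieBracket (hvf hu) (hvf hv) hw (by rw [e]; exact smoothFun_bracket Ω hw hu)
      (by rw [e]; exact smoothFun_bracket Ω hw hv) p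
    rw [e, e, ← bracket_eq, ← bracket_eq] at h
    exact h
  funext p
  have hcl := Ω.closed _ _ _ (hvf hf) (hvf hk) (hvf hh) p
  have e : ∀ a b : P → ℝ, (fun q => Ω.toFun q (hamiltonianVF Ω a q) (hamiltonianVF Ω b q)) =
    bracket Ω a b := fun _ _ => rfl
  rw [e, e, e, ← bracket_eq, ← bracket_eq, ← bracket_eq, Ω.swap _ _ (hamiltonianVF Ω h p),
    Ω.swap _ _ (hamiltonianVF Ω k p), Ω.swap _ _ (hamiltonianVF Ω f p), hamiltonianVF_spec,
    hamiltonianVF_spec, hamiltonianVF_spec, hlie hf hk hh, hlie hf hh hk, hlie hk hh hf,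
    bracket_swap Ω h k, bracket_swap Ω h f, bracket_swap Ω k f, bracket_neg_left,
    bracket_neg_left, bracket_neg_left] at hcl
  have h2 := congrFun (bracket_swap Ω f (bracket Ω k h)) p
  simp only [Pi.add_apply, Pi.neg_apply] at hcl h2 ⊢
  linarith

end Jacobi

/-! ### Hamiltonian actions -/

section ConstantFunctions

/-- If the partial derivative of `H` in the direction `η` at `x₀`, as a function of `y`, has
vanishing derivative in the direction `v`, then so does the mixed derivative. -/
theorem fderiv_fderiv_eq_zero {F E : Type*} [NormedAddCommGroup F] [NormedSpace ℝ F]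
    [NormedAddCommGroup E] [NormedSpace ℝ E] {H : F × E → ℝ} {x₀ : F} {y₀ : E}
    (hH : ContDiffAt ℝ 2 H (x₀, y₀)) (v : E)
    (hB : ∀ η : F, HasFDerivAt (fun t : ℝ => fderiv ℝ (fun x => H (x, y₀ + t • v)) x₀ η)
      (0 : ℝ →L[ℝ] ℝ) 0) :
    HasFDerivAt (fun x => fderiv ℝ (fun y => H (x, y)) y₀ v) (0 : F →L[ℝ] ℝ) x₀ := by
  have h1 : DifferentiableAt ℝ (fderiv ℝ H) (x₀, y₀) :=
    (hH.fderiv_right (m := 1) (by norm_num)).differentiableAt (by simp)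
  have hsymm : IsSymmSndFDerivAt ℝ H (x₀, y₀) := hH.isSymmSndFDerivAt (by simp)
  have hev : ∀ᶠ z in 𝓝 (x₀, y₀), DifferentiableAt ℝ H z := by
    filter_upwards [hH.eventually (by simp)] with z hz using hz.differentiableAt (by simp)
  have hx : ∀ᶠ x in 𝓝 x₀, fderiv ℝ (fun y => H (x, y)) y₀ v = fderiv ℝ H (x, y₀) (0, v) := by
    have hc : ContinuousAt (fun x : F => (x, y₀)) x₀ := by fun_prop
    filter_upwards [hc.eventually hev] with x hx
    have h2 : HasFDerivAt (fun y => H (x, y)) ((fderiv ℝ H (x, y₀)).comp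
        (ContinuousLinearMap.inr ℝ F E)) y₀ := hx.hasFDerivAt.comp y₀ (hasFDerivAt_prodMk_right x y₀)
    rw [h2.fderiv]
    rfl
  have hy : ∀ η : F, ∀ᶠ t : ℝ in 𝓝 0, fderiv ℝ (fun x => H (x, y₀ + t • v)) x₀ η =
      fderiv ℝ H (x₀, y₀ + t • v) (η, 0) := fun η => by
    have hc : Filter.Tendsto (fun t : ℝ => (x₀, y₀ + t • v)) (𝓝 0) (𝓝 (x₀, y₀)) := by
      have : Continuous (fun t : ℝ => (x₀, y₀ + t • v)) := by fun_prop
      simpa using this.tendsto 0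
    filter_upwards [hc.eventually hev] with t ht
    have h2 : HasFDerivAt (fun x => H (x, y₀ + t • v)) ((fderiv ℝ H (x₀, y₀ + t • v)).comp
        (ContinuousLinearMap.inl ℝ F E)) x₀ :=
      ht.hasFDerivAt.comp x₀ (hasFDerivAt_prodMk_left x₀ (y₀ + t • v))
    rw [h2.fderiv]
    rfl
  -- Symmetry of the second derivative exchanges the roles of `η` and `v`, so `hB` applies.
  have hmixed : ∀ η : F, fderiv ℝ (fderiv ℝ H) (x₀, y₀) (η, 0) (0, v) = 0 := fun η => by
    rw [hsymm.eq]
    have h2 : HasDerivAt (fun t : ℝ => (x₀, y₀ + t • v)) ((0 : F), v) 0 := by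
      simpa using (hasDerivAt_const (0 : ℝ) x₀).prodMk
        (((hasDerivAt_id (0 : ℝ)).smul_const v).const_add y₀)
    have h3 : HasDerivAt (fun t : ℝ => fderiv ℝ H (x₀, y₀ + t • v) (η, 0))
        (fderiv ℝ (fderiv ℝ H) (x₀, y₀) (0, v) (η, 0)) 0 := by
      have h4 : HasFDerivAt (fderiv ℝ H) (fderiv ℝ (fderiv ℝ H) (x₀, y₀))
          (x₀, y₀ + (0 : ℝ) • v) := by simpa using h1.hasFDerivAt
      have h5 := h4.comp_hasDerivAt (0 : ℝ) h2
      simpa using h5.clm_apply (hasDerivAt_const (0 : ℝ) ((η, 0) : F × E))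
    have h6 : HasDerivAt (fun t : ℝ => fderiv ℝ (fun x => H (x, y₀ + t • v)) x₀ η) 0 0 := by
      simpa using (hB η).hasDerivAt
    exact h3.unique (h6.congr_of_eventuallyEq ((hy η).mono fun t ht => ht.symm))
  have h7 : HasFDerivAt (fun x => fderiv ℝ H (x, y₀) (0, v))
      (((fderiv ℝ (fderiv ℝ H) (x₀, y₀)).comp (ContinuousLinearMap.inl ℝ F E)).flip (0, v)) x₀ := by
    have h8 : HasFDerivAt (fun x => fderiv ℝ H (x, y₀))
        ((fderiv ℝ (fderiv ℝ H) (x₀, y₀)).comp (ContinuousLinearMap.inl ℝ F E)) x₀ :=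
      h1.hasFDerivAt.comp x₀ (hasFDerivAt_prodMk_left x₀ y₀)
    simpa using h8.clm_apply (hasFDerivAt_const ((0, v) : F × E) x₀)
  have h9 : (((fderiv ℝ (fderiv ℝ H) (x₀, y₀)).comp (ContinuousLinearMap.inl ℝ F E)).flip (0, v)) =
      (0 : F →L[ℝ] ℝ) := ContinuousLinearMap.ext fun η => hmixed η
  rw [h9] at h7
  exact h7.congr_of_eventuallyEq hx

variable {F : Type*} [NormedAddCommGroup F] [NormedSpace ℝ F]
  {G : Type*} [TopologicalSpace G] [ChartedSpace F G] [IsManifold 𝓘(ℝ, F) ∞ G]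

/-- The hypothesis concerns each chart at its own centre only. It says that the manifold derivative
vanishes at each point, so `S` is constant on balls in any chart, and connectedness concludes. -/
theorem eq_of_hasFDerivAt_chart_zero [ConnectedSpace G] {S : G → ℝ}
    (hS : ∀ g : G, HasFDerivAt (fun x => S ((extChartAt 𝓘(ℝ, F) g).symm x)) (0 : F →L[ℝ] ℝ)
      (extChartAt 𝓘(ℝ, F) g g)) (g g' : G) : S g = S g' := by
  have : IsManifold 𝓘(ℝ, F) 1 G := IsManifold.of_le (n := ∞) (by simp)
  have h0 : ∀ g : G, HasMFDerivAt 𝓘(ℝ, F) 𝓘(ℝ, ℝ) S g (0 : F →L[ℝ] ℝ) := fun g => by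
    have h1 := (hS g).hasMFDerivAt.comp g
      (hasMFDerivAt_extChartAt (I := 𝓘(ℝ, F)) (mem_chart_source F g))
    refine (h1.congr_mfderiv (ContinuousLinearMap.zero_comp _)).congr_of_eventuallyEq ?_
    filter_upwards [extChartAt_source_mem_nhds (I := 𝓘(ℝ, F)) g] with k hk
    exact congrArg S ((extChartAt 𝓘(ℝ, F) g).left_inv hk).symm
  have hloc : IsLocallyConstant S := by
    rw [IsLocallyConstant.iff_exists_open]
    intro g₀
    let c := extChartAt 𝓘(ℝ, F) g₀
    have hT : IsOpen c.target := isOpen_extChartAt_target g₀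
    obtain ⟨r, hr, hball⟩ := Metric.isOpen_iff.1 hT (c g₀) (mem_extChartAt_target g₀)
    have hd : ∀ y ∈ c.target, HasFDerivAt (fun x => S (c.symm x)) (0 : F →L[ℝ] ℝ) y := by
      intro y hy
      have h2 := (h0 (c.symm y)).comp y (hasMFDerivAt_extChartAt_symm hy)
      exact hasMFDerivAt_iff_hasFDerivAt.1 (h2.congr_mfderiv (ContinuousLinearMap.zero_comp _))
    have hconst : ∀ y ∈ Metric.ball (c g₀) r, S (c.symm y) = S (c.symm (c g₀)) := fun y hy =>
      (convex_ball (c g₀) r).is_const_of_fderivWithin_eq_zero (𝕜 := ℝ)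
        (fun z hz => (hd z (hball hz)).differentiableAt.differentiableWithinAt)
        (fun z hz => by
          rw [fderivWithin_of_isOpen Metric.isOpen_ball hz, (hd z (hball hz)).fderiv])
        hy (Metric.mem_ball_self hr)
    refine ⟨c.source ∩ c ⁻¹' Metric.ball (c g₀) r,
      (continuousOn_extChartAt g₀).isOpen_inter_preimage (isOpen_extChartAt_source g₀)
        Metric.isOpen_ball, ⟨mem_extChartAt_source g₀, Metric.mem_ball_self hr⟩, ?_⟩
    rintro k ⟨hk, hkr⟩
    have h3 := hconst _ hkr
    rwa [c.left_inv hk, c.left_inv (mem_extChartAt_source g₀)] at h3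
  exact hloc.apply_eq_of_isPreconnected isPreconnected_univ (Set.mem_univ _) (Set.mem_univ _)

end ConstantFunctions

/-! ### Derivatives along a smooth action -/

section Action

/-- Moves a derivative along an equality of base points such as `1 • p = p`. All tangent spaces are
the model space, so the same linear map serves at both points. -/
theorem HasMFDerivAt.of_eq {E : Type*} [NormedAddCommGroup E] [NormedSpace ℝ E]
    {P : Type*} [TopologicalSpace P] [ChartedSpace E P]
    {E' : Type*} [NormedAddCommGroup E'] [NormedSpace ℝ E']
    {P' : Type*} [TopologicalSpace P'] [ChartedSpace E' P'] {f : P → P'} {x y : P}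
    {A : E →L[ℝ] E'} (hf : HasMFDerivAt 𝓘(ℝ, E) 𝓘(ℝ, E') f x A) (hxy : x = y) :
    HasMFDerivAt 𝓘(ℝ, E) 𝓘(ℝ, E') f y A := by
  subst hxy
  exact hf

variable {E : Type*} [NormedAddCommGroup E] [NormedSpace ℝ E]
  {P : Type*} [TopologicalSpace P] [ChartedSpace E P] [IsManifold 𝓘(ℝ, E) ∞ P]
  {F : Type*} [NormedAddCommGroup F] [NormedSpace ℝ F]
  {G : Type*} [TopologicalSpace G] [ChartedSpace F G] [Group G] [LieGroup 𝓘(ℝ, F) ∞ G]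
  [MulAction G P] [ContMDiffSMul 𝓘(ℝ, F) 𝓘(ℝ, E) ∞ G P]

/-- The derivative at `p` of the diffeomorphism `q ↦ g • q`. -/
def smulDiff (g : G) (p : P) : TangentSpace 𝓘(ℝ, E) p →L[ℝ] TangentSpace 𝓘(ℝ, E) (g • p) :=
  mfderiv 𝓘(ℝ, E) 𝓘(ℝ, E) (fun q : P => g • q) p

variable (E F) in
include F in
theorem contMDiff_smul_left (g : G) : ContMDiff 𝓘(ℝ, E) 𝓘(ℝ, E) ∞ (fun p : P => g • p) :=
  (ContMDiffSMul.contMDiff_smul (I := 𝓘(ℝ, F)) (I' := 𝓘(ℝ, E)) (n := ∞) (G := G) (M := P)).comp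
    (contMDiff_const.prodMk contMDiff_id)

variable (E F) in
theorem contMDiff_smul_right (p : P) : ContMDiff 𝓘(ℝ, F) 𝓘(ℝ, E) ∞ (fun g : G => g • p) :=
  (ContMDiffSMul.contMDiff_smul (I := 𝓘(ℝ, F)) (I' := 𝓘(ℝ, E)) (n := ∞) (G := G) (M := P)).comp
    (contMDiff_id.prodMk contMDiff_const)

variable (F) in
include F in
theorem hasMFDerivAt_smul_left (g : G) (p : P) :
    HasMFDerivAt 𝓘(ℝ, E) 𝓘(ℝ, E) (fun q : P => g • q) p (smulDiff g p) :=
  ((contMDiff_smul_left E F g).mdifferentiable (by simp) p).hasMFDerivAt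

variable (F) in
include F in
theorem smoothFun_comp_smul {k : P → ℝ} (hk : SmoothFun (E := E) k) (g : G) :
    SmoothFun (E := E) (fun p => k (g • p)) :=
  ContMDiff.comp hk (contMDiff_smul_left E F g)

variable (F) in
include F in
theorem diff_comp_smul {k : P → ℝ} (hk : SmoothFun (E := E) k) (g : G) (p : P)
    (u : TangentSpace 𝓘(ℝ, E) p) :
    diff (E := E) (fun q => k (g • q)) p u = diff (E := E) k (g • p) (smulDiff g p u) :=
  congrArg (fun A : E →L[ℝ] ℝ => A u)
    ((hk.mdifferentiable (by simp) (g • p)).hasMFDerivAt.comp p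
      (hasMFDerivAt_smul_left F g p)).mfderiv

theorem hasMFDerivAt_orbit (p : P) :
    HasMFDerivAt 𝓘(ℝ, F) 𝓘(ℝ, E) (fun g : G => g • p) 1 (generator (E := E) (F := F) p : F →L[ℝ] E) :=
  ((contMDiff_smul_right E F p).mdifferentiable (by simp) 1).hasMFDerivAt

theorem diff_orbit {k : P → ℝ} (hk : SmoothFun (E := E) k) (p : P)
    (ξ : GroupLieAlgebra 𝓘(ℝ, F) G) :
    diff (E := F) (fun g : G => k (g • p)) 1 ξ = diff (E := E) k p (generator p ξ) := by
  have h1 := (HasMFDerivAt.of_eq (hk.mdifferentiable (by simp) p).hasMFDerivAt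
    (one_smul G p).symm).comp (1 : G) (hasMFDerivAt_orbit (E := E) (F := F) p)
  exact congrArg (fun A : F →L[ℝ] ℝ => A ξ) h1.mfderiv

/-- The right translate to the identity of a tangent vector of `G`. -/
def rightTranslate (g : G) (η : TangentSpace 𝓘(ℝ, F) g) : GroupLieAlgebra 𝓘(ℝ, F) G :=
  (mfderiv 𝓘(ℝ, F) 𝓘(ℝ, F) (fun k : G => k * g⁻¹) g : F →L[ℝ] F) η

/-- The orbit map of `p` is k ↦ k g⁻¹ followed by the orbit map of `g • p`, so the derivative at any
`g` reduces to one at the identity. -/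
theorem diff_orbit_of_ne_one {k : P → ℝ} (hk : SmoothFun (E := E) k) (p : P) (g : G)
    (η : TangentSpace 𝓘(ℝ, F) g) :
    diff (E := F) (fun g : G => k (g • p)) g η =
      diff (E := E) k (g • p) (generator (g • p) (rightTranslate g η)) := by
  rw [← diff_orbit (F := F) (G := G) hk]
  have h1 : ContMDiff 𝓘(ℝ, F) 𝓘(ℝ, ℝ) ∞ (fun k' : G => k (k' • (g • p))) :=
    ContMDiff.comp hk (contMDiff_smul_right E F (g • p))
  have h2 : HasMFDerivAt 𝓘(ℝ, F) 𝓘(ℝ, F) (fun k : G => k * g⁻¹) g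
      (mfderiv 𝓘(ℝ, F) 𝓘(ℝ, F) (fun k : G => k * g⁻¹) g) :=
    ((contMDiff_mul_right (I := 𝓘(ℝ, F)) (n := ∞) (a := g⁻¹)).mdifferentiable
      (by simp) g).hasMFDerivAt
  have h3 := (HasMFDerivAt.of_eq (h1.mdifferentiable (by simp) 1).hasMFDerivAt
    (mul_inv_cancel g).symm).comp g h2
  have h4 : (fun k' : G => k (k' • (g • p))) ∘ (fun k' : G => k' * g⁻¹) =
      fun g : G => k (g • p) := by
    funext k'
    simp [smul_smul]
  rw [h4] at h3
  exact congrArg (fun A : F →L[ℝ] ℝ => A η) h3.mfderiv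

/-- Since k g p = g (g⁻¹ k g) p, the witness is Ad(g⁻¹) ξ. -/
theorem exists_smulDiff_generator (g : G) (p : P) (ξ : GroupLieAlgebra 𝓘(ℝ, F) G) :
    ∃ ξ' : GroupLieAlgebra 𝓘(ℝ, F) G, generator (g • p) ξ =
      smulDiff g p (generator (E := E) (F := F) p ξ') := by
  let conj : G → G := fun k => g⁻¹ * k * g
  have hc : HasMFDerivAt 𝓘(ℝ, F) 𝓘(ℝ, F) conj 1 (mfderiv 𝓘(ℝ, F) 𝓘(ℝ, F) conj 1) :=
    (((contMDiff_mul_right (I := 𝓘(ℝ, F)) (n := ∞) (a := g)).comp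
      (contMDiff_mul_left (I := 𝓘(ℝ, F)) (n := ∞) (a := g⁻¹))).mdifferentiable
      (by simp) 1).hasMFDerivAt
  have e : (1 : G) = conj 1 := by simp [conj]
  have h1 := (HasMFDerivAt.of_eq (hasMFDerivAt_orbit (E := E) (F := F) (G := G) p) e).comp 1 hc
  have h2 := (HasMFDerivAt.of_eq (hasMFDerivAt_smul_left F g p)
    (show p = ((fun k : G => k • p) ∘ conj) 1 by simp [conj])).comp 1 h1
  have h4 : (fun q => g • q) ∘ (fun k : G => k • p) ∘ conj = fun k : G => k • g • p := by
    funext k'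
    simp [smul_smul, conj, mul_assoc]
  rw [h4] at h2
  exact ⟨(mfderiv 𝓘(ℝ, F) 𝓘(ℝ, F) conj 1 : F →L[ℝ] F) ξ,
    congrArg (fun A : F →L[ℝ] E => A ξ) h2.mfderiv⟩

end Action

/-! ### Symplectic complements of orbits and the tangency of φ_{g*}X_h - X_h -/

section HamiltonianAction

variable {E : Type*} [NormedAddCommGroup E] [NormedSpace ℝ E] [FiniteDimensional ℝ E]
  {P : Type*} [TopologicalSpace P] [ChartedSpace E P] [IsManifold 𝓘(ℝ, E) ∞ P]
  {F : Type*} [NormedAddCommGroup F] [NormedSpace ℝ F]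
  {G : Type*} [TopologicalSpace G] [ChartedSpace F G] [Group G] [LieGroup 𝓘(ℝ, F) ∞ G]
  [MulAction G P] [ContMDiffSMul 𝓘(ℝ, F) 𝓘(ℝ, E) ∞ G P]
  {Ω : SymplecticForm E P} {j : P → (GroupLieAlgebra 𝓘(ℝ, F) G →L[ℝ] ℝ)}

/-- A subspace is its own double symplectic complement: a functional vanishing on the orbit
directions but not at `w` would be represented through Ω by a vector `v` of the complement with Ω(w,
v) ≠ 0. -/
theorem mem_orbitTangentSpace_of_forall (Ω : SymplecticForm E P) {p : P}
    {w : TangentSpace 𝓘(ℝ, E) p}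
    (hw : ∀ v : TangentSpace 𝓘(ℝ, E) p,
      (∀ ξ : GroupLieAlgebra 𝓘(ℝ, F) G, Ω.toFun p (generator p ξ) v = 0) → Ω.toFun p w v = 0) :
    w ∈ orbitTangentSpace (F := F) G p := by
  have : FiniteDimensional ℝ (TangentSpace 𝓘(ℝ, E) p) := inferInstanceAs (FiniteDimensional ℝ E)
  have : T2Space (TangentSpace 𝓘(ℝ, E) p) := inferInstanceAs (T2Space E)
  by_contra hmem
  obtain ⟨α, hα, hker⟩ := Submodule.exists_le_ker_of_notMem hmem
  obtain ⟨v, hv⟩ := Ω.exists_sharp p (LinearMap.toContinuousLinearMap α)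
  have hv' : ∀ u, Ω.toFun p v u = α u := fun u =>
    congrArg (fun β : TangentSpace 𝓘(ℝ, E) p →L[ℝ] ℝ => β u) hv
  refine hα ?_
  rw [← hv', Ω.swap, hw v, neg_zero]
  intro ξ
  rw [Ω.swap, hv', neg_eq_zero]
  exact hker (LinearMap.mem_range_self _ ξ)

/-- Preserving a nondegenerate form forces injectivity, and both tangent spaces are the
finite-dimensional space `E`. -/
theorem smulDiff_surjective (hj : IsHamiltonianAction Ω j) (g : G) (p : P) :
    Function.Surjective (smulDiff (E := E) g p) := by
  have : FiniteDimensional ℝ (TangentSpace 𝓘(ℝ, E) p) := inferInstanceAs (FiniteDimensional ℝ E)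
  let A : E →L[ℝ] E := smulDiff (E := E) g p
  have hinj : Function.Injective A.toLinearMap := by
    rw [injective_iff_map_eq_zero]
    intro u hu
    refine Ω.nondegenerate p u fun v => ?_
    rw [← hj.symplectic g p u v]
    have h1 : mfderiv 𝓘(ℝ, E) 𝓘(ℝ, E) (fun q : P => g • q) p u = 0 := hu
    rw [h1, map_zero]
    rfl
  exact LinearMap.injective_iff_surjective.1 hinj

theorem hamiltonianVF_smul (hj : IsHamiltonianAction Ω j) {k : P → ℝ} (hk : SmoothFun (E := E) k)
    (g : G) (p : P) :
    hamiltonianVF Ω k (g • p) = smulDiff g p (hamiltonianVF Ω (fun q => k (g • q)) p) := by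
  refine sub_eq_zero.1 (Ω.nondegenerate (g • p) _ fun v => ?_)
  obtain ⟨u, rfl⟩ := smulDiff_surjective hj g p v
  rw [map_sub, sub_apply, sub_eq_zero, hamiltonianVF_spec, ← diff_comp_smul F hk,
    ← hamiltonianVF_spec]
  exact (hj.symplectic g p _ u).symm

theorem pushforward_smul (X : ∀ p : P, TangentSpace 𝓘(ℝ, E) p) (g : G) (p : P) :
    pushforward g X (g • p) = smulDiff g p (X p) := by
  -- The base point `g⁻¹ • g • p` occurs in a type, so it is generalized before being replaced by
  -- `p`.
  have h : ∀ q : P, q = p → (mfderiv 𝓘(ℝ, E) 𝓘(ℝ, E) (fun q : P => g • q) q : E →L[ℝ] E) (X q) =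
      (mfderiv 𝓘(ℝ, E) 𝓘(ℝ, E) (fun q : P => g • q) p : E →L[ℝ] E) (X p) := by
    rintro q rfl
    rfl
  exact h _ (inv_smul_smul g p)

/-- This takes the place of equivariance of `j`: the generator at `g • p` is the image under `g` of
a generator at `p`, and `g` preserves Ω. -/
theorem momentum_diff_eq_zero (hj : IsHamiltonianAction Ω j) {p : P} {v : TangentSpace 𝓘(ℝ, E) p}
    (hv : ∀ ξ : GroupLieAlgebra 𝓘(ℝ, F) G, Ω.toFun p (generator p ξ) v = 0) (g : G)
    (ξ : GroupLieAlgebra 𝓘(ℝ, F) G) : diff (E := E) (fun q => j (g • q) ξ) p v = 0 := by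
  obtain ⟨ξ', hξ'⟩ := exists_smulDiff_generator (E := E) g p ξ
  have h1 := diff_comp_smul F (hj.smooth_momentum ξ) g p v
  refine h1.trans ?_
  rw [← hj.momentum, hξ']
  exact (hj.symplectic g p _ v).trans (hv ξ')

variable {n : ℕ} {b : Module.Basis (Fin n) ℝ (GroupLieAlgebra 𝓘(ℝ, F) G)}
  {h : P → ℝ} {f : Fin n → (Fin n → ℝ) → ℝ}

/-- The hypothesis on the brackets enters here: along the orbits, the derivatives of `h` are
functions of the momentum alone. The sign comes from {j_a, h} = -X_{j_a} h. -/
theorem diff_generator (hj : IsHamiltonianAction Ω j)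
    (hjh : ∀ (a : Fin n) (p : P), bracket Ω (fun q => j q (b a)) h p = f a (fun c => j p (b c)))
    (p : P) (ξ : GroupLieAlgebra 𝓘(ℝ, F) G) :
    diff (E := E) h p (generator p ξ) = -∑ a, b.repr ξ a * f a (fun c => j p (b c)) := by
  have h1 : ∀ a, diff (E := E) h p (generator p (b a)) = -f a (fun c => j p (b c)) := fun a => by
    rw [← hjh, bracket_eq, ← hj.momentum, ← hamiltonianVF_spec Ω, Ω.swap]
  conv_lhs => rw [← b.sum_repr ξ]
  rw [map_sum, map_sum, ← Finset.sum_neg_distrib]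
  refine Finset.sum_congr rfl fun a _ => ?_
  rw [map_smul, map_smul, h1, smul_eq_mul, mul_neg]

/-- The covectors `d(h ∘ g)` at `p` all agree on the symplectic complement of the orbit. -/
theorem diff_smul_eq [ConnectedSpace G] (hj : IsHamiltonianAction Ω j)
    (hh : SmoothFun (E := E) h)
    (hf : ∀ (a : Fin n) (p : P), ContDiffAt ℝ ∞ (f a) (fun c => j p (b c)))
    (hjh : ∀ (a : Fin n) (p : P), bracket Ω (fun q => j q (b a)) h p = f a (fun c => j p (b c)))
    {p : P} {v : TangentSpace 𝓘(ℝ, E) p}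
    (hv : ∀ ξ : GroupLieAlgebra 𝓘(ℝ, F) G, Ω.toFun p (generator p ξ) v = 0) (g : G) :
    diff (E := E) (fun q => h (g • q)) p v = diff (E := E) h p v := by
  suffices H : ∀ g g' : G, diff (E := E) (fun q => h (g • q)) p v =
      diff (E := E) (fun q => h (g' • q)) p v by simpa using H g 1
  refine eq_of_hasFDerivAt_chart_zero (F := F) fun g₀ => ?_
  let c := extChartAt 𝓘(ℝ, E) p
  let d := extChartAt 𝓘(ℝ, F) g₀
  have hcT : IsOpen c.target := isOpen_extChartAt_target p
  have hp : p ∈ c.source := mem_extChartAt_source p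
  have hy₀ : c p ∈ c.target := mem_extChartAt_target p
  have hx₀ : d g₀ ∈ d.target := mem_extChartAt_target g₀
  let H : F × E → ℝ := fun z => h (d.symm z.1 • c.symm z.2)
  let v' : E := chartDiff p p v
  have hH : ContDiffAt ℝ 2 H (d g₀, c p) := by
    have h1 : ContMDiffAt 𝓘(ℝ, F) 𝓘(ℝ, F) ∞ d.symm (d g₀) :=
      (contMDiffOn_extChartAt_symm g₀).contMDiffAt ((isOpen_extChartAt_target g₀).mem_nhds hx₀)
    have h2 : ContMDiffAt 𝓘(ℝ, E) 𝓘(ℝ, E) ∞ c.symm (c p) :=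
      (contMDiffOn_extChartAt_symm p).contMDiffAt (hcT.mem_nhds hy₀)
    have h3 : ContMDiffAt 𝓘(ℝ, F × E) (𝓘(ℝ, F).prod 𝓘(ℝ, E)) ∞
        (fun z : F × E => (d.symm z.1, c.symm z.2)) (d g₀, c p) :=
      (ContMDiffAt.comp (d g₀, c p) h1 contDiff_fst.contMDiff.contMDiffAt).prodMk
        (ContMDiffAt.comp (d g₀, c p) h2 contDiff_snd.contMDiff.contMDiffAt)
    have h4 : ContMDiffAt 𝓘(ℝ, F × E) 𝓘(ℝ, ℝ) ∞ H (d g₀, c p) :=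
      (ContMDiff.comp hh (ContMDiffSMul.contMDiff_smul (I := 𝓘(ℝ, F)) (I' := 𝓘(ℝ, E))
        (n := ∞) (G := G) (M := P))).contMDiffAt.comp _ h3
    exact h4.contDiffAt.of_le (by norm_cast)
  have hS : ∀ x : F, diff (E := E) (fun q => h (d.symm x • q)) p v =
      fderiv ℝ (fun y => H (x, y)) (c p) v' := fun x =>
    diff_eq_fderiv (smoothFun_comp_smul F hh _) hp v
  rw [show (fun x => diff (E := E) (fun q => h (d.symm x • q)) p v) =
    fun x => fderiv ℝ (fun y => H (x, y)) (c p) v' from funext hS]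
  -- It remains to differentiate along `v` the derivative of `h` in the orbit direction `η`, which
  -- is a function of the momentum.
  refine fderiv_fderiv_eq_zero hH v' fun η => ?_
  -- This is `g₀` again; the form produced by the chart is kept to avoid rewriting the base point of
  -- `η'`.
  let g₁ : G := d.symm (d g₀)
  let η' : TangentSpace 𝓘(ℝ, F) g₁ := chartDiffSymm g₀ (d g₀) η
  let ξ : GroupLieAlgebra 𝓘(ℝ, F) G := rightTranslate g₁ η'
  let L : ℝ → E := fun t => c p + t • v'
  have hL : HasDerivAt L v' 0 := by
    have := ((hasDerivAt_id (0 : ℝ)).smul_const v').const_add (c p)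
    rw [one_smul] at this
    exact this
  have hL0 : L 0 = c p := by simp [L]
  have h1 : ∀ y : E, fderiv ℝ (fun x => H (x, y)) (d g₀) η =
      -∑ a, b.repr ξ a * f a (fun i => j (g₁ • c.symm y) (b i)) := fun y => by
    have h2 : SmoothFun (E := F) (fun g : G => h (g • c.symm y)) :=
      ContMDiff.comp hh (contMDiff_smul_right E F (c.symm y))
    have h3 := hasFDerivAt_comp_extChartAt_symm h2 hx₀
    rw [← diff_generator hj hjh, ← diff_orbit_of_ne_one hh]
    exact congrArg (fun A : F →L[ℝ] ℝ => A η) h3.fderiv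
  have h5 : HasDerivAt (fun t => fun i => j (g₁ • c.symm (L t)) (b i)) (0 : Fin n → ℝ) 0 := by
    rw [hasDerivAt_pi]
    intro i
    have hsm : SmoothFun (E := E) (fun q => j (g₁ • q) (b i)) :=
      smoothFun_comp_smul F (hj.smooth_momentum (b i)) g₁
    have h6 := (hasFDerivAt_comp_extChartAt_symm hsm hy₀).differentiableAt.hasFDerivAt
    have h7 : fderiv ℝ (fun y => j (g₁ • c.symm y) (b i)) (c p) v' = 0 :=
      (diff_eq_fderiv hsm hp v).symm.trans (momentum_diff_eq_zero hj hv g₁ (b i))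
    rw [← hL0] at h6
    have h8 := h6.comp_hasDerivAt (0 : ℝ) hL
    rw [hL0] at h8
    exact h8.congr_deriv h7
  -- Chain rule: the momentum is stationary at 0 along the curve, and `f a` is differentiable at its
  -- value.
  have h9 : ∀ a, HasDerivAt (fun t => f a (fun i => j (g₁ • c.symm (L t)) (b i))) 0 0 :=
    fun a => by
      have h10 := ((hf a (g₁ • c.symm (L 0))).differentiableAt (by simp)).hasFDerivAt
      exact (h10.comp_hasDerivAt (0 : ℝ) h5).congr_deriv (map_zero _)
  have h11 : HasDerivAt (fun t => -∑ a, b.repr ξ a * f a (fun i => j (g₁ • c.symm (L t)) (b i)))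
      0 0 := by
    have h12 := (HasDerivAt.fun_sum (u := Finset.univ)
      fun a _ => (h9 a).const_mul (b.repr ξ a)).fun_neg
    exact h12.congr_deriv (by simp)
  have h13 := h11.hasFDerivAt
  simp only [ContinuousLinearMap.toSpanSingleton_zero] at h13
  exact h13.congr_of_eventuallyEq (Filter.Eventually.of_forall fun t => h1 (L t))

/-- The push-forward of `X_h` is the Hamiltonian field of h ∘ g⁻¹, whose differential agrees with dh
on the complement of the orbit by `diff_smul_eq`; the double complement gives the claim. -/
theorem pushforward_sub_mem_orbitTangentSpace [ConnectedSpace G] (hj : IsHamiltonianAction Ω j)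
    (hh : SmoothFun (E := E) h)
    (hf : ∀ (a : Fin n) (p : P), ContDiffAt ℝ ∞ (f a) (fun c => j p (b c)))
    (hjh : ∀ (a : Fin n) (p : P), bracket Ω (fun q => j q (b a)) h p = f a (fun c => j p (b c)))
    (g : G) (p : P) :
    pushforward g (hamiltonianVF Ω h) p - hamiltonianVF Ω h p ∈ orbitTangentSpace (F := F) G p := by
  obtain ⟨q, rfl⟩ : ∃ q, g • q = p := ⟨g⁻¹ • p, smul_inv_smul g p⟩
  refine mem_orbitTangentSpace_of_forall Ω fun v hv => ?_
  have h2 := hamiltonianVF_smul hj (smoothFun_comp_smul F hh g⁻¹) g q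
  simp only [inv_smul_smul] at h2
  rw [pushforward_smul]
  refine (congrArg (fun w => Ω.toFun (g • q) (w - hamiltonianVF Ω h (g • q)) v) h2.symm).trans ?_
  rw [map_sub, sub_apply, hamiltonianVF_spec, hamiltonianVF_spec, diff_smul_eq hj hh hf hjh hv,
    sub_self]

/-! ### Invariant functions -/

theorem diff_generator_of_invariant {k : P → ℝ} (hk : k ∈ invariantFunctions E P G) (p : P)
    (ξ : GroupLieAlgebra 𝓘(ℝ, F) G) : diff (E := E) k p (generator p ξ) = 0 := by
  rw [← diff_orbit (F := F) (G := G) hk.1]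
  have h1 : (fun g : G => k (g • p)) = fun _ => k p := funext fun g => hk.2 g p
  rw [h1, diff, mfderiv_const]
  rfl

variable (F) in
include F in
theorem diff_smul_of_invariant {k : P → ℝ} (hk : k ∈ invariantFunctions E P G) (g : G) (p : P)
    (u : TangentSpace 𝓘(ℝ, E) p) :
    diff (E := E) k (g • p) (smulDiff g p u) = diff (E := E) k p u := by
  rw [← diff_comp_smul F hk.1, show (fun q => k (g • q)) = k from funext fun q => hk.2 g q]

theorem diff_eq_of_sub_mem {k : P → ℝ} (hk : k ∈ invariantFunctions E P G) {p : P}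
    {u w : TangentSpace 𝓘(ℝ, E) p} (huw : u - w ∈ orbitTangentSpace (F := F) G p) :
    diff (E := E) k p u = diff (E := E) k p w := by
  obtain ⟨ξ, hξ⟩ := huw
  rw [← sub_eq_zero, ← map_sub, ← hξ]
  exact diff_generator_of_invariant hk p ξ

/-- The field of `l` need only be invariant modulo orbit directions, because `k` is constant along
orbits. -/
theorem bracket_mem_invariantFunctions_of_diff {k l : P → ℝ} (hk : k ∈ invariantFunctions E P G)
    (hl : SmoothFun (E := E) l) (hkl : ∀ (g : G) (p : P),
      pushforward g (hamiltonianVF Ω l) p - hamiltonianVF Ω l p ∈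
        orbitTangentSpace (F := F) G p) :
    bracket Ω k l ∈ invariantFunctions E P G := by
  refine ⟨smoothFun_bracket Ω hk.1 hl, fun g p => ?_⟩
  rw [bracket_eq, bracket_eq, ← diff_smul_of_invariant F hk g p, ← pushforward_smul]
  exact (diff_eq_of_sub_mem hk (hkl g (g • p))).symm

theorem bracket_mem_invariantFunctions (hj : IsHamiltonianAction Ω j) {k l : P → ℝ}
    (hk : k ∈ invariantFunctions E P G) (hl : l ∈ invariantFunctions E P G) :
    bracket Ω k l ∈ invariantFunctions E P G := by
  refine bracket_mem_invariantFunctions_of_diff (F := F) hk hl.1 fun g p => ?_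
  obtain ⟨q, rfl⟩ : ∃ q, g • q = p := ⟨g⁻¹ • p, smul_inv_smul g p⟩
  rw [pushforward_smul, hamiltonianVF_smul hj hl.1,
    show (fun r => l (g • r)) = l from funext fun r => hl.2 g r, sub_self]
  exact Submodule.zero_mem _

end HamiltonianAction

/-! ### Derivatives of integrals -/

section DerivIntegral

open MeasureTheory

universe u

variable {E : Type u} [NormedAddCommGroup E] [NormedSpace ℝ E]
  {F : Type*} [NormedAddCommGroup F] [NormedSpace ℝ F]
  {G : Type*} [TopologicalSpace G] [ChartedSpace F G] [IsManifold 𝓘(ℝ, F) ∞ G]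
  [T2Space G] [MeasurableSpace G] [BorelSpace G] {μ : Measure G}
  [IsFiniteMeasureOnCompacts μ] {K : Set G}

/-- Smoothness of the integral is already known, so differentiating under the integral sign along
the line through `x` in direction `v` suffices. -/
theorem fderiv_setIntegral_eq_zero (hK : IsCompact K) {Φ : G × E → ℝ}
    (hΦ : ContMDiff (𝓘(ℝ, F).prod 𝓘(ℝ, E)) 𝓘(ℝ, ℝ) ∞ Φ) {x v : E}
    (hv : ∀ g, fderiv ℝ (fun y => Φ (g, y)) x v = 0) :
    fderiv ℝ (fun x => ∫ g in K, Φ (g, x) ∂μ) x v = 0 := by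
  have h1 : ContDiff ℝ ∞ (fun y => ∫ g in K, Φ (g, y) ∂μ) := contDiff_setIntegral hK hΦ
  have hcont := (contMDiff_fderiv_snd hΦ).continuous
  have hdiff : ∀ g y, DifferentiableAt ℝ (fun y => Φ (g, y)) y := fun g y =>
    ((hΦ.comp (contMDiff_const.prodMk contMDiff_id)).contDiff.differentiable (by simp)) y
  let Q : G × ℝ → ℝ := fun z => fderiv ℝ (fun y => Φ (z.1, y)) (x + z.2 • v) v
  have hQ : Continuous Q := by
    have h2 : Continuous (fun z : G × ℝ => (z.1, x + z.2 • v)) := by fun_prop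
    exact (hcont.comp h2).clm_apply continuous_const
  -- A bound on the compact set `K × [-1, 1]` serves as the dominating constant.
  obtain ⟨C, hC⟩ := (hK.prod (isCompact_Icc (a := (-1 : ℝ)) (b := 1))).exists_bound_of_continuousOn
    hQ.continuousOn
  have hΦc : ∀ t : ℝ, Continuous fun g => Φ (g, x + t • v) := fun t =>
    hΦ.continuous.comp (by fun_prop)
  have h3 := hasDerivAt_integral_of_dominated_loc_of_deriv_le (μ := μ.restrict K) (𝕜 := ℝ)
    (F := fun t g => Φ (g, x + t • v)) (F' := fun t g => Q (g, t)) (x₀ := (0 : ℝ))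
    (s := Set.Icc (-1) 1) (bound := fun _ => C) (Icc_mem_nhds (by norm_num) (by norm_num))
    (Filter.Eventually.of_forall fun t =>
      (hΦc t).continuousOn.aestronglyMeasurable_of_isCompact hK hK.measurableSet)
    ((hΦc 0).continuousOn.integrableOn_compact hK)
    ((hQ.comp (by fun_prop : Continuous fun g : G => (g, (0 : ℝ)))).continuousOn.aestronglyMeasurable_of_isCompact hK hK.measurableSet)
    ((ae_restrict_iff' hK.measurableSet).2 (ae_of_all _ fun g hg t ht => hC (g, t) ⟨hg, ht⟩))
    ((integrableOn_const_iff).2 (Or.inr hK.measure_lt_top))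
    (ae_of_all _ fun g t _ => by
      have h4 : HasDerivAt (fun t : ℝ => x + t • v) v t := by
        have := ((hasDerivAt_id t).smul_const v).const_add x
        rwa [one_smul] at this
      exact (hdiff g (x + t • v)).hasFDerivAt.comp_hasDerivAt t h4)
  have h5 : ∀ g, Q (g, 0) = 0 := fun g => by simpa [Q] using hv g
  simp only [h5, integral_zero] at h3
  have h6 : HasDerivAt (fun t : ℝ => x + t • v) v 0 := by
    have := ((hasDerivAt_id (0 : ℝ)).smul_const v).const_add x
    rwa [one_smul] at this
  have h7 : HasFDerivAt (fun y => ∫ g in K, Φ (g, y) ∂μ)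
      (fderiv ℝ (fun y => ∫ g in K, Φ (g, y) ∂μ) x) (x + (0 : ℝ) • v) := by
    rw [zero_smul, add_zero]
    exact (h1.differentiable (by simp) x).hasFDerivAt
  have h8 := h7.comp_hasDerivAt (0 : ℝ) h6
  exact h8.unique h3.2

theorem diff_setIntegral_eq_zero [FiniteDimensional ℝ E]
    {P : Type*} [TopologicalSpace P] [ChartedSpace E P] [IsManifold 𝓘(ℝ, E) ∞ P]
    (hK : IsCompact K) {Φ : G × P → ℝ}
    (hΦ : ContMDiff (𝓘(ℝ, F).prod 𝓘(ℝ, E)) 𝓘(ℝ, ℝ) ∞ Φ) {p : P} {v : TangentSpace 𝓘(ℝ, E) p}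
    (hv : ∀ g, diff (E := E) (fun q => Φ (g, q)) p v = 0) :
    diff (E := E) (fun x => ∫ g in K, Φ (g, x) ∂μ) p v = 0 := by
  obtain ⟨β, hβ⟩ := exists_contDiffBump (isOpen_extChartAt_target (I := 𝓘(ℝ, E)) p)
    (mem_extChartAt_target (I := 𝓘(ℝ, E)) p)
  have hp := mem_extChartAt_source (I := 𝓘(ℝ, E)) p
  have h1 : ContMDiff (𝓘(ℝ, F).prod 𝓘(ℝ, E)) 𝓘(ℝ, ℝ) ∞
      (fun z : G × E => β z.2 • Φ (z.1, (extChartAt 𝓘(ℝ, E) p).symm z.2)) := by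
    refine contMDiff_bump_smul _ β hβ fun z hz => ?_
    refine hΦ.contMDiffAt.comp z (contMDiffAt_fst.prodMk ?_)
    exact (((contMDiffOn_extChartAt_symm p).contMDiffAt
      ((isOpen_extChartAt_target p).mem_nhds hz)).comp z contMDiffAt_snd)
  rw [diff_eq_fderiv (contMDiff_setIntegral hK hΦ) hp]
  have hβ1 := β.eventuallyEq_one
  have h2 := fderiv_setIntegral_eq_zero (μ := μ) hK h1 (x := extChartAt 𝓘(ℝ, E) p p)
    (v := chartDiff p p v) fun g => by
      have h3 : SmoothFun (E := E) (fun q => Φ (g, q)) :=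
        hΦ.comp (contMDiff_const.prodMk contMDiff_id)
      rw [← hv g, diff_eq_fderiv h3 hp]
      refine congrArg (fun A : E →L[ℝ] ℝ => A (chartDiff p p v)) (Filter.EventuallyEq.fderiv_eq ?_)
      filter_upwards [hβ1] with y hy
      have hy1 : β y = 1 := hy
      simp only [hy1, one_smul]
  rw [← h2]
  refine congrArg (fun A : E →L[ℝ] ℝ => A (chartDiff p p v)) (Filter.EventuallyEq.fderiv_eq ?_)
  filter_upwards [hβ1] with y hy
  have hy1 : β y = 1 := hy
  simp only [hy1, one_smul]

end DerivIntegral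

/-! ### Averaging over the group -/

section Averaging

open MeasureTheory

variable {E : Type*} [NormedAddCommGroup E] [NormedSpace ℝ E] [FiniteDimensional ℝ E]
  {P : Type*} [TopologicalSpace P] [T2Space P] [ChartedSpace E P] [IsManifold 𝓘(ℝ, E) ∞ P]
  {F : Type*} [NormedAddCommGroup F] [NormedSpace ℝ F]
  {G : Type*} [TopologicalSpace G] [T2Space G] [ChartedSpace F G] [Group G]
  [LieGroup 𝓘(ℝ, F) ∞ G] [MulAction G P] [ContMDiffSMul 𝓘(ℝ, F) 𝓘(ℝ, E) ∞ G P]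
  [ProperSMul G P]

omit [T2Space P] [ChartedSpace E P] [IsManifold 𝓘(ℝ, E) ∞ P] [T2Space G] [ChartedSpace F G]
  [LieGroup 𝓘(ℝ, F) ∞ G] [ContMDiffSMul 𝓘(ℝ, F) 𝓘(ℝ, E) ∞ G P] in
-- Properness: (g, g⁻¹p) lies in the preimage of `B ×ˢ K` under (g, q) ↦ (gq, q), which is compact.
theorem exists_isCompact_forall_smul_mem {K B : Set P} (hK : IsCompact K) (hB : IsCompact B) :
    ∃ L : Set G, IsCompact L ∧ ∀ g : G, ∀ p ∈ B, g⁻¹ • p ∈ K → g ∈ L := by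
  refine ⟨Prod.fst '' ((fun z : G × P => (z.1 • z.2, z.2)) ⁻¹' (B ×ˢ K)),
    ((ProperSMul.isProperMap_smul_pair (G := G) (X := P)).isCompact_preimage
      (hB.prod hK)).image continuous_fst, fun g p hp hg => ⟨(g, g⁻¹ • p), ⟨?_, hg⟩, rfl⟩⟩
  simpa using hp

variable [IsTopologicalGroup G] [MeasurableSpace G] [BorelSpace G] (μ : Measure G)
  [μ.IsHaarMeasure]

/-- The average of `u` over the orbit of `q`, weighted by `θ` along the orbit of `p`. -/
def orbitAverage (θ u : P → ℝ) (p q : P) : ℝ := ∫ g : G, θ (g⁻¹ • p) * u (g⁻¹ • q) ∂μ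

/-- Left invariance of the Haar measure; both points must be moved together. -/
theorem orbitAverage_smul (θ u : P → ℝ) (k : G) (p q : P) :
    orbitAverage μ θ u (k • p) (k • q) = orbitAverage μ θ u p q := by
  rw [orbitAverage, orbitAverage,
    ← integral_mul_left_eq_self (fun g : G => θ (g⁻¹ • k • p) * u (g⁻¹ • k • q)) k]
  simp [smul_smul, mul_assoc]

variable (E F) in
include F in
theorem contMDiff_inv_smul : ContMDiff (𝓘(ℝ, F).prod 𝓘(ℝ, E)) 𝓘(ℝ, E) ∞
    (fun z : G × P => z.1⁻¹ • z.2) :=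
  (ContMDiffSMul.contMDiff_smul (I := 𝓘(ℝ, F)) (I' := 𝓘(ℝ, E)) (n := ∞) (G := G) (M := P)).comp
    (((contMDiff_inv 𝓘(ℝ, F) ∞).comp contMDiff_fst).prodMk contMDiff_snd)

omit [T2Space P] [ChartedSpace E P] [IsManifold 𝓘(ℝ, E) ∞ P] [ChartedSpace F G] [T2Space G]
  [LieGroup 𝓘(ℝ, F) ∞ G] [ContMDiffSMul 𝓘(ℝ, F) 𝓘(ℝ, E) ∞ G P] [ProperSMul G P]
  [IsTopologicalGroup G] [BorelSpace G] [μ.IsHaarMeasure] in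
theorem orbitAverage_eq_setIntegral {θ : P → ℝ} {L : Set G} {p : P}
    (hL : ∀ g : G, θ (g⁻¹ • p) ≠ 0 → g ∈ L) (u : P → ℝ) (q : P) :
    orbitAverage μ θ u p q = ∫ g in L, θ (g⁻¹ • p) * u (g⁻¹ • q) ∂μ := by
  refine (setIntegral_eq_integral_of_forall_compl_eq_zero fun g hg => ?_).symm
  by_contra hne
  exact hg (hL g fun h => hne (by rw [h, zero_mul]))

variable (F) in
include F in
-- For `p` in a compact neighbourhood of `p₀`, one compact set of group elements carries the whole
-- integral. The second point is unrestricted, as the weight depends on `p` only.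
theorem contMDiff_orbitAverage {θ u : P → ℝ} (hθ : SmoothFun (E := E) θ)
    (hθc : HasCompactSupport θ) (hu : SmoothFun (E := E) u) :
    ContMDiff (𝓘(ℝ, E).prod 𝓘(ℝ, E)) 𝓘(ℝ, ℝ) ∞ (Function.uncurry (orbitAverage μ θ u)) := by
  have : LocallyCompactSpace P := Manifold.locallyCompact_of_finiteDimensional 𝓘(ℝ, E)
  rintro ⟨p₀, q₀⟩
  obtain ⟨B, hB, hB'⟩ := exists_compact_mem_nhds p₀
  obtain ⟨L, hL, hL'⟩ := exists_isCompact_forall_smul_mem (G := G) hθc hB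
  have h1 : ContMDiff (𝓘(ℝ, F).prod (𝓘(ℝ, E).prod 𝓘(ℝ, E))) 𝓘(ℝ, ℝ) ∞
      (fun z : G × P × P => θ (z.1⁻¹ • z.2.1) * u (z.1⁻¹ • z.2.2)) :=
    ContMDiff.mul
      (hθ.comp ((contMDiff_inv_smul E F).comp
        (contMDiff_fst.prodMk (contMDiff_fst.comp contMDiff_snd))))
      (hu.comp ((contMDiff_inv_smul E F).comp
        (contMDiff_fst.prodMk (contMDiff_snd.comp contMDiff_snd))))
  refine (contMDiff_setIntegral (μ := μ) hL h1).contMDiffAt.congr_of_eventuallyEq ?_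
  filter_upwards [continuous_fst.continuousAt.preimage_mem_nhds hB'] with z hz
  exact orbitAverage_eq_setIntegral μ
    (fun g hg => hL' g z.1 hz (subset_tsupport _ hg)) u z.2

variable (F) in
include F in
theorem orbitAverage_one_mem_invariantFunctions {θ : P → ℝ} (hθ : SmoothFun (E := E) θ)
    (hθc : HasCompactSupport θ) :
    (fun p => orbitAverage μ θ 1 p p) ∈ invariantFunctions E P G :=
  ⟨(contMDiff_orbitAverage F μ hθ hθc contMDiff_const).comp (contMDiff_id.prodMk contMDiff_id),
    fun g p => orbitAverage_smul μ θ 1 g p p⟩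

variable (E F) in
include E F in
theorem orbitAverage_one_pos {θ : P → ℝ} (hθ : Continuous θ) (hθc : HasCompactSupport θ)
    (hθ0 : 0 ≤ θ) {p : P} (hp : 0 < θ p) : 0 < orbitAverage μ θ 1 p p := by
  obtain ⟨L, hL, hL'⟩ := exists_isCompact_forall_smul_mem (G := G) hθc (isCompact_singleton (x := p))
  have hc : Continuous fun g : G => θ (g⁻¹ • p) * (1 : P → ℝ) (g⁻¹ • p) := by
    have h1 : Continuous fun g : G => g⁻¹ • p :=
      (contMDiff_inv_smul E F (P := P)).continuous.comp (by fun_prop : Continuous fun g => (g, p))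
    simpa [Function.comp_def] using hθ.comp h1
  refine hc.integral_pos_of_hasCompactSupport_nonneg_nonzero (x := 1)
    (HasCompactSupport.intro hL fun g hg => ?_) (fun g => ?_) (by simpa using hp.ne')
  · by_contra hne
    exact hg (hL' g p rfl (subset_tsupport _ fun h => hne (by rw [h, zero_mul])))
  · simpa using hθ0 _

theorem orbitAverage_one_ne_zero {θ : P → ℝ} {p : P} (hp : orbitAverage μ θ 1 p p ≠ 0) :
    ∃ g : G, θ (g⁻¹ • p) ≠ 0 := by
  by_contra! hne
  exact hp (by simp [orbitAverage, hne])

/-- With the weight frozen at `p`, each g contributes θ(g⁻¹p) d(h ∘ g⁻¹)(v), which equals θ(g⁻¹p)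
dh(v) by `diff_smul_eq`. -/
theorem diff_orbitAverage [ConnectedSpace G] {Ω : SymplecticForm E P}
    {j : P → (GroupLieAlgebra 𝓘(ℝ, F) G →L[ℝ] ℝ)}
    {n : ℕ} {b : Module.Basis (Fin n) ℝ (GroupLieAlgebra 𝓘(ℝ, F) G)}
    {h : P → ℝ} {f : Fin n → (Fin n → ℝ) → ℝ} (hj : IsHamiltonianAction Ω j)
    (hh : SmoothFun (E := E) h)
    (hf : ∀ (a : Fin n) (p : P), ContDiffAt ℝ ∞ (f a) (fun c => j p (b c)))
    (hjh : ∀ (a : Fin n) (p : P), bracket Ω (fun q => j q (b a)) h p = f a (fun c => j p (b c)))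
    {θ : P → ℝ} (hθ : SmoothFun (E := E) θ) (hθc : HasCompactSupport θ)
    {p : P} {v : TangentSpace 𝓘(ℝ, E) p}
    (hv : ∀ ξ : GroupLieAlgebra 𝓘(ℝ, F) G, Ω.toFun p (generator p ξ) v = 0) :
    diff (E := E) (orbitAverage μ θ h p) p v = orbitAverage μ θ 1 p p * diff (E := E) h p v := by
  obtain ⟨L, hL, hL'⟩ := exists_isCompact_forall_smul_mem (G := G) hθc (isCompact_singleton (x := p))
  have hLθ : ∀ g : G, θ (g⁻¹ • p) ≠ 0 → g ∈ L := fun g hg => hL' g p rfl (subset_tsupport _ hg)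
  have hinvp : ContMDiff (𝓘(ℝ, F).prod 𝓘(ℝ, E)) 𝓘(ℝ, E) ∞ (fun z : G × P => z.1⁻¹ • p) :=
    (contMDiff_inv_smul E F (G := G) (P := P)).comp (contMDiff_fst.prodMk contMDiff_const)
  have hA : ContMDiff (𝓘(ℝ, F).prod 𝓘(ℝ, E)) 𝓘(ℝ, ℝ) ∞
      (fun z : G × P => θ (z.1⁻¹ • p) * h (z.1⁻¹ • z.2)) :=
    ContMDiff.mul (hθ.comp hinvp) (hh.comp (contMDiff_inv_smul E F))
  have hB : ContMDiff (𝓘(ℝ, F).prod 𝓘(ℝ, E)) 𝓘(ℝ, ℝ) ∞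
      (fun z : G × P => θ (z.1⁻¹ • p) * h z.2) :=
    ContMDiff.mul (hθ.comp hinvp) (hh.comp contMDiff_snd)
  have hd : ∀ {u : P → ℝ}, SmoothFun (E := E) u → MDifferentiableAt 𝓘(ℝ, E) 𝓘(ℝ, ℝ) u p :=
    fun hu => hu.mdifferentiable (by simp) p
  have hsub : ∀ {u w : P → ℝ}, SmoothFun (E := E) u → SmoothFun (E := E) w →
      diff (E := E) (fun q => u q - w q) p v = diff (E := E) u p v - diff (E := E) w p v :=
    fun hu hw => congrArg (fun A : E →L[ℝ] ℝ => A v)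
      ((hd hu).hasMFDerivAt.sub (hd hw).hasMFDerivAt).mfderiv
  have hmul : ∀ (r : ℝ) {u : P → ℝ}, SmoothFun (E := E) u →
      diff (E := E) (fun q => r * u q) p v = r * diff (E := E) u p v :=
    fun r u hu => congrArg (fun A : E →L[ℝ] ℝ => A v)
      ((hd hu).hasMFDerivAt.const_smul r).mfderiv
  -- Subtracting θ(g⁻¹p) h(q) inside the integral makes every integrand stationary along `v`.
  have key := diff_setIntegral_eq_zero (μ := μ) hL (ContMDiff.sub hA hB) (p := p) (v := v)
    fun g => by
      have h1 := smoothFun_comp_smul F hh g⁻¹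
      have h2 : (fun q => θ (g⁻¹ • p) * h (g⁻¹ • q) - θ (g⁻¹ • p) * h q) =
          fun q => θ (g⁻¹ • p) * (h (g⁻¹ • q) - h q) := by funext q; ring
      refine (congrArg (fun w => diff (E := E) w p v) h2).trans ?_
      rw [hmul _ (ContMDiff.sub h1 hh), hsub h1 hh, diff_smul_eq hj hh hf hjh hv, sub_self,
        mul_zero]
  have hcongr : (fun q => ∫ g in L, (θ (g⁻¹ • p) * h (g⁻¹ • q) - θ (g⁻¹ • p) * h q) ∂μ) =
      fun q => orbitAverage μ θ h p q - orbitAverage μ θ 1 p p * h q := by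
    funext q
    rw [orbitAverage_eq_setIntegral μ hLθ, orbitAverage_eq_setIntegral μ hLθ,
      ← integral_mul_const, ← integral_sub]
    · simp
    · exact (hA.continuous.comp
        (by fun_prop : Continuous fun g : G => (g, q))).continuousOn.integrableOn_compact hL
    · simp only [Pi.one_apply, mul_one]
      exact (hB.continuous.comp
        (by fun_prop : Continuous fun g : G => (g, q))).continuousOn.integrableOn_compact hL
  replace key := (congrArg (fun u => diff (E := E) u p v) hcongr).symm.trans key
  have hav : SmoothFun (E := E) (orbitAverage μ θ h p) :=
    (contMDiff_orbitAverage F μ hθ hθc hh).comp (contMDiff_const.prodMk contMDiff_id)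
  have hNh : SmoothFun (E := E) (fun q => orbitAverage μ θ 1 p p * h q) :=
    ContMDiff.mul contMDiff_const hh
  rw [hsub hav hNh, hmul _ hh] at key
  exact sub_eq_zero.1 key

end Averaging

/-! ### Invariant cut-off functions and an invariant vector field -/

section InvariantField

open MeasureTheory

variable {E : Type*} [NormedAddCommGroup E] [NormedSpace ℝ E] [FiniteDimensional ℝ E]
  {P : Type*} [TopologicalSpace P] [T2Space P] [ChartedSpace E P] [IsManifold 𝓘(ℝ, E) ∞ P]
  {F : Type*} [NormedAddCommGroup F] [NormedSpace ℝ F] [FiniteDimensional ℝ F]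
  {G : Type*} [TopologicalSpace G] [T2Space G] [ChartedSpace F G] [Group G]
  [LieGroup 𝓘(ℝ, F) ∞ G] [MulAction G P] [ContMDiffSMul 𝓘(ℝ, F) 𝓘(ℝ, E) ∞ G P]
  [ProperSMul G P]

variable (E) in
theorem exists_smooth_bump {O : Set P} (hO : IsOpen O) {p : P}
    (hp : p ∈ O) : ∃ θ : P → ℝ, SmoothFun (E := E) θ ∧ HasCompactSupport θ ∧ 0 ≤ θ ∧ 0 < θ p ∧
      Function.support θ ⊆ O := by
  obtain ⟨θ, -, hθ⟩ := (SmoothBumpFunction.nhds_basis_tsupport (I := 𝓘(ℝ, E)) p).mem_iff.1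
    (hO.mem_nhds hp)
  exact ⟨θ, θ.contMDiff, θ.hasCompactSupport, fun q => θ.nonneg, by rw [θ.eq_one]; norm_num,
    (subset_tsupport _).trans hθ⟩

variable (F) in
include F in
/-- A weight whose average over the group is positive at a given point and supported in a given
invariant open set. -/
theorem exists_invariantFunction_pos [IsTopologicalGroup G] [MeasurableSpace G] [BorelSpace G]
    (μ : Measure G) [μ.IsHaarMeasure] {S : Set P} (hS : IsOpen S)
    (hSG : ∀ (g : G) (p : P), p ∈ S → g • p ∈ S) {p₀ : P} (hp₀ : p₀ ∈ S) :
    ∃ θ : P → ℝ, SmoothFun (E := E) θ ∧ HasCompactSupport θ ∧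
      (fun p => orbitAverage μ θ 1 p p) ∈ invariantFunctions E P G ∧
      0 < orbitAverage μ θ 1 p₀ p₀ ∧ ∀ p, orbitAverage μ θ 1 p p ≠ 0 → p ∈ S := by
  obtain ⟨θ, hθ, hθc, hθ0, hθp, hθS⟩ := exists_smooth_bump E hS hp₀
  refine ⟨θ, hθ, hθc, orbitAverage_one_mem_invariantFunctions F μ hθ hθc,
    orbitAverage_one_pos E F μ hθ.continuous hθc hθ0 hθp, fun p hp => ?_⟩
  obtain ⟨g, hg⟩ := orbitAverage_one_ne_zero μ hp
  simpa using hSG g _ (hθS hg)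

omit [FiniteDimensional ℝ E] [T2Space P] [ContMDiffSMul 𝓘(ℝ, F) 𝓘(ℝ, E) ∞ G P] [ProperSMul G P]
  [T2Space G] [LieGroup 𝓘(ℝ, F) ∞ G] [FiniteDimensional ℝ F] [IsManifold 𝓘(ℝ, E) ∞ P] in
theorem exists_cutoff_of_pos {N : P → ℝ} (hN : N ∈ invariantFunctions E P G) {p₀ : P}
    (hp₀ : 0 < N p₀) : ∃ κ ∈ invariantFunctions E P G, κ =ᶠ[𝓝 p₀] 1 ∧
      tsupport κ ⊆ Function.support N := by
  have hNc : Continuous N := hN.1.continuous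
  -- The argument is at most 0 where N ≤ N(p₀)/4, and at least 1 where N ≥ N(p₀)/2.
  refine ⟨fun p => Real.smoothTransition (4 * N p / N p₀ - 1), ⟨?_, fun g p => ?_⟩, ?_, ?_⟩
  · have h1 : ContDiff ℝ ∞ (fun t : ℝ => Real.smoothTransition (4 * t / N p₀ - 1)) :=
      Real.smoothTransition.contDiff.comp (by fun_prop)
    exact h1.contMDiff.comp hN.1
  · simp only [hN.2 g p]
  · have h1 : ∀ᶠ p in 𝓝 p₀, N p₀ / 2 < N p :=
      hNc.continuousAt.eventually (lt_mem_nhds (by linarith))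
    filter_upwards [h1] with p hp
    refine Real.smoothTransition.one_of_one_le ?_
    rw [le_sub_iff_add_le, le_div_iff₀ hp₀]
    linarith
  · have hcl : IsClosed {p | N p₀ / 4 ≤ N p} := isClosed_le continuous_const hNc
    refine (closure_minimal (fun p hp => ?_) hcl).trans fun p (hp : N p₀ / 4 ≤ N p) => ?_
    · by_contra hlt
      refine hp (Real.smoothTransition.zero_of_nonpos ?_)
      rw [sub_nonpos, div_le_iff₀ hp₀]
      simp only [Set.mem_ofPred_eq, not_le] at hlt
      linarith
    · exact (lt_of_lt_of_le (by linarith) hp).ne'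

variable (F) in
include F in
theorem exists_invariant_cutoff {S : Set P} (hS : IsOpen S)
    (hSG : ∀ (g : G) (p : P), p ∈ S → g • p ∈ S) {p₀ : P} (hp₀ : p₀ ∈ S) :
    ∃ κ ∈ invariantFunctions E P G, κ =ᶠ[𝓝 p₀] 1 ∧ tsupport κ ⊆ S := by
  have : IsTopologicalGroup G := topologicalGroup_of_lieGroup 𝓘(ℝ, F) ∞
  have : LocallyCompactSpace G := Manifold.locallyCompact_of_finiteDimensional 𝓘(ℝ, F)
  borelize G
  obtain ⟨θ, -, -, hN, hN0, hNS⟩ := exists_invariantFunction_pos (E := E) F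
    (Measure.haar : Measure G) hS hSG hp₀
  obtain ⟨κ, hκ, hκ1, hκS⟩ := exists_cutoff_of_pos hN hN0
  exact ⟨κ, hκ, hκ1, hκS.trans hNS⟩

variable (F) in
include F in
/-- Smooth invariant functions on an invariant open set extend, locally, to invariant functions. -/
theorem exists_invariantFunction_eventuallyEq {S : Set P} (hS : IsOpen S)
    (hSG : ∀ (g : G) (p : P), p ∈ S → g • p ∈ S) {p₀ : P} (hp₀ : p₀ ∈ S) {u : P → ℝ}
    (hu : ∀ p ∈ S, ContMDiffAt 𝓘(ℝ, E) 𝓘(ℝ, ℝ) ∞ u p)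
    (huG : ∀ (g : G) (p : P), p ∈ S → u (g • p) = u p) :
    ∃ k ∈ invariantFunctions E P G, k =ᶠ[𝓝 p₀] u := by
  obtain ⟨κ, hκ, hκ1, hκS⟩ := exists_invariant_cutoff (E := E) F hS hSG hp₀
  refine ⟨fun p => κ p * u p, ⟨?_, fun g p => ?_⟩, ?_⟩
  · refine contMDiff_of_tsupport fun p hp => ?_
    exact ContMDiffAt.mul hκ.1.contMDiffAt
      (hu p (hκS (closure_mono (Function.support_mul_subset_left _ _) hp)))
  · by_cases hp : p ∈ S
    · simp only [hκ.2, huG g p hp]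
    · have h1 : κ p = 0 := image_eq_zero_of_notMem_tsupport fun h => hp (hκS h)
      simp only [hκ.2, h1, zero_mul]
  · filter_upwards [hκ1] with p hp
    have : κ p = 1 := hp
    simp [this]

variable [ConnectedSpace G] {Ω : SymplecticForm E P}
    {j : P → (GroupLieAlgebra 𝓘(ℝ, F) G →L[ℝ] ℝ)}
    {n : ℕ} {b : Module.Basis (Fin n) ℝ (GroupLieAlgebra 𝓘(ℝ, F) G)}
    {h : P → ℝ} {f : Fin n → (Fin n → ℝ) → ℝ}

/-- Near every point there is an invariant vector field that induces the same derivation of the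
invariant functions as `X_h`. -/
theorem exists_invariant_vectorField (hj : IsHamiltonianAction Ω j)
    (hh : SmoothFun (E := E) h)
    (hf : ∀ (a : Fin n) (p : P), ContDiffAt ℝ ∞ (f a) (fun c => j p (b c)))
    (hjh : ∀ (a : Fin n) (p : P), bracket Ω (fun q => j q (b a)) h p = f a (fun c => j p (b c)))
    (p₀ : P) :
    ∃ Y : ∀ p : P, TangentSpace 𝓘(ℝ, E) p,
      ContMDiff 𝓘(ℝ, E) 𝓘(ℝ, E).tangent ∞ (fun p => (⟨p, Y p⟩ : TangentBundle 𝓘(ℝ, E) P)) ∧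
      (∀ (g : G) (p : P), Y (g • p) = smulDiff g p (Y p)) ∧
      ∃ κ ∈ invariantFunctions E P G, κ =ᶠ[𝓝 p₀] 1 ∧
        ∀ k ∈ invariantFunctions E P G, ∀ p,
          diff (E := E) k p (Y p) = κ p * diff (E := E) k p (hamiltonianVF Ω h p) := by
  have : IsTopologicalGroup G := topologicalGroup_of_lieGroup 𝓘(ℝ, F) ∞
  have : LocallyCompactSpace G := Manifold.locallyCompact_of_finiteDimensional 𝓘(ℝ, F)
  borelize G
  let μ : Measure G := Measure.haar
  obtain ⟨θ, hθ, hθc, hN, hN0, -⟩ := exists_invariantFunction_pos (E := E) F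
    μ isOpen_univ (fun _ _ _ => Set.mem_univ _) (Set.mem_univ p₀)
  obtain ⟨κ, hκ, hκ1, hκS⟩ := exists_cutoff_of_pos hN hN0
  let N : P → ℝ := fun p => orbitAverage μ θ 1 p p
  -- Dividing by `N` is harmless: the closed support of `κ` lies where `N` is nonzero.
  let r : P → ℝ := fun p => κ p / N p
  have hrG : ∀ (g : G) (p : P), r (g • p) = r p := fun g p => by
    simp only [r, N, hκ.2 g p, orbitAverage_smul]
  have hr : SmoothFun (E := E) r := by
    refine contMDiff_of_tsupport fun p hp => ?_
    have h1 : Function.support r ⊆ Function.support κ := fun q hq h0 => hq (by simp [r, h0])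
    exact hκ.1.contMDiffAt.div₀ hN.1.contMDiffAt (hκS (closure_mono h1 hp))
  have hrN : ∀ p, r p * N p = κ p := fun p => by
    by_cases h0 : N p = 0
    · have h1 : κ p = 0 := image_eq_zero_of_notMem_tsupport fun h => hκS h h0
      rw [h0, h1, mul_zero]
    · exact div_mul_cancel₀ _ h0
  -- Moving both arguments by g leaves `K` unchanged, so its Hamiltonian field on the diagonal is
  -- invariant.
  let K : P → P → ℝ := fun p q => r p * orbitAverage μ θ h p q
  have hK : ContMDiff (𝓘(ℝ, E).prod 𝓘(ℝ, E)) 𝓘(ℝ, ℝ) ∞ (Function.uncurry K) :=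
    ContMDiff.mul (hr.comp contMDiff_fst) (contMDiff_orbitAverage F μ hθ hθc hh)
  have hKp : ∀ p, SmoothFun (E := E) (K p) := fun p =>
    hK.comp (contMDiff_const.prodMk contMDiff_id)
  have hav : ∀ p, SmoothFun (E := E) (orbitAverage μ θ h p) := fun p =>
    (contMDiff_orbitAverage F μ hθ hθc hh).comp (contMDiff_const.prodMk contMDiff_id)
  have hYV := smoothVectorField_hamiltonianVF_diag Ω hK
  refine ⟨fun p => hamiltonianVF Ω (K p) p, hYV, fun g p => ?_, κ, hκ, hκ1, fun k hk p => ?_⟩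
  · refine (hamiltonianVF_smul hj (hKp (g • p)) g p).trans ?_
    have h1 : (fun q => K (g • p) (g • q)) = K p := by
      funext q
      simp only [K, hrG, orbitAverage_smul]
    rw [h1]
  · rw [← smul_eq_mul, ← map_smul]
    refine diff_eq_of_sub_mem (F := F) hk (mem_orbitTangentSpace_of_forall Ω fun v hv => ?_)
    have h1 : diff (E := E) (K p) p v = r p * diff (E := E) (orbitAverage μ θ h p) p v :=
      congrArg (fun A : E →L[ℝ] ℝ => A v)
        (((hav p).mdifferentiable (by simp) p).hasMFDerivAt.const_smul (r p)).mfderiv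
    rw [map_sub, map_smul, sub_apply, smul_apply, hamiltonianVF_spec, hamiltonianVF_spec, h1,
      diff_orbitAverage μ hj hh hf hjh hθ hθc hv, smul_eq_mul, ← mul_assoc, hrN, sub_self]

end InvariantField

/-! ### Integral curves on a space with local flows -/

section LocalFlows

/-- A chain rule without joint differentiability of `W`: a limit for the `r`-derivative at the base
point, and differentiability in `t` at `r₁` alone, suffice. The mean value inequality in `r`
controls the rest. -/
theorem hasDerivWithinAt_comp_sub {W W' : ℝ → ℝ → ℝ} {I : Set ℝ} {r₁ t₁ B B' : ℝ}
    (h1 : ∀ᶠ z : ℝ × ℝ in 𝓝 r₁ ×ˢ 𝓝[I] t₁, HasDerivAt (fun r => W r z.2) (W' z.1 z.2) z.1)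
    (hc : Filter.Tendsto (fun z : ℝ × ℝ => W' z.1 z.2) (𝓝 r₁ ×ˢ 𝓝[I] t₁) (𝓝 B'))
    (h2 : HasDerivWithinAt (fun t => W r₁ t) B I t₁) :
    HasDerivWithinAt (fun t => W (r₁ - (t - t₁)) t) (B - B') I t₁ := by
  have h3 : HasDerivWithinAt (fun t => W (r₁ - (t - t₁)) t - W r₁ t) (-B') I t₁ := by
    rw [hasDerivWithinAt_iff_isLittleO, Asymptotics.isLittleO_iff]
    intro ε hε
    have h4 := h1.and (hc.eventually (Metric.ball_mem_nhds B' hε))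
    obtain ⟨s, hs, u, hu, hsu⟩ := Filter.mem_prod_iff.1 h4
    obtain ⟨δ, hδ, hδs⟩ := Metric.mem_nhds_iff.1 hs
    filter_upwards [hu, mem_nhdsWithin_of_mem_nhds (Metric.ball_mem_nhds t₁ hδ)] with t ht htδ
    have hb : ∀ r ∈ Metric.ball r₁ δ, HasDerivWithinAt (fun r => W r t - r * B') (W' r t - B')
        (Metric.ball r₁ δ) r := fun r hr => by
      have h5 := (hsu (Set.mk_mem_prod (hδs hr) ht)).1
      have h6 := h5.fun_sub ((hasDerivAt_id r).mul_const B')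
      rw [one_mul] at h6
      exact h6.hasDerivWithinAt
    have h7 := Convex.norm_image_sub_le_of_norm_hasDerivWithin_le (C := ε) hb
      (fun r hr => le_of_lt (by
        have h8 := (hsu (Set.mk_mem_prod (hδs hr) ht)).2
        simpa [dist_eq_norm] using h8)) (convex_ball r₁ δ) (Metric.mem_ball_self hδ)
      (y := r₁ - (t - t₁)) (by
        rw [Metric.mem_ball, Real.dist_eq] at htδ ⊢
        rwa [sub_sub_cancel_left, abs_neg])
    have e1 : W (r₁ - (t - t₁)) t - W r₁ t - (W (r₁ - (t₁ - t₁)) t₁ - W r₁ t₁) -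
        (t - t₁) • -B' = W (r₁ - (t - t₁)) t - (r₁ - (t - t₁)) * B' - (W r₁ t - r₁ * B') := by
      simp only [sub_self, sub_zero, smul_eq_mul]
      ring
    have e2 : ‖r₁ - (t - t₁) - r₁‖ = ‖t - t₁‖ := by rw [sub_sub_cancel_left, norm_neg]
    rw [e1, ← e2]
    exact h7
  have h4 := h2.fun_add h3
  rw [← sub_eq_add_neg] at h4
  refine h4.congr_of_eventuallyEq (Filter.Eventually.of_forall fun t => ?_) ?_ <;> simp

variable {M : Type*} [TopologicalSpace M] {A : Subalgebra ℝ (M → ℝ)}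

/-- `Φ` is a local flow of `D`, defined on the open set `S` for times in `(-ε, ε)`. -/
structure IsLocalFlow (D : Derivation ℝ A A) (S : Set M) (ε : ℝ) (Φ : ℝ → M → M) : Prop where
  isOpen : IsOpen S
  pos : 0 < ε
  zero (x : M) : x ∈ S → Φ 0 x = x
  hasDerivAt (x : M) : x ∈ S → ∀ t ∈ Set.Ioo (-ε) ε, ∀ f : A,
    HasDerivAt (fun s => f.1 (Φ s x)) ((D f).1 (Φ t x)) t
  continuousAt (x : M) : x ∈ S → ∀ t ∈ Set.Ioo (-ε) ε, ContinuousAt (Function.uncurry Φ) (t, x)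
  smooth (x : M) : x ∈ S → ∀ t ∈ Set.Ioo (-ε) ε, ∀ f ∈ A, ∃ k ∈ A, f ∘ Φ t =ᶠ[𝓝 x] k
  add (x : M) : x ∈ S → ∀ s ∈ Set.Ioo (-ε) ε, ∀ t ∈ Set.Ioo (-ε) ε, s + t ∈ Set.Ioo (-ε) ε →
    Φ t x ∈ S → Φ s (Φ t x) = Φ (s + t) x

variable {D : Derivation ℝ A A} {S : Set M} {ε : ℝ} {Φ : ℝ → M → M}

/-- Continuity is not part of the definition. It follows because `f ∘ c` is continuous for every `f`
in `A`, and sets where such functions are nonzero form arbitrarily small neighbourhoods. -/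
theorem IsIntegralCurve.continuousOn
    (hA : ∀ x : M, ∀ O ∈ 𝓝 x, ∃ f ∈ A, f x ≠ 0 ∧ Function.support f ⊆ O)
    {c : ℝ → M} {I : Set ℝ} (hc : IsIntegralCurve D c I) : ContinuousOn c I := by
  intro t ht O hO
  obtain ⟨f, hf, hft, hfO⟩ := hA (c t) O hO
  have h1 : ContinuousWithinAt (fun s => f (c s)) I t :=
    (hc.hasDeriv ⟨f, hf⟩ t ht).continuousWithinAt
  exact Filter.mem_map.2 ((h1.eventually_ne hft).mono fun s hs => hfO hs)

theorem eq_of_forall_apply_eq [T1Space M]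
    (hA : ∀ x : M, ∀ O ∈ 𝓝 x, ∃ f ∈ A, f x ≠ 0 ∧ Function.support f ⊆ O) {x y : M}
    (hxy : ∀ f ∈ A, f x = f y) : x = y := by
  by_contra hne
  obtain ⟨f, hf, hfx, hfO⟩ := hA x {y}ᶜ (isOpen_compl_singleton.mem_nhds hne)
  exact hfO (show f y ≠ 0 by rwa [← hxy f hf]) rfl

/-- `D` commutes with pull-back by its flow: by the group law both sides are the derivative at r = 0
of f(Φ_{t+r} x). -/
theorem IsLocalFlow.derivation_eq (hΦ : IsLocalFlow D S ε Φ) {x : M} (hx : x ∈ S) {t : ℝ}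
    (ht : t ∈ Set.Ioo (-ε) ε) {f k : A} (hfk : f.1 ∘ Φ t =ᶠ[𝓝 x] k.1) :
    (D k).1 x = (D f).1 (Φ t x) := by
  have h0 : (0 : ℝ) ∈ Set.Ioo (-ε) ε := ⟨by linarith [hΦ.pos], hΦ.pos⟩
  have h1 := hΦ.hasDerivAt x hx 0 h0 k
  rw [hΦ.zero x hx] at h1
  have h2 : Filter.Tendsto (fun r => Φ r x) (𝓝 0) (𝓝 x) := by
    have h3 : ContinuousAt (fun r : ℝ => Function.uncurry Φ (r, x)) 0 :=
      ContinuousAt.comp (f := fun r : ℝ => (r, x)) (hΦ.continuousAt x hx 0 h0) (by fun_prop)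
    have h4 := h3.tendsto
    simp only [Function.uncurry, hΦ.zero x hx] at h4
    exact h4
  have h5 : HasDerivAt (fun r => f.1 (Φ (t + r) x)) ((D f).1 (Φ t x)) 0 := by
    have h6 := hΦ.hasDerivAt x hx (t + 0) (by simpa using ht) f
    have h7 := h6.comp_const_add t 0
    simpa using h7
  refine h1.unique (h5.congr_of_eventuallyEq ?_)
  have h8 : ∀ᶠ r : ℝ in 𝓝 0, t + r ∈ Set.Ioo (-ε) ε := by
    have : ContinuousAt (fun r : ℝ => t + r) 0 := by fun_prop
    refine this.eventually_mem ?_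
    rw [add_zero]
    exact Ioo_mem_nhds ht.1 ht.2
  filter_upwards [h2.eventually hfk, h2.eventually (hΦ.isOpen.mem_nhds hx), h8,
    Ioo_mem_nhds h0.1 h0.2] with r hr hrS hr2 hr3
  rw [← hr, Function.comp_apply, hΦ.add x hx t ht r hr3 hr2 hrS]

/-- Integral curves agree locally with the flow lines. -/
theorem IsLocalFlow.eventually_eq [T1Space M]
    (hA : ∀ x : M, ∀ O ∈ 𝓝 x, ∃ f ∈ A, f x ≠ 0 ∧ Function.support f ⊆ O)
    (hAc : ∀ f ∈ A, Continuous f) (hΦ : IsLocalFlow D S ε Φ) {c : ℝ → M} {I : Set ℝ}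
    (hc : IsIntegralCurve D c I) {t₀ : ℝ} (ht₀ : t₀ ∈ I) (hS : c t₀ ∈ S) :
    ∀ᶠ t in 𝓝[I] t₀, c t = Φ (t - t₀) (c t₀) := by
  have hcont := hc.continuousOn hA
  have h1 : ∀ᶠ t in 𝓝[I] t₀, c t ∈ S := hcont t₀ ht₀ (hΦ.isOpen.mem_nhds hS)
  obtain ⟨δ, hδ, hδS⟩ := Metric.mem_nhdsWithin_iff.1 (Filter.inter_mem h1
    (mem_nhdsWithin_of_mem_nhds (Metric.ball_mem_nhds t₀ hΦ.pos)))
  let J : Set ℝ := Metric.ball t₀ δ ∩ I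
  have hJS : ∀ t ∈ J, c t ∈ S := fun t ht => (hδS ht).1
  have hJε : ∀ t ∈ J, t - t₀ ∈ Set.Ioo (-ε) ε := fun t ht => by
    have := (hδS ht).2
    rw [Metric.mem_ball, Real.dist_eq] at this
    exact abs_lt.1 this
  have hJε' : ∀ t ∈ J, t₀ - t ∈ Set.Ioo (-ε) ε := fun t ht => by
    have := hJε t ht
    constructor <;> linarith [this.1, this.2]
  have hJconv : Convex ℝ J := (convex_ball t₀ δ).inter hc.interval.convex
  have ht₀J : t₀ ∈ J := ⟨Metric.mem_ball_self hδ, ht₀⟩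
  -- Carrying c(t) back to time `t₀` by the flow: the motion of `c` and the backward motion of the
  -- flow contribute opposite derivatives.
  have hderiv : ∀ f : A, ∀ t₁ ∈ J,
      HasDerivWithinAt (fun t => f.1 (Φ (t₀ - t) (c t))) 0 J t₁ := by
    intro f t₁ ht₁
    obtain ⟨k, hk, hfk⟩ := hΦ.smooth (c t₁) (hJS t₁ ht₁) _ (hJε' t₁ ht₁) f.1 f.2
    have hct : Filter.Tendsto c (𝓝[J] t₁) (𝓝 (c t₁)) :=
      (hcont t₁ ht₁.2).mono Set.inter_subset_right
    have h2 : HasDerivWithinAt (fun t => f.1 (Φ (t₀ - t₁) (c t))) ((D f).1 (Φ (t₀ - t₁) (c t₁)))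
        J t₁ := by
      rw [← hΦ.derivation_eq (k := ⟨k, hk⟩) (hJS t₁ ht₁) (hJε' t₁ ht₁) hfk]
      exact ((hc.hasDeriv ⟨k, hk⟩ t₁ ht₁.2).mono Set.inter_subset_right).congr_of_eventuallyEq
        (hct.eventually hfk) hfk.self_of_nhds
    have h3 : Filter.Tendsto (fun z : ℝ × ℝ => (D f).1 (Φ z.1 (c z.2)))
        (𝓝 (t₀ - t₁) ×ˢ 𝓝[J] t₁) (𝓝 ((D f).1 (Φ (t₀ - t₁) (c t₁)))) := by
      have h4 : Filter.Tendsto (fun z : ℝ × ℝ => (z.1, c z.2)) (𝓝 (t₀ - t₁) ×ˢ 𝓝[J] t₁)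
          (𝓝 (t₀ - t₁, c t₁)) := by
        rw [nhds_prod_eq]
        exact Filter.Tendsto.prodMap Filter.tendsto_id hct
      exact ((hAc _ (D f).2).tendsto _).comp
        (Filter.Tendsto.comp (hΦ.continuousAt (c t₁) (hJS t₁ ht₁) _ (hJε' t₁ ht₁)) h4)
    have h5 : ∀ᶠ z : ℝ × ℝ in 𝓝 (t₀ - t₁) ×ˢ 𝓝[J] t₁,
        HasDerivAt (fun r => f.1 (Φ r (c z.2))) ((D f).1 (Φ z.1 (c z.2))) z.1 := by
      filter_upwards [Filter.prod_mem_prod (Ioo_mem_nhds (hJε' t₁ ht₁).1 (hJε' t₁ ht₁).2)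
        (self_mem_nhdsWithin (a := t₁) (s := J))] with z hz
      exact hΦ.hasDerivAt _ (hJS _ hz.2) _ hz.1 f
    have h6 := hasDerivWithinAt_comp_sub (W := fun r t => f.1 (Φ r (c t)))
      (W' := fun r t => (D f).1 (Φ r (c t))) h5 h3 h2
    simpa using h6
  have hconst : ∀ t ∈ J, Φ (t₀ - t) (c t) = c t₀ := fun t ht => by
    refine eq_of_forall_apply_eq hA fun f hf => ?_
    have h2 := Convex.norm_image_sub_le_of_norm_hasDerivWithin_le (C := 0)
      (hderiv ⟨f, hf⟩) (fun _ _ => by simp) hJconv ht₀J ht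
    rw [zero_mul, norm_le_zero_iff, sub_eq_zero] at h2
    simpa [hΦ.zero _ hS] using h2
  filter_upwards [inter_mem_nhdsWithin I (Metric.ball_mem_nhds t₀ hδ)] with t ht
  have htJ : t ∈ J := ⟨ht.2, ht.1⟩
  -- Flowing forward again by t - t₀ recovers c(t).
  have h2 := hΦ.add (c t) (hJS t htJ) _ (hJε t htJ) _ (hJε' t htJ)
    (by rw [sub_add_sub_cancel, sub_self]; exact ⟨by linarith [hΦ.pos], hΦ.pos⟩)
    (by rw [hconst t htJ]; exact hS)
  rw [hconst t htJ, sub_add_sub_cancel, sub_self, hΦ.zero _ (hJS t htJ)] at h2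
  exact h2.symm

/-- The set of agreement is closed since `M` is Hausdorff, open since both curves follow a local
flow, and contains 0; the common domain is connected. -/
theorem IsIntegralCurve.eqOn [T2Space M]
    (hA : ∀ x : M, ∀ O ∈ 𝓝 x, ∃ f ∈ A, f x ≠ 0 ∧ Function.support f ⊆ O)
    (hAc : ∀ f ∈ A, Continuous f) (hD : ∀ x, ∃ S ε Φ, x ∈ S ∧ IsLocalFlow D S ε Φ)
    {c d : ℝ → M} {I J : Set ℝ} (hc : IsIntegralCurve D c I) (hd : IsIntegralCurve D d J)
    (hcd : c 0 = d 0) : Set.EqOn c d (I ∩ J) := by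
  have hconn : PreconnectedSpace ↥(I ∩ J) :=
    isPreconnected_iff_preconnectedSpace.1 (hc.interval.inter hd.interval).isPreconnected
  have hcc : Continuous fun t : ↥(I ∩ J) => c t :=
    ((hc.continuousOn hA).mono Set.inter_subset_left).domRestrict
  have hdc : Continuous fun t : ↥(I ∩ J) => d t :=
    ((hd.continuousOn hA).mono Set.inter_subset_right).domRestrict
  have hclopen : IsClopen {t : ↥(I ∩ J) | c t = d t} := by
    refine ⟨isClosed_eq hcc hdc, isOpen_iff_mem_nhds.2 fun t (ht : c t = d t) => ?_⟩
    obtain ⟨S, ε, Φ, hS, hΦ⟩ := hD (c t)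
    have h1 := (hΦ.eventually_eq hA hAc hc t.2.1 hS).filter_mono
      (nhdsWithin_mono _ (Set.inter_subset_left (t := J)))
    have h2 := (hΦ.eventually_eq hA hAc hd t.2.2 (ht ▸ hS)).filter_mono
      (nhdsWithin_mono _ (Set.inter_subset_right (s := I)))
    have h3 : ∀ᶠ s in 𝓝[I ∩ J] (t : ℝ), c s = d s := by
      filter_upwards [h1, h2] with s hs hs'
      rw [hs, hs', ht]
    rw [← map_nhds_subtype_val] at h3
    exact h3
  intro t ht
  have h0 : (⟨0, hc.zero_mem, hd.zero_mem⟩ : ↥(I ∩ J)) ∈ {t : ↥(I ∩ J) | c t = d t} := hcd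
  have h1 := hclopen.eq_univ ⟨_, h0⟩
  have h2 : (⟨t, ht⟩ : ↥(I ∩ J)) ∈ {t : ↥(I ∩ J) | c t = d t} := h1 ▸ Set.mem_univ _
  exact h2

/-- If no interval of the family passes `t`, the right part of the union at `t` is the point `t`;
otherwise some interval containing `t` reaches beyond it. -/
theorem exists_mem_nhdsWithin_Ici {𝒥 : Set (Set ℝ)} (h𝒥 : ∀ J ∈ 𝒥, J.OrdConnected ∧ (0 : ℝ) ∈ J)
    {t : ℝ} (ht : t ∈ ⋃₀ 𝒥) : ∃ J ∈ 𝒥, t ∈ J ∧ J ∈ 𝓝[⋃₀ 𝒥 ∩ Set.Ici t] t := by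
  obtain ⟨J₁, hJ₁, ht₁⟩ := ht
  by_cases hex : ∃ J₂ ∈ 𝒥, ∃ u ∈ J₂, t < u
  · obtain ⟨J₂, hJ₂, u, hu, htu⟩ := hex
    have key : ∀ J ∈ 𝒥, ∀ v, t < v → t ∈ J → v ∈ J → ∃ J ∈ 𝒥, t ∈ J ∧
        J ∈ 𝓝[⋃₀ 𝒥 ∩ Set.Ici t] t := fun J hJ v hv h1 h2 => by
      refine ⟨J, hJ, h1, ?_⟩
      filter_upwards [mem_nhdsWithin_of_mem_nhds (Iio_mem_nhds hv), self_mem_nhdsWithin] with s hs hs'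
      exact (h𝒥 J hJ).1.out h1 h2 ⟨hs'.2, le_of_lt hs⟩
    rcases le_or_gt 0 t with h0 | h0
    · exact key J₂ hJ₂ u htu ((h𝒥 J₂ hJ₂).1.out (h𝒥 J₂ hJ₂).2 hu ⟨h0, htu.le⟩) hu
    · exact key J₁ hJ₁ 0 h0 ht₁ (h𝒥 J₁ hJ₁).2
  · push Not at hex
    refine ⟨J₁, hJ₁, ht₁, ?_⟩
    filter_upwards [self_mem_nhdsWithin] with s hs
    obtain ⟨⟨J₂, hJ₂, hs₂⟩, hs'⟩ := hs
    rwa [le_antisymm (hex J₂ hJ₂ s hs₂) hs']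

theorem exists_mem_nhdsWithin_Iic {𝒥 : Set (Set ℝ)} (h𝒥 : ∀ J ∈ 𝒥, J.OrdConnected ∧ (0 : ℝ) ∈ J)
    {t : ℝ} (ht : t ∈ ⋃₀ 𝒥) : ∃ J ∈ 𝒥, t ∈ J ∧ J ∈ 𝓝[⋃₀ 𝒥 ∩ Set.Iic t] t := by
  obtain ⟨J₁, hJ₁, ht₁⟩ := ht
  by_cases hex : ∃ J₂ ∈ 𝒥, ∃ u ∈ J₂, u < t
  · obtain ⟨J₂, hJ₂, u, hu, htu⟩ := hex
    have key : ∀ J ∈ 𝒥, ∀ v, v < t → t ∈ J → v ∈ J → ∃ J ∈ 𝒥, t ∈ J ∧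
        J ∈ 𝓝[⋃₀ 𝒥 ∩ Set.Iic t] t := fun J hJ v hv h1 h2 => by
      refine ⟨J, hJ, h1, ?_⟩
      filter_upwards [mem_nhdsWithin_of_mem_nhds (Ioi_mem_nhds hv), self_mem_nhdsWithin] with s hs hs'
      exact (h𝒥 J hJ).1.out h2 h1 ⟨le_of_lt hs, hs'.2⟩
    rcases le_or_gt t 0 with h0 | h0
    · exact key J₂ hJ₂ u htu ((h𝒥 J₂ hJ₂).1.out hu (h𝒥 J₂ hJ₂).2 ⟨htu.le, h0⟩) hu
    · exact key J₁ hJ₁ 0 h0 ht₁ (h𝒥 J₁ hJ₁).2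
  · push Not at hex
    refine ⟨J₁, hJ₁, ht₁, ?_⟩
    filter_upwards [self_mem_nhdsWithin] with s hs
    obtain ⟨⟨J₂, hJ₂, hs₂⟩, hs'⟩ := hs
    rwa [le_antisymm hs' (hex J₂ hJ₂ s hs₂)]

theorem exists_isMaximalIntegralCurve [T2Space M]
    (hA : ∀ x : M, ∀ O ∈ 𝓝 x, ∃ f ∈ A, f x ≠ 0 ∧ Function.support f ⊆ O)
    (hAc : ∀ f ∈ A, Continuous f) (hD : ∀ x, ∃ S ε Φ, x ∈ S ∧ IsLocalFlow D S ε Φ) (x : M) :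
    ∃ (c : ℝ → M) (I : Set ℝ), IsMaximalIntegralCurve D x c I := by
  let 𝒥 : Set (Set ℝ) := {J | ∃ d : ℝ → M, IsIntegralCurve D d J ∧ d 0 = x}
  have h𝒥 : ∀ J ∈ 𝒥, J.OrdConnected ∧ (0 : ℝ) ∈ J := fun J ⟨d, hd, _⟩ => ⟨hd.interval, hd.zero_mem⟩
  -- Derivatives within a singleton carry no condition, so the constant curve on {0} makes the
  -- family nonempty.
  have h0 : {0} ∈ 𝒥 := ⟨fun _ => x, ⟨Set.ordConnected_singleton, rfl, fun f t ht => by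
    rw [Set.mem_singleton_iff.1 ht]
    exact hasDerivWithinAt_iff_hasFDerivWithinAt.2 HasFDerivWithinAt.singleton⟩, rfl⟩
  have hex : ∀ t : ℝ, ∃ y : M, ∀ (d : ℝ → M) (J : Set ℝ), IsIntegralCurve D d J → d 0 = x →
      t ∈ J → d t = y := fun t => by
    by_cases ht : ∃ d J, IsIntegralCurve D d J ∧ d 0 = x ∧ t ∈ J
    · obtain ⟨d, J, hd, hdx, htJ⟩ := ht
      exact ⟨d t, fun d' J' hd' hdx' htJ' =>
        hd'.eqOn hA hAc hD hd (hdx'.trans hdx.symm) ⟨htJ', htJ⟩⟩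
    · exact ⟨x, fun d J hd hdx htJ => absurd ⟨d, J, hd, hdx, htJ⟩ ht⟩
  choose c hc using hex
  have hderiv : ∀ (f : A) (t : ℝ) (K : Set ℝ), t ∈ K → (∃ J ∈ 𝒥, t ∈ J ∧ J ∈ 𝓝[K] t) →
      HasDerivWithinAt (fun s => f.1 (c s)) ((D f).1 (c t)) K t := by
    rintro f t K htK ⟨J, ⟨d, hd, hdx⟩, htJ, hJK⟩
    have h1 : HasDerivWithinAt (fun s => f.1 (c s)) ((D f).1 (c t)) J t := by
      rw [← hc t d J hd hdx htJ]
      exact (hd.hasDeriv f t htJ).congr (fun s hs => congrArg f.1 (hc s d J hd hdx hs).symm)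
        (congrArg f.1 (hc t d J hd hdx htJ).symm)
    exact h1.mono_of_mem_nhdsWithin hJK
  refine ⟨c, ⋃₀ 𝒥, ⟨⟨fun t ht u hu v hv => ?_⟩, ⟨{0}, h0, rfl⟩, fun f t ht => ?_⟩, ?_,
    fun d J hd hdx => ⟨fun t ht => ⟨J, ⟨d, hd, hdx⟩, ht⟩, fun t ht => hc t d J hd hdx ht⟩⟩
  · obtain ⟨J₁, hJ₁, ht₁⟩ := ht
    obtain ⟨J₂, hJ₂, hu₂⟩ := hu
    rcases le_total 0 v with hv0 | hv0
    · exact ⟨J₂, hJ₂, (h𝒥 J₂ hJ₂).1.out (h𝒥 J₂ hJ₂).2 hu₂ ⟨hv0, hv.2⟩⟩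
    · exact ⟨J₁, hJ₁, (h𝒥 J₁ hJ₁).1.out ht₁ (h𝒥 J₁ hJ₁).2 ⟨hv.1, hv0⟩⟩
  -- The two sides are treated apart: at t = 0, the left and right parts of the union may come from
  -- different curves.
  · have h1 := (hderiv f t (⋃₀ 𝒥 ∩ Set.Iic t) ⟨ht, Set.mem_Iic.2 le_rfl⟩ (exists_mem_nhdsWithin_Iic h𝒥 ht)).union
      (hderiv f t (⋃₀ 𝒥 ∩ Set.Ici t) ⟨ht, Set.mem_Ici.2 le_rfl⟩ (exists_mem_nhdsWithin_Ici h𝒥 ht))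
    rwa [← Set.inter_union_distrib_left, Set.Iic_union_Ici, Set.inter_univ] at h1
  · obtain ⟨d, hd, hdx⟩ := h0
    rw [← hc 0 d {0} hd hdx rfl, hdx]

theorem IsLocalFlow.isIntegralCurve (hΦ : IsLocalFlow D S ε Φ) {x : M} (hx : x ∈ S) :
    IsIntegralCurve D (fun t => Φ t x) (Set.Ioo (-ε) ε) :=
  ⟨Set.ordConnected_Ioo, ⟨by linarith [hΦ.pos], hΦ.pos⟩,
    fun f t ht => (hΦ.hasDerivAt x hx t ht f).hasDerivWithinAt⟩

/-- The time-`t` map of a local flow, on an open set that stays in the domain of the flow. -/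
def IsLocalFlow.toOpenPartialHomeomorph (hΦ : IsLocalFlow D S ε Φ) {U : Set M} (hU : IsOpen U)
    (hUS : U ⊆ S) {t : ℝ} (ht : |t| < ε) (hΦU : ∀ y ∈ U, Φ t y ∈ S) :
    OpenPartialHomeomorph M M where
  toFun := Φ t
  invFun := Φ (-t)
  source := U
  -- The image of `U` is described through the inverse map, which makes its openness a matter of
  -- continuity.
  target := S ∩ Φ (-t) ⁻¹' U
  map_source' y hy := ⟨hΦU y hy, by
    have h1 := hΦ.add y (hUS hy) (-t) (abs_lt.1 (by rwa [abs_neg])) t (abs_lt.1 ht)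
      (by rw [neg_add_cancel]; exact ⟨by linarith [hΦ.pos], hΦ.pos⟩) (hΦU y hy)
    rw [neg_add_cancel, hΦ.zero y (hUS hy)] at h1
    rwa [Set.mem_preimage, h1]⟩
  map_target' y hy := hy.2
  left_inv' y hy := by
    have h1 := hΦ.add y (hUS hy) (-t) (abs_lt.1 (by rwa [abs_neg])) t (abs_lt.1 ht)
      (by rw [neg_add_cancel]; exact ⟨by linarith [hΦ.pos], hΦ.pos⟩) (hΦU y hy)
    rwa [neg_add_cancel, hΦ.zero y (hUS hy)] at h1
  right_inv' y hy := by
    have h1 := hΦ.add y hy.1 t (abs_lt.1 ht) (-t) (abs_lt.1 (by rwa [abs_neg]))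
      (by rw [add_neg_cancel]; exact ⟨by linarith [hΦ.pos], hΦ.pos⟩) (hUS hy.2)
    rwa [add_neg_cancel, hΦ.zero y hy.1] at h1
  continuousOn_toFun y hy := (ContinuousAt.comp (f := fun y : M => (t, y))
    (hΦ.continuousAt y (hUS hy) t (abs_lt.1 ht)) (by fun_prop)).continuousWithinAt
  continuousOn_invFun y hy := (ContinuousAt.comp (f := fun y : M => (-t, y))
    (hΦ.continuousAt y hy.1 (-t) (abs_lt.1 (by rwa [abs_neg]))) (by fun_prop)).continuousWithinAt
  open_source := hU
  open_target := by
    refine ContinuousOn.isOpen_inter_preimage (fun y hy => ?_) hΦ.isOpen hU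
    exact (ContinuousAt.comp (f := fun y : M => (-t, y)) (hΦ.continuousAt y hy (-t)
      (abs_lt.1 (by rwa [abs_neg]))) (by fun_prop)).continuousWithinAt

theorem isVectorField_of_localFlow [T2Space M]
    (hA : ∀ x : M, ∀ O ∈ 𝓝 x, ∃ f ∈ A, f x ≠ 0 ∧ Function.support f ⊆ O)
    (hAc : ∀ f ∈ A, Continuous f) (hD : ∀ x, ∃ S ε Φ, x ∈ S ∧ IsLocalFlow D S ε Φ) :
    IsVectorField D := by
  refine ⟨exists_isMaximalIntegralCurve hA hAc hD, fun x => ?_⟩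
  obtain ⟨S, ε, Φ, hx, hΦ⟩ := hD x
  have h0 : (0 : ℝ) ∈ Set.Ioo (-ε) ε := ⟨by linarith [hΦ.pos], hΦ.pos⟩
  have h1 : ∀ᶠ z : ℝ × M in 𝓝 0 ×ˢ 𝓝 x, Φ z.1 z.2 ∈ S := by
    rw [← nhds_prod_eq]
    refine (hΦ.continuousAt x hx 0 h0).eventually_mem (hΦ.isOpen.mem_nhds ?_)
    rwa [Function.uncurry_apply_pair, hΦ.zero x hx]
  obtain ⟨s, hs, V, hV, hsV⟩ := Filter.mem_prod_iff.1 h1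
  obtain ⟨δ, hδ, hδs⟩ := Metric.mem_nhds_iff.1 hs
  obtain ⟨U, hUV, hU, hxU⟩ := mem_nhds_iff.1 (Filter.inter_mem hV (hΦ.isOpen.mem_nhds hx))
  refine ⟨U, hU, hxU, min δ ε, lt_min hδ hΦ.pos, fun t ht => ?_⟩
  have htε : |t| < ε := ht.trans_le (min_le_right _ _)
  have hUS : U ⊆ S := fun y hy => (hUV hy).2
  have hΦU : ∀ y ∈ U, Φ t y ∈ S := fun y hy => by
    have h2 : t ∈ s := hδs (by simpa using ht.trans_le (min_le_left _ _))
    exact hsV (Set.mk_mem_prod h2 (hUV hy).1)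
  refine ⟨hΦ.toOpenPartialHomeomorph hU hUS htε hΦU, rfl, fun y hy => ?_, fun f hf y hy => ?_,
    fun f hf y hy => ?_⟩
  · obtain ⟨c, I, hc⟩ := exists_isMaximalIntegralCurve hA hAc hD y
    obtain ⟨h2, h3⟩ := hc.maximal _ _ (hΦ.isIntegralCurve (hUS hy)) (hΦ.zero y (hUS hy))
    exact ⟨c, I, hc, h2 (abs_lt.1 htε), (h3 (abs_lt.1 htε)).symm⟩
  · exact hΦ.smooth y (hUS hy) t (abs_lt.1 htε) f hf
  · exact hΦ.smooth y hy.1 (-t) (abs_lt.1 (by rwa [abs_neg])) f hf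

end LocalFlows

/-! ### Flows of invariant vector fields -/

section InvariantFlow

variable {E : Type*} [NormedAddCommGroup E] [NormedSpace ℝ E] [FiniteDimensional ℝ E]
  {P : Type*} [TopologicalSpace P] [T2Space P] [ChartedSpace E P] [IsManifold 𝓘(ℝ, E) ∞ P]
  {F : Type*} [NormedAddCommGroup F] [NormedSpace ℝ F]
  {G : Type*} [TopologicalSpace G] [ChartedSpace F G] [Group G]
  [LieGroup 𝓘(ℝ, F) ∞ G] [MulAction G P] [ContMDiffSMul 𝓘(ℝ, F) 𝓘(ℝ, E) ∞ G P]
  {Y : ∀ p : P, TangentSpace 𝓘(ℝ, E) p}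

theorem eqOn_of_isMIntegralCurveOn
    (hY : ContMDiff 𝓘(ℝ, E) 𝓘(ℝ, E).tangent ∞ (fun p => (⟨p, Y p⟩ : TangentBundle 𝓘(ℝ, E) P)))
    {c d : ℝ → P} {a b t₀ : ℝ} (ht₀ : t₀ ∈ Set.Ioo a b) (hc : IsMIntegralCurveOn c Y (Set.Ioo a b))
    (hd : IsMIntegralCurveOn d Y (Set.Ioo a b)) (hcd : c t₀ = d t₀) : Set.EqOn c d (Set.Ioo a b) := by
  have : IsManifold 𝓘(ℝ, E) 1 P := IsManifold.of_le (n := ∞) (by simp)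
  have : CompleteSpace E := FiniteDimensional.complete ℝ E
  exact isMIntegralCurveOn_Ioo_eqOn_of_contMDiff_boundaryless ht₀ (hY.of_le (by simp)) hc hd hcd

variable (F) in
include F in
theorem isMIntegralCurveOn_smul (hYG : ∀ (g : G) (p : P), Y (g • p) = smulDiff g p (Y p))
    {c : ℝ → P} {s : Set ℝ} (hc : IsMIntegralCurveOn c Y s) (g : G) :
    IsMIntegralCurveOn (fun t => g • c t) Y s := fun t ht => by
  have h1 := (hasMFDerivAt_smul_left F g (c t)).comp_hasMFDerivWithinAt t (hc t ht)
  refine h1.congr_mfderiv (ContinuousLinearMap.ext fun (r : ℝ) => ?_)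
  have h2 : smulDiff g (c t) (r • Y (c t)) = r • Y (g • c t) := by rw [map_smul, hYG]
  exact h2

variable (F) in
include F in
/-- A flow box of an invariant vector field, saturated by the action. -/
theorem exists_equivariant_flow
    (hY : ContMDiff 𝓘(ℝ, E) 𝓘(ℝ, E).tangent ∞ (fun p => (⟨p, Y p⟩ : TangentBundle 𝓘(ℝ, E) P)))
    (hYG : ∀ (g : G) (p : P), Y (g • p) = smulDiff g p (Y p)) {O : Set P} (hO : IsOpen O)
    (hOG : ∀ (g : G) (p : P), p ∈ O → g • p ∈ O) {p₀ : P} (hp₀ : p₀ ∈ O) :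
    ∃ ε > (0 : ℝ), ∃ S : Set P, IsOpen S ∧ p₀ ∈ S ∧ (∀ (g : G) (p : P), p ∈ S → g • p ∈ S) ∧
      ∃ ψ : ℝ → P → P, (∀ p ∈ S, ψ 0 p = p) ∧
        (∀ t ∈ Set.Ioo (-ε) ε, ∀ p ∈ S, ContMDiffAt 𝓘(ℝ, E) 𝓘(ℝ, E) ∞ (ψ t) p) ∧
        (∀ t ∈ Set.Ioo (-ε) ε, ∀ p ∈ S, ContinuousAt (Function.uncurry ψ) (t, p)) ∧
        (∀ p ∈ S, IsMIntegralCurveOn (fun t => ψ t p) Y (Set.Ioo (-ε) ε)) ∧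
        (∀ p ∈ S, ∀ t ∈ Set.Ioo (-ε) ε, ψ t p ∈ O) ∧
        ∀ (g : G), ∀ p ∈ S, ∀ t ∈ Set.Ioo (-ε) ε, ψ t (g • p) = g • ψ t p := by
  obtain ⟨ε, hε, U, hU, hpU, φ, hφ0, hφs, hφc, hφY, hφO⟩ := exists_flow_box hY hO hp₀
  have h0 : (0 : ℝ) ∈ Set.Ioo (-ε) ε := ⟨by linarith, hε⟩
  have hgc : ∀ g : G, Continuous fun p : P => g • p := fun g => (contMDiff_smul_left E F g).continuous
  let S : Set P := {p | ∃ g : G, g • p ∈ U}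
  have hS : IsOpen S := by
    have : S = ⋃ g : G, (fun p => g • p) ⁻¹' U := by ext p; simp [S]
    rw [this]
    exact isOpen_iUnion fun g => hU.preimage (hgc g)
  have hSG : ∀ (g : G) (p : P), p ∈ S → g • p ∈ S := fun g p ⟨k, hk⟩ =>
    ⟨k * g⁻¹, by simpa [mul_smul] using hk⟩
  -- An arbitrary choice of an element moving `p` into `U`; it need not be continuous, since `key`
  -- shows that the resulting flow does not depend on it.
  let γ : P → G := fun p => Classical.epsilon fun g : G => g • p ∈ U
  have hγ : ∀ p ∈ S, γ p • p ∈ U := fun p hp => Classical.epsilon_spec hp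
  let ψ : ℝ → P → P := fun t p => (γ p)⁻¹ • φ t (γ p • p)
  have hcurve : ∀ (g : G) (p : P), g • p ∈ U →
      IsMIntegralCurveOn (fun t => g⁻¹ • φ t (g • p)) Y (Set.Ioo (-ε) ε) := fun g p hp =>
    isMIntegralCurveOn_smul F hYG (hφY _ hp) g⁻¹
  -- Both sides are integral curves of `Y` starting at `p`. Near a point a fixed `g` can then be
  -- used, which gives smoothness, continuity and equivariance.
  have key : ∀ (g : G) (p : P), g • p ∈ U → ∀ t ∈ Set.Ioo (-ε) ε, ψ t p = g⁻¹ • φ t (g • p) :=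
    fun g p hp => eqOn_of_isMIntegralCurveOn hY h0 (hcurve _ p (hγ p ⟨g, hp⟩)) (hcurve g p hp)
      (by
        have h1 := hφ0 _ (hγ p ⟨g, hp⟩)
        simp only [ψ, hφ0 _ hp, h1, inv_smul_smul])
  have hev : ∀ (g : G) (p : P), g • p ∈ U → ∀ᶠ q in 𝓝 p, g • q ∈ U := fun g p hp =>
    (hgc g).continuousAt.eventually_mem (hU.mem_nhds hp)
  refine ⟨ε, hε, S, hS, ⟨1, by simpa using hpU⟩, hSG, ψ, fun p hp => ?_, ?_, ?_,
    fun p hp => hcurve _ p (hγ p hp), fun p hp t ht => hOG _ _ (hφO _ (hγ p hp) t ht), ?_⟩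
  · simp only [ψ, hφ0 _ (hγ p hp), inv_smul_smul]
  · rintro t ht p ⟨g, hg⟩
    have h1 : ContMDiffAt 𝓘(ℝ, E) 𝓘(ℝ, E) ∞ (fun q => g⁻¹ • φ t (g • q)) p :=
      (contMDiff_smul_left E F g⁻¹).contMDiffAt.comp p
        (((hφs t ht).contMDiffAt (hU.mem_nhds hg)).comp p (contMDiff_smul_left E F g).contMDiffAt)
    exact h1.congr_of_eventuallyEq ((hev g p hg).mono fun q hq => key g q hq t ht)
  · rintro t ht p ⟨g, hg⟩
    have h1 : ContinuousAt (fun z : ℝ × P => g⁻¹ • Function.uncurry φ (z.1, g • z.2)) (t, p) := by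
      refine (hgc g⁻¹).continuousAt.comp ?_
      refine ContinuousAt.comp (f := fun z : ℝ × P => (z.1, g • z.2)) (hφc.continuousAt
        (prod_mem_nhds (Ioo_mem_nhds ht.1 ht.2) (hU.mem_nhds hg))) ?_
      exact (continuous_fst.prodMk ((hgc g).comp continuous_snd)).continuousAt
    refine h1.congr ?_
    rw [nhds_prod_eq]
    filter_upwards [Filter.prod_mem_prod (Ioo_mem_nhds ht.1 ht.2) (hev g p hg)] with z hz
    exact (key g z.2 hz.2 z.1 hz.1).symm
  · rintro g p ⟨k, hk⟩ t ht
    rw [key k p hk t ht, key (k * g⁻¹) (g • p) (by simpa [mul_smul] using hk) t ht]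
    simp [mul_smul]

end InvariantFlow

/-! ### Local flows on the orbit space -/

section OrbitSpace

variable {E : Type*} [NormedAddCommGroup E] [NormedSpace ℝ E] [FiniteDimensional ℝ E]
  {P : Type*} [TopologicalSpace P] [T2Space P] [ChartedSpace E P] [IsManifold 𝓘(ℝ, E) ∞ P]
  {F : Type*} [NormedAddCommGroup F] [NormedSpace ℝ F] [FiniteDimensional ℝ F]
  {G : Type*} [TopologicalSpace G] [T2Space G] [ChartedSpace F G] [Group G]
  [LieGroup 𝓘(ℝ, F) ∞ G] [MulAction G P] [ContMDiffSMul 𝓘(ℝ, F) 𝓘(ℝ, E) ∞ G P]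
  [ProperSMul G P]

variable (P G) in
theorem isOpenQuotientMap_orbitMap : IsOpenQuotientMap (orbitMap P G) :=
  MulAction.isOpenQuotientMap_quotientMk

omit [FiniteDimensional ℝ E] [T2Space P] [T2Space G] [ProperSMul G P] [TopologicalSpace G]
  [ChartedSpace F G] [LieGroup 𝓘(ℝ, F) ∞ G] [ContMDiffSMul 𝓘(ℝ, F) 𝓘(ℝ, E) ∞ G P]
  [FiniteDimensional ℝ F] [TopologicalSpace P] [ChartedSpace E P] [IsManifold 𝓘(ℝ, E) ∞ P] in
theorem orbitMap_smul (g : G) (p : P) : orbitMap P G (g • p) = orbitMap P G p :=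
  Quotient.sound (MulAction.mem_orbit p g)

theorem orbitMap_eq_iff {p q : P} : orbitMap P G p = orbitMap P G q ↔ ∃ g : G, g • q = p := by
  rw [orbitMap, orbitMap, Quotient.eq]
  rfl

theorem continuous_of_mem_orbitSpaceFunctions {f : MulAction.orbitRel.Quotient G P → ℝ}
    (hf : f ∈ orbitSpaceFunctions E P G) : Continuous f :=
  (isOpenQuotientMap_orbitMap P G).isQuotientMap.continuous_iff.2 (ContMDiff.continuous hf)

variable (E F) in
include F in
theorem exists_orbitSpaceFunction_support (x : MulAction.orbitRel.Quotient G P)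
    (O : Set (MulAction.orbitRel.Quotient G P)) (hO : O ∈ 𝓝 x) :
    ∃ f ∈ orbitSpaceFunctions E P G, f x ≠ 0 ∧ Function.support f ⊆ O := by
  obtain ⟨p, rfl⟩ := (isOpenQuotientMap_orbitMap P G).surjective x
  obtain ⟨V, hVO, hV, hpV⟩ := mem_nhds_iff.1 hO
  obtain ⟨κ, hκ, hκ1, hκS⟩ := exists_invariant_cutoff (E := E) F
    (hV.preimage (isOpenQuotientMap_orbitMap P G).continuous)
    (fun g q (hq : orbitMap P G q ∈ V) => by
      rw [Set.mem_preimage, orbitMap_smul]; exact hq) hpV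
  refine ⟨_, ((pullbackEquiv E P G).symm ⟨κ, hκ⟩).2, ?_, fun y hy => ?_⟩
  · have h1 : κ p = 1 := hκ1.self_of_nhds
    exact (h1.trans_ne one_ne_zero : κ p ≠ 0)
  · obtain ⟨q, rfl⟩ := (isOpenQuotientMap_orbitMap P G).surjective y
    exact hVO (hκS (subset_tsupport κ (show κ q ≠ 0 from hy)))

variable (F) in
include F in
-- Where κ = 1, `Y` and `V` act alike on invariant functions, so the equivariant flow of `Y`
-- projects to a local flow of `D`.
theorem exists_localFlow_orbitSpace
    {D : Derivation ℝ (orbitSpaceFunctions E P G) (orbitSpaceFunctions E P G)}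
    {V Y : ∀ p : P, TangentSpace 𝓘(ℝ, E) p}
    (hD : ∀ (k : orbitSpaceFunctions E P G) (p : P),
      (D k).1 (orbitMap P G p) = diff (E := E) (k.1 ∘ orbitMap P G) p (V p))
    (hY : ContMDiff 𝓘(ℝ, E) 𝓘(ℝ, E).tangent ∞ (fun p => (⟨p, Y p⟩ : TangentBundle 𝓘(ℝ, E) P)))
    (hYG : ∀ (g : G) (p : P), Y (g • p) = smulDiff g p (Y p)) {κ : P → ℝ}
    (hκ : κ ∈ invariantFunctions E P G) {p₀ : P} (hκ1 : κ =ᶠ[𝓝 p₀] 1)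
    (hYκ : ∀ k ∈ invariantFunctions E P G, ∀ p,
      diff (E := E) k p (Y p) = κ p * diff (E := E) k p (V p)) :
    ∃ S ε Φ, orbitMap P G p₀ ∈ S ∧ IsLocalFlow D S ε Φ := by
  have hρ := isOpenQuotientMap_orbitMap P G
  have hinv : ∀ f : orbitSpaceFunctions E P G, f.1 ∘ orbitMap P G ∈ invariantFunctions E P G :=
    fun f => (pullbackEquiv E P G f).2
  obtain ⟨O, hOκ, hO, hpO⟩ := mem_nhds_iff.1 hκ1
  -- The saturation of `O`; κ is invariant, so it still equals 1 there.
  let O' : Set P := orbitMap P G ⁻¹' (orbitMap P G '' O)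
  have hO' : IsOpen O' := (hρ.isOpenMap O hO).preimage hρ.continuous
  have hO'κ : ∀ p ∈ O', κ p = 1 := by
    rintro p ⟨q, hq, hqp⟩
    obtain ⟨g, rfl⟩ := orbitMap_eq_iff.1 hqp
    rw [← hκ.2 g p]
    exact hOκ hq
  obtain ⟨ε, hε, S, hS, hpS, hSG, ψ, hψ0, hψs, hψc, hψY, hψO, hψG⟩ := exists_equivariant_flow F
    hY hYG hO' (fun g q (hq : orbitMap P G q ∈ orbitMap P G '' O) => by
      rw [Set.mem_preimage, orbitMap_smul]; exact hq) (p₀ := p₀) ⟨p₀, hpO, rfl⟩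
  have h0 : (0 : ℝ) ∈ Set.Ioo (-ε) ε := ⟨by linarith, hε⟩
  let Φ : ℝ → MulAction.orbitRel.Quotient G P → MulAction.orbitRel.Quotient G P :=
    fun t x => orbitMap P G (ψ t x.out)
  have hΦ : ∀ p ∈ S, ∀ t ∈ Set.Ioo (-ε) ε, Φ t (orbitMap P G p) = orbitMap P G (ψ t p) := by
    intro p hp t ht
    obtain ⟨g, hg⟩ := orbitMap_eq_iff.1 (Quotient.out_eq (orbitMap P G p))
    simp only [Φ]
    rw [← hg, hψG g p hp t ht, orbitMap_smul]
  -- Uniqueness on the intersection of the time interval with its translate by -t, which contains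
  -- both 0 and `s`.
  have hadd : ∀ p ∈ S, ∀ s ∈ Set.Ioo (-ε) ε, ∀ t ∈ Set.Ioo (-ε) ε, s + t ∈ Set.Ioo (-ε) ε →
      ψ t p ∈ S → ψ s (ψ t p) = ψ (s + t) p := by
    intro p hp s hs t ht hst hptS
    have hshift := (hψY p hp).comp_add t
    have e : {r : ℝ | r + t ∈ Set.Ioo (-ε) ε} = Set.Ioo (-ε - t) (ε - t) := by
      ext r
      simp only [Set.mem_ofPred_eq, Set.mem_Ioo, sub_lt_iff_lt_add, lt_sub_iff_add_lt]
    rw [e] at hshift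
    have h1 : ∀ r : ℝ, r ∈ Set.Ioo (-ε) ε → r + t ∈ Set.Ioo (-ε) ε →
        r ∈ Set.Ioo (max (-ε) (-ε - t)) (min ε (ε - t)) := fun r hr hrt =>
      ⟨max_lt hr.1 (by linarith [hrt.1]), lt_min hr.2 (by linarith [hrt.2])⟩
    exact eqOn_of_isMIntegralCurveOn hY (h1 0 h0 (by rwa [zero_add]))
      ((hψY _ hptS).mono (Set.Ioo_subset_Ioo (le_max_left _ _) (min_le_left _ _)))
      (hshift.mono (Set.Ioo_subset_Ioo (le_max_right _ _) (min_le_right _ _)))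
      (by simp [hψ0 _ hptS]) (h1 s hs hst)
  have hmem : ∀ {p : P}, orbitMap P G p ∈ orbitMap P G '' S → p ∈ S := by
    rintro p ⟨q, hq, hqp⟩
    obtain ⟨g, rfl⟩ := orbitMap_eq_iff.1 hqp.symm
    exact hSG g q hq
  refine ⟨orbitMap P G '' S, ε, Φ, ⟨p₀, hpS, rfl⟩, ⟨hρ.isOpenMap S hS, hε, ?_, ?_, ?_, ?_, ?_⟩⟩
  · rintro _ ⟨p, hp, rfl⟩
    rw [hΦ p hp 0 h0, hψ0 p hp]
  · rintro _ ⟨p, hp, rfl⟩ t ht f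
    have h1 := (hψY p hp t ht).hasMFDerivAt (Ioo_mem_nhds ht.1 ht.2)
    have h2 := (((hinv f).1.mdifferentiable (by simp) (ψ t p)).hasMFDerivAt.comp t h1)
    have h3 : HasDerivAt (fun s => (f.1 ∘ orbitMap P G) (ψ s p))
        (diff (E := E) (f.1 ∘ orbitMap P G) (ψ t p) (Y (ψ t p))) t := by
      let B : ℝ →L[ℝ] ℝ := (diff (E := E) (f.1 ∘ orbitMap P G) (ψ t p)).comp
        ((1 : ℝ →L[ℝ] ℝ).smulRight (Y (ψ t p)))
      have h4 : HasFDerivAt (fun s => (f.1 ∘ orbitMap P G) (ψ s p)) B t :=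
        hasMFDerivAt_iff_hasFDerivAt.1 h2
      refine h4.hasDerivAt.congr_deriv ?_
      have h5 : diff (E := E) (f.1 ∘ orbitMap P G) (ψ t p) ((1 : ℝ) • Y (ψ t p)) =
        diff (E := E) (f.1 ∘ orbitMap P G) (ψ t p) (Y (ψ t p)) := by rw [one_smul]
      exact h5
    rw [hYκ _ (hinv f), hO'κ _ (hψO p hp t ht), one_mul, ← hD, ← hΦ p hp t ht] at h3
    refine h3.congr_of_eventuallyEq ?_
    filter_upwards [Ioo_mem_nhds ht.1 ht.2] with s hs
    rw [hΦ p hp s hs, Function.comp_apply]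
  · rintro _ ⟨p, hp, rfl⟩ t ht
    -- Time times the orbit map is again an open quotient map, so joint continuity can be checked
    -- upstairs.
    have h1 := (IsOpenQuotientMap.id.prodMap hρ).map_nhds_eq ((t, p) : ℝ × P)
    have h2 : Filter.Tendsto (Function.uncurry Φ ∘ Prod.map id (orbitMap P G)) (𝓝 (t, p))
        (𝓝 (Φ t (orbitMap P G p))) := by
      rw [hΦ p hp t ht]
      refine Filter.Tendsto.congr' ?_ ((hρ.continuous.tendsto _).comp (hψc t ht p hp).tendsto)
      rw [nhds_prod_eq]
      filter_upwards [Filter.prod_mem_prod (Ioo_mem_nhds ht.1 ht.2) (hS.mem_nhds hp)] with z hz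
      exact (hΦ z.2 hz.2 z.1 hz.1).symm
    rw [← Filter.tendsto_map'_iff, h1] at h2
    exact h2
  · rintro _ ⟨p, hp, rfl⟩ t ht f hf
    -- The function f ∘ Φ_t is controlled only over `S`; an invariant cut-off extends its germ to an
    -- element of the algebra.
    obtain ⟨k, hk, hkf⟩ := exists_invariantFunction_eventuallyEq (E := E) F hS hSG hp
      (u := fun q => f (orbitMap P G (ψ t q)))
      (fun q hq => ContMDiffAt.comp (g := f ∘ orbitMap P G) q
        (ContMDiff.contMDiffAt (hinv ⟨f, hf⟩).1) (hψs t ht q hq))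
      (fun g q hq => by rw [hψG g q hq t ht, orbitMap_smul])
    refine ⟨_, ((pullbackEquiv E P G).symm ⟨k, hk⟩).2, ?_⟩
    rw [← hρ.map_nhds_eq, Filter.EventuallyEq, Filter.eventually_map]
    filter_upwards [hkf, hS.mem_nhds hp] with q hq hqS
    rw [Function.comp_apply, hΦ q hqS t ht]
    exact hq.symm
  · rintro _ ⟨p, hp, rfl⟩ s hs t ht hst hptS
    rw [hΦ p hp t ht] at hptS ⊢
    rw [hΦ _ (hmem hptS) s hs, hΦ p hp _ hst, hadd p hp s hs t ht hst (hmem hptS)]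

end OrbitSpace

/-! ### The reduced derivations -/

section ReducedDerivation

variable {E : Type*} [NormedAddCommGroup E] [NormedSpace ℝ E] [FiniteDimensional ℝ E]
  {P : Type*} [TopologicalSpace P] [ChartedSpace E P] [IsManifold 𝓘(ℝ, E) ∞ P]
  {G : Type*} [Group G] [MulAction G P]

/-- The bracket with `h`, as a derivation of the invariant functions that it preserves. -/
def bracketDerivation (Ω : SymplecticForm E P) (h : P → ℝ)
    (hmem : ∀ k ∈ invariantFunctions E P G, bracket Ω k h ∈ invariantFunctions E P G) :
    Derivation ℝ (invariantFunctions E P G) (invariantFunctions E P G) :=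
  have hd : ∀ (k : invariantFunctions E P G) (p : P),
      HasMFDerivAt 𝓘(ℝ, E) 𝓘(ℝ, ℝ) k.1 p (diff (E := E) k.1 p) := fun k p =>
    (k.2.1.mdifferentiable (by simp) p).hasMFDerivAt
  Derivation.mk'
    { toFun := fun k => ⟨bracket Ω k.1 h, hmem k.1 k.2⟩
      map_add' := fun k l => Subtype.ext (funext fun p => by
        change bracket Ω (k.1 + l.1) h p = bracket Ω k.1 h p + bracket Ω l.1 h p
        rw [bracket_eq, bracket_eq, bracket_eq]
        exact congrArg (fun A : E →L[ℝ] ℝ => A (hamiltonianVF Ω h p))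
          ((hd k p).add (hd l p)).mfderiv)
      map_smul' := fun c k => Subtype.ext (funext fun p => by
        change bracket Ω (c • k.1) h p = c • bracket Ω k.1 h p
        rw [bracket_eq, bracket_eq]
        exact congrArg (fun A : E →L[ℝ] ℝ => A (hamiltonianVF Ω h p))
          ((hd k p).const_smul c).mfderiv) }
    fun k l => Subtype.ext (funext fun p => by
      change bracket Ω (k.1 * l.1) h p = k.1 p * bracket Ω l.1 h p + l.1 p * bracket Ω k.1 h p
      rw [bracket_eq, bracket_eq, bracket_eq]
      exact congrArg (fun A : E →L[ℝ] ℝ => A (hamiltonianVF Ω h p)) ((hd k p).mul (hd l p)).mfderiv)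

/-- A derivation of the invariant functions, seen on the orbit space. -/
def orbitSpaceDerivation
    (δ : Derivation ℝ (invariantFunctions E P G) (invariantFunctions E P G)) :
    Derivation ℝ (orbitSpaceFunctions E P G) (orbitSpaceFunctions E P G) :=
  let e := pullbackEquiv E P G
  Derivation.mk' (e.symm.toLinearMap ∘ₗ δ.toLinearMap ∘ₗ e.toLinearMap) fun k l => by
    change e.symm (δ (e (k * l))) = k • e.symm (δ (e l)) + l • e.symm (δ (e k))
    simp [smul_eq_mul]

theorem isPoissonMorphism_bracketDerivation {Ω : SymplecticForm E P} {h : P → ℝ}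
    (hh : SmoothFun (E := E) h)
    (hmem : ∀ k ∈ invariantFunctions E P G, bracket Ω k h ∈ invariantFunctions E P G)
    (hbr : ∀ k ∈ invariantFunctions E P G, ∀ l ∈ invariantFunctions E P G,
      bracket Ω k l ∈ invariantFunctions E P G) :
    IsPoissonMorphism Ω (bracketDerivation Ω h hmem) := fun k l =>
  ⟨hbr k.1 k.2 l.1 l.2, bracket_jacobi Ω k.2.1 l.2.1 hh⟩

end ReducedDerivation

end NotQuiteHamiltonian

end

/-! ### The main theorem -/

theorem mainTheorem3
    {E : Type*} [NormedAddCommGroup E] [NormedSpace ℝ E] [FiniteDimensional ℝ E]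
    {P : Type*} [TopologicalSpace P] [T2Space P] [SecondCountableTopology P]
    [ChartedSpace E P] [IsManifold 𝓘(ℝ, E) ∞ P]
    {F : Type*} [NormedAddCommGroup F] [NormedSpace ℝ F] [FiniteDimensional ℝ F]
    {G : Type*} [TopologicalSpace G] [T2Space G] [SecondCountableTopology G]
    [ChartedSpace F G] [Group G] [LieGroup 𝓘(ℝ, F) ∞ G] [ConnectedSpace G]
    [MulAction G P] [ContMDiffSMul 𝓘(ℝ, F) 𝓘(ℝ, E) ∞ G P] [ProperSMul G P]
    (Ω : NotQuiteHamiltonian.SymplecticForm E P)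
    (j : P → (GroupLieAlgebra 𝓘(ℝ, F) G →L[ℝ] ℝ))
    (hj : NotQuiteHamiltonian.IsHamiltonianAction Ω j)
    {n : ℕ} (b : Module.Basis (Fin n) ℝ (GroupLieAlgebra 𝓘(ℝ, F) G))
    (h : P → ℝ) (hh : NotQuiteHamiltonian.SmoothFun (E := E) h)
    (f : Fin n → (Fin n → ℝ) → ℝ)
    (hf : ∀ (a : Fin n) (p : P), ContDiffAt ℝ ∞ (f a) (fun c => j p (b c)))
    (hjh : ∀ (a : Fin n) (p : P),
      NotQuiteHamiltonian.bracket Ω (fun q => j q (b a)) h p = f a (fun c => j p (b c))) :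
    (∀ (g : G) (p : P),
      NotQuiteHamiltonian.pushforward g (NotQuiteHamiltonian.hamiltonianVF Ω h) p
        - NotQuiteHamiltonian.hamiltonianVF Ω h p
          ∈ NotQuiteHamiltonian.orbitTangentSpace (F := F) G p) ∧
    ∃ (X : Derivation ℝ (NotQuiteHamiltonian.orbitSpaceFunctions E P G)
        (NotQuiteHamiltonian.orbitSpaceFunctions E P G))
      (δ : Derivation ℝ (NotQuiteHamiltonian.invariantFunctions E P G)
        (NotQuiteHamiltonian.invariantFunctions E P G)),
      (∀ (k : NotQuiteHamiltonian.orbitSpaceFunctions E P G) (p : P),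
        (X k).1 (NotQuiteHamiltonian.orbitMap P G p) =
          NotQuiteHamiltonian.diff (E := E) (k.1 ∘ NotQuiteHamiltonian.orbitMap P G) p
            (NotQuiteHamiltonian.hamiltonianVF Ω h p)) ∧
      NotQuiteHamiltonian.IsVectorField X ∧
      (∀ k : NotQuiteHamiltonian.invariantFunctions E P G,
        (δ k).1 = NotQuiteHamiltonian.bracket Ω k.1 h) ∧
      NotQuiteHamiltonian.IsPoissonMorphism Ω δ ∧
      (h ∉ NotQuiteHamiltonian.invariantFunctions E P G →
        NotQuiteHamiltonian.IsOuterPoissonMorphism Ω h δ) ∧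
      (∀ (c : ℝ → MulAction.orbitRel.Quotient G P) (I : Set ℝ), I.OrdConnected → (0 : ℝ) ∈ I →
        (NotQuiteHamiltonian.IsIntegralCurve X c I ↔
          ∀ k : NotQuiteHamiltonian.invariantFunctions E P G, ∀ t ∈ I,
            HasDerivWithinAt
              (fun s => ((NotQuiteHamiltonian.pullbackEquiv E P G).symm k).1 (c s))
              (((NotQuiteHamiltonian.pullbackEquiv E P G).symm (δ k)).1 (c t)) I t)) := by
  have hbr : ∀ k ∈ NotQuiteHamiltonian.invariantFunctions E P G,
      ∀ l ∈ NotQuiteHamiltonian.invariantFunctions E P G,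
      NotQuiteHamiltonian.bracket Ω k l ∈ NotQuiteHamiltonian.invariantFunctions E P G :=
    fun k hk l hl => NotQuiteHamiltonian.bracket_mem_invariantFunctions hj hk hl
  have htangent := NotQuiteHamiltonian.pushforward_sub_mem_orbitTangentSpace hj hh hf hjh
  have hmem : ∀ k ∈ NotQuiteHamiltonian.invariantFunctions E P G,
      NotQuiteHamiltonian.bracket Ω k h ∈ NotQuiteHamiltonian.invariantFunctions E P G :=
    fun k hk =>
      NotQuiteHamiltonian.bracket_mem_invariantFunctions_of_diff (F := F) hk hh htangent
  let δ := NotQuiteHamiltonian.bracketDerivation Ω h hmem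
  -- Since `X` is `δ` carried over by the pull-back isomorphism, the last equivalence only renames
  -- the test functions.
  let X := NotQuiteHamiltonian.orbitSpaceDerivation δ
  have hX : ∀ (k : NotQuiteHamiltonian.orbitSpaceFunctions E P G) (p : P),
      (X k).1 (NotQuiteHamiltonian.orbitMap P G p) =
        NotQuiteHamiltonian.diff (E := E) (k.1 ∘ NotQuiteHamiltonian.orbitMap P G) p
          (NotQuiteHamiltonian.hamiltonianVF Ω h p) :=
    fun k p => NotQuiteHamiltonian.bracket_eq Ω _ h p
  have hpoisson := NotQuiteHamiltonian.isPoissonMorphism_bracketDerivation hh hmem hbr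
  have hvector : NotQuiteHamiltonian.IsVectorField X := by
    refine NotQuiteHamiltonian.isVectorField_of_localFlow
      (NotQuiteHamiltonian.exists_orbitSpaceFunction_support E F)
      (fun k hk => NotQuiteHamiltonian.continuous_of_mem_orbitSpaceFunctions hk) fun x => ?_
    obtain ⟨p, rfl⟩ := (NotQuiteHamiltonian.isOpenQuotientMap_orbitMap P G).surjective x
    obtain ⟨Y, hY, hYG, κ, hκ, hκ1, hYκ⟩ :=
      NotQuiteHamiltonian.exists_invariant_vectorField hj hh hf hjh p
    exact NotQuiteHamiltonian.exists_localFlow_orbitSpace F hX hY hYG hκ hκ1 hYκ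
  refine ⟨htangent, X, δ, hX, hvector, fun _ => rfl, hpoisson,
    fun hout => ⟨hh, hpoisson, fun _ => rfl, hout⟩, fun c I hI h0 => ⟨fun hc k t ht => ?_,
    fun hc => ⟨hI, h0, fun k t ht => ?_⟩⟩⟩
  · exact hc.hasDeriv ((NotQuiteHamiltonian.pullbackEquiv E P G).symm k) t ht
  · have hk := hc (NotQuiteHamiltonian.pullbackEquiv E P G k) t ht
    rw [AlgEquiv.symm_apply_apply] at hk
    exact hk
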